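/- **Setting.** For $x\in\mathbb R^3$ let $x^\times$ be the matrix with $x^\times y=x\times y$; for $R\in SO(3)$ let $|R|_I=\big(\tfrac14\mathrm{tr}(I_3-R)\big)^{1/2}$. A rigid body moves according to $$\dot R=R\,\omega^\times,\qquad \dot p=v,\qquad \dot v=g+Ra,\qquad R\in SO(3),\ p,v\in\mathbb R^3,$$ with a constant (unknown) vector $g\in\mathbb R^3$, angular velocity $\omega(t)$ and locally integrable apparent acceleration $a(t)$, $t\ge 0$. Landmarks $p_1,\dots,p_N\in\mathbb R^3$, at least three of which are not collinear, give measurements $y_i=R^\top(p_i-p)$ at discrete times $t_1<t_2<\dots$ with $0\le t_1\le T_M$ and $T_m\le t_{j+1}-t_j\le T_M$, where $0<T_m\le T_M<\infty$. The times are generated by a timer $\tau\in[0,T_M]$ with $\dot\tau=-1$ and, when $\tau=0$, the jump $\tau^+\in[T_m,T_M]$. Fix weights $k_i>0$ with $\sum_i k_i=1$ and put $p_c=\sum_i k_ip_i$, $M=\sum_i k_i(p_i-p_c)(p_i-p_c)^\top$, $\bar M=\frac12(\mathrm{tr}(M)I_3-M)$, $\varsigma_M=\lambda_{\min}(\bar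 M)/\lambda_{\max}(\bar M)$. **Observer.** With $\sigma_R=\frac12\sum_i k_i(p_i-p_c)^\times(p_i-\hat p-\hat Ry_i)$ and $y=\sum_i k_i(p_i-\hat p-\hat Ry_i)$, the observer with states $\hat R\in SO(3)$, $\eta,\hat p,\hat v,\hat g\in\mathbb R^3$ and $P\in\mathbb R^{9\times 9}$ flows for $\tau\in[0,T_M]$ by $$\dot{\hat R}=\hat R(\omega+\hat R^\top\eta)^\times,\quad \dot\eta=0,\quad \dot{\hat p}=\eta^\times(\hat p-p_c)+\hat v,\quad \dot{\hat v}=\eta^\times\hat v+\hat g+\hat Ra,\quad \dot{\hat g}=\eta^\times\hat g,\quad \dot P=A_tP+PA_t^\top+V_t,$$ and jumps when $\tau=0$ by $$\hat R^+=\hat R,\quad \eta^+=k_R\sigma_R,\quad \hat p^+=\hat p+\hat RK_p\hat R^\top y,\quad \hat v^+=\hat v+\hat RK_v\hat R^\top y,\quad \hat g^+=\hat g+\hat RK_g\hat R^\top y,$$ $$P^+=P-PC^\top(CPC^\top+Q_t)^{-1}CP,$$ where $$\begin{bmatrix}K_p\\K_v\\K_g\end{bmatrix}=K=PC^\top(CPC^\top+Q_t)^{-1},\quad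 A_t=\begin{bmatrix}-\omega^\times&I_3&0\\0&-\omega^\times&I_3\\0&0&-\omega^\times\end{bmatrix},\quad C=\begin{bmatrix}I_3&0&0\end{bmatrix},$$ and $P(0)$ is a fixed positive definite matrix. The errors are $\tilde R=R\hat R^\top$, $\tilde p=p-\tilde R\hat p-(I_3-\tilde R)p_c$, $\tilde v=v-\tilde R\hat v$, $\tilde g=g-\tilde R\hat g$, $\mathsf x=[\tilde p^\top R,\ \tilde v^\top R,\ \tilde g^\top R]^\top\in\mathbb R^9$, and $$\bar{\mathcal A}=\{(\tilde R,\eta,\mathsf x,\tau)\in SO(3)\times\mathbb R^3\times\mathbb R^9\times[0,T_M]:\ \tilde R=I_3,\ \eta=0,\ \mathsf x=0\}.$$ The distance $|\cdot|_{\bar{\mathcal A}}$ to $\bar{\mathcal A}$ is the infimum over $(\bar R,\bar\eta,\bar{\mathsf x},\bar\tau)\in\bar{\mathcal A}$ of $\big(|\tilde R\bar R^\top|_I^2+\|\eta-\bar\eta\|^2+\|\mathsf x-\bar{\mathsf x}\|^2+|\tau-\bar\tau|^2\big)^{1/2}$. **Theorem.** Assume that $\omega(t)$ and $V_t\in\mathbb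 R^{9\times 9}$ are continuous and bounded on $[0,\infty)$, that $Q_t\in\mathbb R^{3\times3}$ is bounded on $[0,\infty)$, and that $V_t$ and $Q_t$ are (symmetric and) uniformly positive definite. Then for every $0<\epsilon<1$ there exist constants $\eta^*,k_R^*>0$ such that for every $0<k_R<k_R^*$ the set $\bar{\mathcal A}$ is exponentially stable for the hybrid closed loop of the rigid body and the observer, with all initial conditions satisfying $|\tilde R(0)|_I\le\epsilon\sqrt{\varsigma_M}$, $\|\eta(0)\|\le\eta^*$ and $\mathsf x(0)\in\mathbb R^9$ arbitrary in its domain of exponential attraction. That is, there are $\kappa,\lambda,\mu>0$ such that every maximal solution whose initial condition satisfies these bounds, or has distance less than $\mu$ to $\bar{\mathcal A}$, is complete and its error state $x_1=(\tilde R,\eta,\mathsf x,\tau)$ satisfies $$|x_1(t,j)|_{\bar{\mathcal A}}\le\kappa\,e^{-\lambda(t+j)}\,|x_1(0,0)|_{\bar{\mathcal A}}\qquad\text{for all }(t,j)\text{ in the hybrid time domain of the solution.}$$ -/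

import Mathlib

open Set MeasureTheory Matrix

namespace HybridNav

/-! ### Hybrid time domains, hybrid arcs and solutions of hybrid systems -/

/-- Compact hybrid time domains: `⋃_{j < J} [s_j, s_{j+1}] × {j}` with
`0 = s_0 ≤ s_1 ≤ ⋯ ≤ s_J`. -/
def IsCompactHybridTimeDomain (E : Set (ℝ × ℕ)) : Prop :=
  ∃ (J : ℕ) (s : ℕ → ℝ), s 0 = 0 ∧ (∀ j < J, s j ≤ s (j + 1)) ∧
    E = {q | q.2 < J ∧ q.1 ∈ Icc (s q.2) (s (q.2 + 1))}

/-- Hybrid time domains: every truncation at one of its points is a compact hybrid time domain.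
Finitely or infinitely many intervals are allowed, and a last interval may be half-open. -/
def IsHybridTimeDomain (E : Set (ℝ × ℕ)) : Prop :=
  ((0 : ℝ), 0) ∈ E ∧ (∀ q ∈ E, 0 ≤ q.1) ∧
    ∀ q ∈ E, IsCompactHybridTimeDomain (E ∩ {r | r.1 ≤ q.1 ∧ r.2 ≤ q.2})

/-- A hybrid system with state in `X`, whose flow and jump maps may depend on the time `t`. -/
structure HybridSystem (X : Type*) where
  flowSet : Set X
  flowMap : ℝ → X → X
  jumpSet : Set X
  jumpMap : ℝ → X → Set X

/-- A function of hybrid time; only its values on `dom` matter. -/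
structure HybridArc (X : Type*) where
  dom : Set (ℝ × ℕ)
  val : ℝ → ℕ → X

/-- The domain of an arc is unbounded, that is, `t + j` is unbounded on it. -/
def HybridArc.IsComplete {X : Type*} (φ : HybridArc X) : Prop :=
  ∀ b : ℝ, ∃ q ∈ φ.dom, b ≤ q.1 + (q.2 : ℝ)

section Solutions

variable {X : Type*} [NormedAddCommGroup X] [NormedSpace ℝ X]

/-- `φ` is a solution: on each interval `I_j = {t | (t, j) ∈ dom φ}` it is locally absolutely
continuous and satisfies the differential equation almost everywhere; it takes its values in the
flow set or the jump set, and lies in the flow set at the interior times of `I_j`; at each jump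
it leaves a point of the jump set according to the jump map. -/
structure HybridSystem.IsSolution (H : HybridSystem X) (φ : HybridArc X) : Prop where
  timeDomain : IsHybridTimeDomain φ.dom
  mem : ∀ q ∈ φ.dom, φ.val q.1 q.2 ∈ H.flowSet ∪ H.jumpSet
  mem_flow : ∀ j : ℕ, ∀ t ∈ interior {t : ℝ | (t, j) ∈ φ.dom}, φ.val t j ∈ H.flowSet
  absCont : ∀ (j : ℕ) (a b : ℝ), (a, j) ∈ φ.dom → (b, j) ∈ φ.dom →
    AbsolutelyContinuousOnInterval (fun t => φ.val t j) a b
  flow : ∀ j : ℕ, ∀ᵐ t : ℝ, (t, j) ∈ φ.dom →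
    HasDerivAt (fun s => φ.val s j) (H.flowMap t (φ.val t j)) t
  jump : ∀ (t : ℝ) (j : ℕ), (t, j) ∈ φ.dom → (t, j + 1) ∈ φ.dom →
    φ.val t j ∈ H.jumpSet ∧ φ.val t (j + 1) ∈ H.jumpMap t (φ.val t j)

/-- A maximal solution: it has no extension to a larger hybrid time domain. -/
def HybridSystem.IsMaximalSolution (H : HybridSystem X) (φ : HybridArc X) : Prop :=
  H.IsSolution φ ∧ ∀ ψ : HybridArc X, H.IsSolution ψ → φ.dom ⊆ ψ.dom →
    (∀ q ∈ φ.dom, ψ.val q.1 q.2 = φ.val q.1 q.2) → ψ.dom = φ.dom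

/-- Exponential stability of the set from which `d` measures the distance, for the solutions that
start in the set `X₀` of admissible initial states. The estimate holds for all solutions that
start close to the set (this is local exponential stability), and with the same constants for all
that start in `B` (so that `B` belongs to the domain of exponential attraction). -/
def HybridSystem.IsExponentiallyStable (H : HybridSystem X) (d : X → ℝ) (X₀ B : Set X) : Prop :=
  ∃ κ > (0 : ℝ), ∃ lam > (0 : ℝ), ∃ μ > (0 : ℝ),
    ∀ φ : HybridArc X, H.IsMaximalSolution φ → φ.val 0 0 ∈ X₀ →
      (d (φ.val 0 0) < μ ∨ φ.val 0 0 ∈ B) →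
        φ.IsComplete ∧
        ∀ q ∈ φ.dom, d (φ.val q.1 q.2) ≤
          κ * Real.exp (-lam * (q.1 + (q.2 : ℝ))) * d (φ.val 0 0)

end Solutions

/-! ### Vectors and rotations -/

abbrev Vec3 := Fin 3 → ℝ

abbrev Mat3 := Matrix (Fin 3) (Fin 3) ℝ

/-- Index set of the `9`-dimensional error, split into three blocks of size `3`. -/
abbrev Idx9 := Fin 3 ⊕ (Fin 3 ⊕ Fin 3)

abbrev Mat9 := Matrix Idx9 Idx9 ℝ

/-- Euclidean norm. -/
noncomputable def enorm2 {ι : Type*} [Fintype ι] (x : ι → ℝ) : ℝ :=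
  ‖(WithLp.toLp 2 x : EuclideanSpace ℝ ι)‖

/-- The matrix `x^×` of the cross product with `x`. -/
def skew (x : Vec3) : Mat3 :=
  !![0, -x 2, x 1; x 2, 0, -x 0; -x 1, x 0, 0]

theorem skew_mulVec (x y : Vec3) : skew x *ᵥ y = crossProduct x y := by
  ext i
  fin_cases i <;> simp [skew, cross_apply, Matrix.mulVec, dotProduct, Fin.sum_univ_three] <;> ring

/-- `SO(3)`. -/
def SO3 : Set Mat3 := {R | R * Rᵀ = 1 ∧ Rᵀ * R = 1 ∧ R.det = 1}

/-- The normalized attitude distance `|R|_I = (tr(I - R) / 4)^{1/2}`. -/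
noncomputable def attDist (R : Mat3) : ℝ := Real.sqrt ((1 - R).trace / 4)

/-! ### Data of the estimation problem -/

/-- The data: `N` landmarks `p i` with weights `k i`, the bounds `Tm`, `TM` on the time between
measurements, the gravity vector `g`, the angular velocity `ω` and the apparent acceleration `a`
as functions of time, and the matrix functions `V`, `Q` and the initial value `P₀` of the
Riccati equation. -/
structure Setup (N : ℕ) where
  p : Fin N → Vec3
  k : Fin N → ℝ
  Tm : ℝ
  TM : ℝ
  g : Vec3
  ω : ℝ → Vec3
  a : ℝ → Vec3
  V : ℝ → Mat9
  Q : ℝ → Mat3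
  P₀ : Mat9

namespace Setup

variable {N : ℕ} (D : Setup N)

/-- Weighted center `p_c` of the landmarks. -/
noncomputable def pc : Vec3 := ∑ i, D.k i • D.p i

/-- `M = ∑ k_i (p_i - p_c) (p_i - p_c)ᵀ`. -/
noncomputable def M : Mat3 := ∑ i, D.k i • vecMulVec (D.p i - D.pc) (D.p i - D.pc)

/-- `M̄ = (tr(M) I - M) / 2`. -/
noncomputable def Mbar : Mat3 := (1 / 2 : ℝ) • (D.M.trace • (1 : Mat3) - D.M)

/-- `ς_M`: the quotient of the smallest and the largest eigenvalue of `M̄`. -/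
noncomputable def ςM : ℝ := sInf (spectrum ℝ D.Mbar) / sSup (spectrum ℝ D.Mbar)

/-- `A_t`. -/
def A (t : ℝ) : Mat9 :=
  fromBlocks (-skew (D.ω t)) (fromCols (1 : Mat3) (0 : Mat3))
    0 (fromBlocks (-skew (D.ω t)) (1 : Mat3) (0 : Mat3) (-skew (D.ω t)))

end Setup

/-- `C = [I 0 0]`. -/
def C : Matrix (Fin 3) Idx9 ℝ := fromCols (1 : Mat3) (0 : Matrix (Fin 3) (Fin 3 ⊕ Fin 3) ℝ)

/-- The gain `K = P Cᵀ (C P Cᵀ + Q)⁻¹`. -/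
noncomputable def gain (P : Mat9) (Q : Mat3) : Matrix Idx9 (Fin 3) ℝ :=
  P * Cᵀ * (C * P * Cᵀ + Q)⁻¹

/-- Row blocks `K_p`, `K_v`, `K_g` of a gain `K = [K_pᵀ, K_vᵀ, K_gᵀ]ᵀ`. -/
def gainP (K : Matrix Idx9 (Fin 3) ℝ) : Mat3 := K.toRows₁

def gainV (K : Matrix Idx9 (Fin 3) ℝ) : Mat3 := K.toRows₂.toRows₁

def gainG (K : Matrix Idx9 (Fin 3) ℝ) : Mat3 := K.toRows₂.toRows₂

/-! ### The interconnection of the rigid body and the observer -/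

/-- States `(R, p, v, R̂, η, p̂, v̂, ĝ, P, τ)`: attitude, position and velocity of the body, the
observer states, the Riccati matrix and the timer. -/
abbrev State :=
  Mat3 × Vec3 × Vec3 × Mat3 × Vec3 × Vec3 × Vec3 × Vec3 × Mat9 × ℝ

namespace Setup

variable {N : ℕ} (D : Setup N)

/-- Landmark measurements `y_i = Rᵀ (p_i - p)`. -/
def meas (R : Mat3) (p : Vec3) (i : Fin N) : Vec3 := Rᵀ *ᵥ (D.p i - p)

/-- Innovation `σ_R = (1/2) ∑ k_i (p_i - p_c)^× (p_i - p̂ - R̂ y_i)`, with measurements `y`. -/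
noncomputable def sigmaR (Rh : Mat3) (ph : Vec3) (y : Fin N → Vec3) : Vec3 :=
  (1 / 2 : ℝ) • ∑ i, D.k i • (skew (D.p i - D.pc) *ᵥ (D.p i - ph - Rh *ᵥ y i))

/-- Innovation `∑ k_i (p_i - p̂ - R̂ y_i)`, with measurements `y`. -/
def innov (Rh : Mat3) (ph : Vec3) (y : Fin N → Vec3) : Vec3 :=
  ∑ i, D.k i • (D.p i - ph - Rh *ᵥ y i)

/-- Flow map: rigid body kinematics, observer, Riccati differential equation, timer. -/
noncomputable def flowMap (t : ℝ) : State → State :=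
  fun (R, _p, v, Rh, η, ph, vh, gh, P, _τ) =>
    ( R * skew (D.ω t),
      v,
      D.g + R *ᵥ D.a t,
      Rh * skew (D.ω t + Rhᵀ *ᵥ η),
      0,
      skew η *ᵥ (ph - D.pc) + vh,
      skew η *ᵥ vh + gh + Rh *ᵥ D.a t,
      skew η *ᵥ gh,
      D.A t * P + P * (D.A t)ᵀ + D.V t,
      -1 )

/-- Jump map with attitude gain `kR`: the body does not jump, the observer is updated by the
measurements, `P` by the discrete Riccati equation, and the timer is reset in `[Tm, TM]`. -/
noncomputable def jumpMap (kR : ℝ) (t : ℝ) : State → Set State :=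
  fun (R, p, v, Rh, _η, ph, vh, gh, P, _τ) =>
    let K := gain P (D.Q t)
    let y := D.innov Rh ph (D.meas R p)
    {z | ∃ ν ∈ Icc D.Tm D.TM, z =
      ( R,
        p,
        v,
        Rh,
        kR • D.sigmaR Rh ph (D.meas R p),
        ph + (Rh * gainP K * Rhᵀ) *ᵥ y,
        vh + (Rh * gainV K * Rhᵀ) *ᵥ y,
        gh + (Rh * gainG K * Rhᵀ) *ᵥ y,
        P - P * Cᵀ * (C * P * Cᵀ + D.Q t)⁻¹ * C * P,
        ν )}

/-- Flow set: `R, R̂ ∈ SO(3)` and `τ ∈ [0, TM]`. -/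
def flowSet : Set State :=
  {z | match z with
    | (R, _, _, Rh, _, _, _, _, _, τ) => R ∈ SO3 ∧ Rh ∈ SO3 ∧ τ ∈ Icc 0 D.TM}

/-- Jump set: `R, R̂ ∈ SO(3)` and `τ = 0`. -/
def jumpSet : Set State :=
  {z | match z with
    | (R, _, _, Rh, _, _, _, _, _, τ) => R ∈ SO3 ∧ Rh ∈ SO3 ∧ τ = 0}

/-- The hybrid closed loop of the rigid body and the observer with attitude gain `kR`. -/
noncomputable def closedLoop (kR : ℝ) : HybridSystem State where
  flowSet := D.flowSet
  flowMap := D.flowMap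
  jumpSet := jumpSet
  jumpMap := D.jumpMap kR

end Setup

/-! ### Estimation errors -/

/-- Error states `(R̃, η, x, τ)`. -/
abbrev ErrState := Mat3 × Vec3 × (Idx9 → ℝ) × ℝ

/-- Distance of two error states. -/
noncomputable def errDist : ErrState → ErrState → ℝ :=
  fun (R₁, η₁, x₁, τ₁) (R₂, η₂, x₂, τ₂) =>
    Real.sqrt (attDist (R₁ * R₂ᵀ) ^ 2 + enorm2 (η₁ - η₂) ^ 2 + enorm2 (x₁ - x₂) ^ 2
      + (τ₁ - τ₂) ^ 2)

/-- Distance of an error state to a set. -/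
noncomputable def distToSet (S : Set ErrState) (e : ErrState) : ℝ := sInf (errDist e '' S)

namespace Setup

variable {N : ℕ} (D : Setup N)

/-- The error state of a state: `R̃ = R R̂ᵀ`, `p̃ = p - R̃ p̂ - (I - R̃) p_c`, `ṽ = v - R̃ v̂`,
`g̃ = g - R̃ ĝ` and `x = (Rᵀ p̃, Rᵀ ṽ, Rᵀ g̃)`. -/
noncomputable def err : State → ErrState :=
  fun (R, p, v, Rh, η, ph, vh, gh, _P, τ) =>
    let Rt := R * Rhᵀ
    let pt := p - Rt *ᵥ ph - (1 - Rt) *ᵥ D.pc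
    let vt := v - Rt *ᵥ vh
    let gt := D.g - Rt *ᵥ gh
    (Rt, η, Sum.elim (Rᵀ *ᵥ pt) (Sum.elim (Rᵀ *ᵥ vt) (Rᵀ *ᵥ gt)), τ)

/-- The set `{R̃ = I, η = 0, x = 0, τ ∈ [0, TM]}`. -/
def target : Set ErrState :=
  {e | match e with
    | (Rt, η, x, τ) => Rt = 1 ∧ η = 0 ∧ x = 0 ∧ τ ∈ Icc 0 D.TM}

/-- Initial states with `P(0) = P₀`. -/
def admissible : Set State :=
  {z | match z with
    | (_, _, _, _, _, _, _, _, P, _) => P = D.P₀}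

/-- States with `|R̃|_I ≤ ε √ς_M` and `‖η‖ ≤ ηs`. -/
noncomputable def basin (ε ηs : ℝ) : Set State :=
  {z | attDist (D.err z).1 ≤ ε * Real.sqrt D.ςM ∧ enorm2 (D.err z).2.1 ≤ ηs}

section

/- Any norm on the matrix spaces gives the same absolutely continuous functions and the same
derivatives; the maximum norm is used. -/
attribute [local instance] Matrix.normedAddCommGroup Matrix.normedSpace

/-- Exponential stability of the set `{R̃ = I, η = 0, x = 0}` for the closed loop with attitude
gain `kR`, with all initial states of `basin ε ηs` in the domain of exponential attraction. -/
noncomputable def ErrorExponentiallyStable (kR ε ηs : ℝ) : Prop :=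
  (D.closedLoop kR).IsExponentiallyStable (fun z => distToSet D.target (D.err z))
    D.admissible (D.basin ε ηs)

end

end Setup

/-- Uniform positive definiteness on `[0, ∞)`: `c I ≤ S(t)` for some `c > 0`, with `S(t)`
symmetric. -/
def UniformlyPosDef {n : Type*} [Fintype n] [DecidableEq n] (S : ℝ → Matrix n n ℝ) : Prop :=
  ∃ c > (0 : ℝ), ∀ t ≥ (0 : ℝ), (S t - c • (1 : Matrix n n ℝ)).PosSemidef

/-- Boundedness of a matrix function on `[0, ∞)`. -/
def BoundedMat {m n : Type*} (S : ℝ → Matrix m n ℝ) : Prop :=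
  ∃ b : ℝ, ∀ t ≥ (0 : ℝ), ∀ i j, |S t i j| ≤ b

end HybridNav

namespace HybridNav
attribute [local instance] Matrix.normedAddCommGroup Matrix.normedSpace

/-! ### Absolutely continuous functions with prescribed derivative almost everywhere -/

section AC
variable {ι : Type*} [Fintype ι] {a b : ℝ}

/-! The error coordinates decouple the loop into an attitude part and a translational part, and each
is shown to decay geometrically in the number of jumps.

Attitude. Between jumps `R̃' = -R̃ η^×` with `η` constant, and a jump sets `η = k_R σ`, where `σ =
sig M R̃` depends on `R̃` alone because the landmarks are centred at `p_c` (`sigmaR_eq`). The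
potential `U = tr((I - R̃)M)/2` has derivative `-η·σ(R̃)` and lies between `2 λ_min |R̃|²` and `2
λ_max |R̃|²`, with the extremal eigenvalues of `M̄` (`le_pot`, `pot_le`). On the sublevel set `U ≤ 2
λ_min e²` with `e < 1` there is a gradient inequality `|σ|² ≥ c U` (`mul_pot_le_sig_sq`). For small
`k_R` the held value of `σ` stays within half its length of the current one, so `U` shrinks by a
fixed factor per interval (`pot_le_sub`). On the first interval `η(0)` is arbitrary; the bound `η*`
keeps `R̃` so close to `I` that `U` is in this sublevel set at the first jump, and the factor `ς_M`
in the basin converts the upper bound of `U` into the required level.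

Translation. In the inertial frame `p̃' = ṽ`, `ṽ' = g̃`, `g̃' = 0`, whatever `R̃` does, and at a
jump `x⁺ = x - K C x` (`jump_errors`). So `x` is the error of a Kalman filter with a triple
integrator as plant. The usual Lyapunov function `xᵀ P⁻¹ x` is used in dual form: `ErrLe z w` says
`(λ·x)² ≤ w λᵀPλ` for all `λ`, which needs no inverse of `P`. Along a flow, transport `λ` by the
adjoint equation; its solutions are polynomials in the inertial frame, `λ·x` is constant and `λᵀPλ`
grows at rate `λᵀVλ` (`cov_deriv`). At a jump, completing the square in the Riccati update shows
that `λ` pulls back to `λ - CᵀKᵀλ`, with the same pairing and no larger form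
(`exists_pairing_jump`). Hence `w` never increases, and it contracts on intervals of length at least
`T_m` because `V` is uniformly positive and `P` is bounded above. That upper bound is uniform
observability: optimality of the Kalman gain allows comparison with gains that recover position,
velocity and gravity from three measurements and forget the earlier `P`
(`exists_cycle_covForm_bound`). A lower bound of `P` is needed only at time `0`.

Completeness. A maximal solution with bounded domain would have a last level; flowing until the
timer vanishes and jumping once more would extend it, by existence and uniqueness of flows. Since
intervals have length at most `T_M`, decay in the number of jumps is decay in `t + j`. -/

theorem ac_comp_lipschitz {X Y : Type*} [PseudoMetricSpace X] [PseudoMetricSpace Y] {f : ℝ → X}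
    {K : NNReal} {L : X → Y} (hL : LipschitzWith K L) (hf : AbsolutelyContinuousOnInterval f a b) :
    AbsolutelyContinuousOnInterval (fun t => L (f t)) a b := by
  unfold AbsolutelyContinuousOnInterval at *
  refine squeeze_zero (fun t => Finset.sum_nonneg fun i _ => dist_nonneg) (fun t => ?_)
    (by simpa using hf.const_mul (K : ℝ))
  rw [Finset.mul_sum]
  exact Finset.sum_le_sum fun i _ => hL.dist_le_mul _ _

theorem ac_clm {E F : Type*} [NormedAddCommGroup E] [NormedSpace ℝ E] [NormedAddCommGroup F]
    [NormedSpace ℝ F] (L : E →L[ℝ] F) {f : ℝ → E} (hf : AbsolutelyContinuousOnInterval f a b) :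
    AbsolutelyContinuousOnInterval (fun t => L (f t)) a b :=
  ac_comp_lipschitz L.lipschitz hf

theorem ac_pi {E : ι → Type*} [∀ i, PseudoMetricSpace (E i)] {f : ℝ → ∀ i, E i}
    (hf : ∀ i, AbsolutelyContinuousOnInterval (fun t => f t i) a b) :
    AbsolutelyContinuousOnInterval f a b := by
  unfold AbsolutelyContinuousOnInterval at *
  refine squeeze_zero (fun t => Finset.sum_nonneg fun i _ => dist_nonneg) (fun t => ?_)
    (by simpa using tendsto_finsetSum Finset.univ (fun i _ => hf i))
  rw [Finset.sum_comm]
  refine Finset.sum_le_sum fun n _ => ?_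
  refine (dist_pi_le_iff (Finset.sum_nonneg fun i _ => dist_nonneg)).2 fun i => ?_
  exact Finset.single_le_sum (f := fun i => dist (f (t.2 n).1 i) (f (t.2 n).2 i))
    (fun i _ => dist_nonneg) (Finset.mem_univ i)

theorem ac_pi_apply {E : ι → Type*} [∀ i, PseudoMetricSpace (E i)] {f : ℝ → ∀ i, E i}
    (hf : AbsolutelyContinuousOnInterval f a b) (i : ι) :
    AbsolutelyContinuousOnInterval (fun t => f t i) a b :=
  ac_comp_lipschitz (L := fun x : ∀ i, E i => x i) (LipschitzWith.eval i) hf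

theorem ac_prodMk {X Y : Type*} [PseudoMetricSpace X] [PseudoMetricSpace Y] {f : ℝ → X} {g : ℝ → Y}
    (hf : AbsolutelyContinuousOnInterval f a b) (hg : AbsolutelyContinuousOnInterval g a b) :
    AbsolutelyContinuousOnInterval (fun t => (f t, g t)) a b := by
  unfold AbsolutelyContinuousOnInterval at *
  refine squeeze_zero (fun t => Finset.sum_nonneg fun i _ => dist_nonneg) (fun t => ?_)
    (by simpa using hf.add hg)
  rw [← Finset.sum_add_distrib]
  refine Finset.sum_le_sum fun n _ => ?_
  rw [Prod.dist_eq]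
  exact max_le_add_of_nonneg dist_nonneg dist_nonneg

theorem ac_const {X : Type*} [PseudoMetricSpace X] (c : X) :
    AbsolutelyContinuousOnInterval (fun _ => c) a b :=
  (LipschitzWith.const c).lipschitzOnWith.absolutelyContinuousOnInterval (K := 0)

theorem ac_sum {F κ : Type*} [SeminormedAddCommGroup F] (s : Finset κ) {f : κ → ℝ → F}
    (hf : ∀ i ∈ s, AbsolutelyContinuousOnInterval (f i) a b) :
    AbsolutelyContinuousOnInterval (fun t => ∑ i ∈ s, f i t) a b := by
  classical
  induction s using Finset.induction_on with
  | empty => simpa using ac_const (0 : F)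
  | insert i s hi ih =>
    simp only [Finset.sum_insert hi]
    exact (hf i (by simp)).fun_add (ih fun k hk => hf k (by simp [hk]))

theorem ac_congr {X : Type*} [PseudoMetricSpace X] {f g : ℝ → X}
    (hf : AbsolutelyContinuousOnInterval f a b) (h : ∀ t ∈ uIcc a b, g t = f t) :
    AbsolutelyContinuousOnInterval g a b := by
  rw [absolutelyContinuousOnInterval_iff] at *
  intro ε hε
  obtain ⟨δ, hδ, H⟩ := hf ε hε
  refine ⟨δ, hδ, fun E hE hs => ?_⟩
  convert H E hE hs using 1
  refine Finset.sum_congr rfl fun i hi => ?_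
  rw [h _ (hE.1 i hi).1, h _ (hE.1 i hi).2]

end AC

/-! ### Matrix-valued functions, entry by entry -/

section Entrywise
variable {m n : Type*}

theorem hasDerivAt_matrix_iff [Finite m] [Fintype n] {A : ℝ → Matrix m n ℝ} {A' : Matrix m n ℝ} {t : ℝ} :
    HasDerivAt A A' t ↔ ∀ i j, HasDerivAt (fun s => A s i j) (A' i j) t := by
  rw [show HasDerivAt A A' t ↔ ∀ i, HasDerivAt (fun s => A s i) (A' i) t from hasDerivAt_pi]
  exact forall_congr' fun i => hasDerivAt_pi

variable {m n : Type*} [Fintype m] [Fintype n]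

theorem ac_matrix {A : ℝ → Matrix m n ℝ} {a b : ℝ}
    (h : ∀ i j, AbsolutelyContinuousOnInterval (fun t => A t i j) a b) :
    AbsolutelyContinuousOnInterval A a b :=
  ac_pi (E := fun _ : m => n → ℝ) fun i => ac_pi fun j => h i j

theorem ac_entry {A : ℝ → Matrix m n ℝ} {a b : ℝ} (h : AbsolutelyContinuousOnInterval A a b)
    (i : m) (j : n) : AbsolutelyContinuousOnInterval (fun t => A t i j) a b :=
  ac_pi_apply (ac_pi_apply (E := fun _ : m => n → ℝ) h i) j

end Entrywise

/-- `f` is absolutely continuous on `[a, b]` and has derivative `f'` almost everywhere there. -/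
structure HasAEDerivOn {E : Type*} [NormedAddCommGroup E] [NormedSpace ℝ E] (f f' : ℝ → E)
    (a b : ℝ) : Prop where
  ac : AbsolutelyContinuousOnInterval f a b
  deriv : ∀ᵐ t : ℝ, t ∈ uIcc a b → HasDerivAt f (f' t) t

namespace HasAEDerivOn
variable {E F : Type*} [NormedAddCommGroup E] [NormedSpace ℝ E] [NormedAddCommGroup F]
  [NormedSpace ℝ F] {a b : ℝ} {f f' g g' : ℝ → E}

theorem congr_deriv (h : HasAEDerivOn f f' a b) (hfg : ∀ t ∈ uIcc a b, f' t = g' t) :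
    HasAEDerivOn f g' a b :=
  ⟨h.ac, by filter_upwards [h.deriv] with t ht hm; rw [← hfg t hm]; exact ht hm⟩

theorem mono (h : HasAEDerivOn f f' a b) {c d : ℝ} (hs : uIcc c d ⊆ uIcc a b) :
    HasAEDerivOn f f' c d :=
  ⟨h.ac.mono hs, by filter_upwards [h.deriv] with t ht hm; exact ht (hs hm)⟩

theorem const (c : E) : HasAEDerivOn (fun _ => c) (fun _ => 0) a b :=
  ⟨ac_const c, by filter_upwards with t _; exact hasDerivAt_const t c⟩

theorem add (h : HasAEDerivOn f f' a b) (k : HasAEDerivOn g g' a b) :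
    HasAEDerivOn (fun t => f t + g t) (fun t => f' t + g' t) a b :=
  ⟨h.ac.fun_add k.ac, by
    filter_upwards [h.deriv, k.deriv] with t h1 h2 hm; exact (h1 hm).fun_add (h2 hm)⟩

theorem sub (h : HasAEDerivOn f f' a b) (k : HasAEDerivOn g g' a b) :
    HasAEDerivOn (fun t => f t - g t) (fun t => f' t - g' t) a b :=
  ⟨h.ac.fun_sub k.ac, by
    filter_upwards [h.deriv, k.deriv] with t h1 h2 hm; exact (h1 hm).fun_sub (h2 hm)⟩

theorem smul {u u' : ℝ → ℝ} (h : HasAEDerivOn u u' a b) (k : HasAEDerivOn g g' a b) :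
    HasAEDerivOn (fun t => u t • g t) (fun t => u t • g' t + u' t • g t) a b :=
  ⟨h.ac.fun_smul k.ac, by
    filter_upwards [h.deriv, k.deriv] with t h1 h2 hm; exact (h1 hm).fun_smul (h2 hm)⟩

theorem clm (L : E →L[ℝ] F) (h : HasAEDerivOn f f' a b) :
    HasAEDerivOn (fun t => L (f t)) (fun t => L (f' t)) a b :=
  ⟨ac_clm L h.ac, by
    filter_upwards [h.deriv] with t h1 hm; exact L.hasFDerivAt.comp_hasDerivAt t (h1 hm)⟩

theorem prodMk {g g' : ℝ → F} (h : HasAEDerivOn f f' a b) (k : HasAEDerivOn g g' a b) :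
    HasAEDerivOn (fun t => (f t, g t)) (fun t => (f' t, g' t)) a b :=
  ⟨ac_prodMk h.ac k.ac, by
    filter_upwards [h.deriv, k.deriv] with t h1 h2 hm; exact (h1 hm).prodMk (h2 hm)⟩

theorem fst {f f' : ℝ → E × F} (h : HasAEDerivOn f f' a b) :
    HasAEDerivOn (fun t => (f t).1) (fun t => (f' t).1) a b :=
  h.clm (ContinuousLinearMap.fst ℝ E F)

theorem snd {f f' : ℝ → E × F} (h : HasAEDerivOn f f' a b) :
    HasAEDerivOn (fun t => (f t).2) (fun t => (f' t).2) a b :=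
  h.clm (ContinuousLinearMap.snd ℝ E F)

theorem congr (h : HasAEDerivOn f f' a b) (hfg : ∀ t ∈ uIcc a b, g t = f t) :
    HasAEDerivOn g f' a b := by
  refine ⟨ac_congr h.ac hfg, ?_⟩
  -- The functions agree only on the interval, so derivatives transfer only at interior points; the
  -- two endpoints form a null set.
  have h1 : ∀ᵐ t : ℝ, t ≠ a ∧ t ≠ b := by
    have := (Set.Finite.measure_zero (s := ({a, b} : Set ℝ)) (by simp) volume)
    rw [measure_eq_zero_iff_ae_notMem] at this
    filter_upwards [this] with t ht
    simpa using ht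
  filter_upwards [h.deriv, h1] with t ht hne hm
  refine (ht hm).congr_of_eventuallyEq ?_
  have : uIcc a b ∈ nhds t := by
    rw [uIcc, Set.mem_Icc] at hm
    rw [uIcc]
    refine Icc_mem_nhds ?_ ?_
    · rcases min_choice a b with e | e <;> rw [e] at hm ⊢
      · exact lt_of_le_of_ne hm.1 hne.1.symm
      · exact lt_of_le_of_ne hm.1 hne.2.symm
    · rcases max_choice a b with e | e <;> rw [e] at hm ⊢
      · exact lt_of_le_of_ne hm.2 hne.1
      · exact lt_of_le_of_ne hm.2 hne.2
  filter_upwards [this] with s hs using hfg s hs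

theorem eq_of_zero (h : HasAEDerivOn f (fun _ => 0) a b) : ∀ t ∈ uIcc a b, f t = f a := by
  obtain ⟨c, hc⟩ := h.ac.const_of_ae_hasDerivAt_zero h.deriv
  intro t ht
  rw [hc t ht, hc a (by simp)]

/-- A bound of the derivative by that of a reference function bounds the increment. -/
theorem sub_le_sub {u u' G G' : ℝ → ℝ} (hab : a ≤ b) (hu : HasAEDerivOn u u' a b)
    (hG : HasAEDerivOn G G' a b) (hle : ∀ t ∈ Icc a b, u' t ≤ G' t) :
    u b - u a ≤ G b - G a := by
  have h := hu.sub hG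
  have e := h.ac.integral_deriv_eq_sub
  have : ∫ x in a..b, _root_.deriv (fun t => u t - G t) x ≤ 0 := by
    have : ∫ x in a..b, _root_.deriv (fun t => u t - G t) x ≤ ∫ x in a..b, (0 : ℝ) := by
      refine intervalIntegral.integral_mono_ae_restrict hab h.ac.intervalIntegrable_deriv
        (by simp) ?_
      rw [Filter.EventuallyLE, ae_restrict_iff' measurableSet_Icc]
      filter_upwards [h.deriv] with t ht hm
      rw [(ht (by rwa [uIcc_of_le hab])).deriv]
      simpa using hle t hm
    simpa using this
  linarith

theorem of_hasDerivAt {E : Type*} [NormedAddCommGroup E] [NormedSpace ℝ E] {f f' : ℝ → E}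
    (hf : ∀ t, HasDerivAt f (f' t) t) (hc : Continuous f') : HasAEDerivOn f f' a b := by
  refine ⟨ContDiffOn.absolutelyContinuousOnInterval ?_, by filter_upwards with t _ using hf t⟩
  refine ContDiff.contDiffOn ?_
  rw [contDiff_one_iff_deriv]
  refine ⟨fun t => (hf t).differentiableAt, ?_⟩
  rw [show _root_.deriv f = f' from funext fun t => (hf t).deriv]
  exact hc

variable {l m n : Type*} [Fintype l] [Fintype m] [Fintype n]

theorem id_sub (c a b : ℝ) : HasAEDerivOn (fun r : ℝ => r - c) (fun _ => 1) a b :=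
  HasAEDerivOn.of_hasDerivAt (fun r => (hasDerivAt_id r).sub_const c) continuous_const

theorem id_sub_sq (c a b : ℝ) :
    HasAEDerivOn (fun r : ℝ => (r - c) ^ 2 / 2) (fun r => r - c) a b :=
  HasAEDerivOn.of_hasDerivAt (fun r => by
    have := (((hasDerivAt_id r).sub_const c).pow 2).div_const 2
    simpa using this) (by fun_prop)

theorem sum {κ : Type*} (s : Finset κ) {u u' : κ → ℝ → E}
    (h : ∀ i ∈ s, HasAEDerivOn (u i) (u' i) a b) :
    HasAEDerivOn (fun t => ∑ i ∈ s, u i t) (fun t => ∑ i ∈ s, u' i t) a b := by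
  refine ⟨ac_sum s fun i hi => (h i hi).ac, ?_⟩
  have : ∀ᵐ t : ℝ, ∀ i ∈ s, t ∈ uIcc a b → HasDerivAt (u i) (u' i t) t :=
    (Finset.eventually_all s).2 fun i hi => (h i hi).deriv
  filter_upwards [this] with t ht hm
  exact HasDerivAt.fun_sum fun i hi => ht i hi hm

theorem entry {A A' : ℝ → Matrix m n ℝ} (h : HasAEDerivOn A A' a b) (i : m) (j : n) :
    HasAEDerivOn (fun t => A t i j) (fun t => A' t i j) a b :=
  ⟨ac_entry h.ac i j, by
    filter_upwards [h.deriv] with t ht hm using hasDerivAt_matrix_iff.1 (ht hm) i j⟩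

theorem matrix {A A' : ℝ → Matrix m n ℝ}
    (h : ∀ i j, HasAEDerivOn (fun t => A t i j) (fun t => A' t i j) a b) :
    HasAEDerivOn A A' a b := by
  refine ⟨ac_matrix fun i j => (h i j).ac, ?_⟩
  have : ∀ᵐ t : ℝ, ∀ i j, t ∈ uIcc a b → HasDerivAt (fun t => A t i j) (A' t i j) t :=
    ae_all_iff.2 fun i => ae_all_iff.2 fun j => (h i j).deriv
  filter_upwards [this] with t ht hm
  exact hasDerivAt_matrix_iff.2 fun i j => ht i j hm

theorem coord {x x' : ℝ → n → ℝ} (h : HasAEDerivOn x x' a b) (i : n) :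
    HasAEDerivOn (fun t => x t i) (fun t => x' t i) a b :=
  ⟨ac_pi_apply h.ac i, by
    filter_upwards [h.deriv] with t ht hm using hasDerivAt_pi.1 (ht hm) i⟩

theorem pi {x x' : ℝ → n → ℝ}
    (h : ∀ i, HasAEDerivOn (fun t => x t i) (fun t => x' t i) a b) :
    HasAEDerivOn x x' a b := by
  refine ⟨ac_pi fun i => (h i).ac, ?_⟩
  have : ∀ᵐ t : ℝ, ∀ i, t ∈ uIcc a b → HasDerivAt (fun t => x t i) (x' t i) t :=
    ae_all_iff.2 fun i => (h i).deriv
  filter_upwards [this] with t ht hm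
  exact hasDerivAt_pi.2 fun i => ht i hm

theorem matMul {A A' : ℝ → Matrix l m ℝ} {B B' : ℝ → Matrix m n ℝ} (h : HasAEDerivOn A A' a b)
    (k : HasAEDerivOn B B' a b) :
    HasAEDerivOn (fun t => A t * B t) (fun t => A' t * B t + A t * B' t) a b := by
  refine matrix fun i j => ?_
  simp only [Matrix.mul_apply, Matrix.add_apply]
  refine (sum Finset.univ fun p _ => (h.entry i p).smul (k.entry p j)).congr_deriv fun t _ => ?_
  rw [← Finset.sum_add_distrib]
  exact Finset.sum_congr rfl fun p _ => by simp only [smul_eq_mul]; ring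

theorem mulVec {A A' : ℝ → Matrix l m ℝ} {x x' : ℝ → m → ℝ} (h : HasAEDerivOn A A' a b)
    (k : HasAEDerivOn x x' a b) :
    HasAEDerivOn (fun t => A t *ᵥ x t) (fun t => A' t *ᵥ x t + A t *ᵥ x' t) a b := by
  refine pi fun i => ?_
  simp only [Matrix.mulVec, dotProduct, Pi.add_apply]
  refine (sum Finset.univ fun p _ => (h.entry i p).smul (k.coord p)).congr_deriv fun t _ => ?_
  rw [← Finset.sum_add_distrib]
  exact Finset.sum_congr rfl fun p _ => by simp only [smul_eq_mul]; ring

theorem dot {x x' y y' : ℝ → m → ℝ} (h : HasAEDerivOn x x' a b)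
    (k : HasAEDerivOn y y' a b) :
    HasAEDerivOn (fun t => x t ⬝ᵥ y t) (fun t => x' t ⬝ᵥ y t + x t ⬝ᵥ y' t) a b := by
  simp only [dotProduct]
  refine (sum Finset.univ fun p _ => (h.coord p).smul (k.coord p)).congr_deriv fun t _ => ?_
  rw [← Finset.sum_add_distrib]
  exact Finset.sum_congr rfl fun p _ => by simp only [smul_eq_mul]; ring

theorem transpose {A A' : ℝ → Matrix m n ℝ} (h : HasAEDerivOn A A' a b) :
    HasAEDerivOn (fun t => (A t)ᵀ) (fun t => (A' t)ᵀ) a b :=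
  matrix fun i j => h.entry j i

theorem trace {A A' : ℝ → Matrix m m ℝ} (h : HasAEDerivOn A A' a b) :
    HasAEDerivOn (fun t => (A t).trace) (fun t => (A' t).trace) a b := by
  simp only [Matrix.trace, Matrix.diag]
  exact sum Finset.univ fun i _ => h.entry i i

end HasAEDerivOn

/-! ### Rotations and the attitude innovation -/

theorem enorm2_sq {ι : Type*} [Fintype ι] (x : ι → ℝ) : enorm2 x ^ 2 = x ⬝ᵥ x := by
  rw [enorm2, EuclideanSpace.norm_sq_eq]
  simp [dotProduct, sq]

theorem enorm2_nonneg {ι : Type*} [Fintype ι] (x : ι → ℝ) : 0 ≤ enorm2 x := norm_nonneg _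

theorem dotProduct_sq_le {ι : Type*} [Fintype ι] (x y : ι → ℝ) :
    (x ⬝ᵥ y) ^ 2 ≤ (x ⬝ᵥ x) * (y ⬝ᵥ y) := by
  simpa [dotProduct, sq] using Finset.sum_mul_sq_le_sq_mul_sq Finset.univ x y

theorem dotProduct_self_nonneg' {ι : Type*} [Fintype ι] (x : ι → ℝ) : 0 ≤ x ⬝ᵥ x :=
  Finset.sum_nonneg fun i _ => mul_self_nonneg (x i)

/-- The squared Frobenius norm. -/
def frobSq (E : Mat3) : ℝ := ∑ i, ∑ j, E i j ^ 2

theorem frobSq_nonneg (E : Mat3) : 0 ≤ frobSq E := by unfold frobSq; positivity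

theorem frobSq_eq_trace (E : Mat3) : frobSq E = (Eᵀ * E).trace := by
  simp [frobSq, Matrix.trace, Matrix.mul_apply, Fin.sum_univ_three]
  ring

theorem trace_transpose_mul_sq_le (A B : Mat3) :
    (Aᵀ * B).trace ^ 2 ≤ frobSq A * frobSq B := by
  have h := Finset.sum_mul_sq_le_sq_mul_sq (Finset.univ : Finset (Fin 3 × Fin 3))
    (fun p => A p.1 p.2) (fun p => B p.1 p.2)
  rw [Fintype.sum_prod_type, Fintype.sum_prod_type, Fintype.sum_prod_type] at h
  refine le_trans (le_of_eq ?_) h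
  congr 1
  simp [Matrix.trace, Matrix.mul_apply, Fin.sum_univ_three]
  ring

namespace SO3

variable {R S : Mat3}

theorem mul_transpose_mem (hR : R ∈ SO3) (hS : S ∈ SO3) : R * Sᵀ ∈ SO3 := by
  obtain ⟨h1, h2, h3⟩ := hR
  obtain ⟨k1, k2, k3⟩ := hS
  refine ⟨?_, ?_, ?_⟩
  · rw [transpose_mul, transpose_transpose, Matrix.mul_assoc, ← Matrix.mul_assoc Sᵀ, k2,
      Matrix.one_mul, h1]
  · rw [transpose_mul, transpose_transpose, Matrix.mul_assoc, ← Matrix.mul_assoc Rᵀ, h2,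
      Matrix.one_mul, k1]
  · rw [det_mul, det_transpose, h3, k3, one_mul]

theorem entry_mul_transpose (hR : R ∈ SO3) (i j : Fin 3) :
    R i 0 * R j 0 + R i 1 * R j 1 + R i 2 * R j 2 = (1 : Mat3) i j := by
  rw [← hR.1, Matrix.mul_apply, Fin.sum_univ_three]; rfl

theorem entry_transpose_mul (hR : R ∈ SO3) (i j : Fin 3) :
    R 0 i * R 0 j + R 1 i * R 1 j + R 2 i * R 2 j = (1 : Mat3) i j := by
  rw [← hR.2.1, Matrix.mul_apply, Fin.sum_univ_three]; rfl

theorem transpose_eq_adjugate (hR : R ∈ SO3) : Rᵀ = R.adjugate := by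
  have h : R * R.adjugate = 1 := by rw [mul_adjugate, hR.2.2, one_smul]
  calc Rᵀ = Rᵀ * (R * R.adjugate) := by rw [h, Matrix.mul_one]
    _ = R.adjugate := by rw [← Matrix.mul_assoc, hR.2.1, Matrix.one_mul]

theorem cofactor (hR : R ∈ SO3) (i j : Fin 3) : R j i = R.adjugate i j := by
  rw [← SO3.transpose_eq_adjugate hR]; rfl

end SO3

/-- The axial vector of the skew symmetric part of a matrix. -/
noncomputable def axial (R : Mat3) : Vec3 :=
  (1 / 2 : ℝ) • ![R 2 1 - R 1 2, R 0 2 - R 2 0, R 1 0 - R 0 1]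

/-- For a rotation by the angle `θ`, this is `cos θ`. -/
noncomputable def cosAngle (R : Mat3) : ℝ := (R.trace - 1) / 2

/-- The entries of the symmetric part of a rotation in terms of its angle and axial vector. -/
theorem SO3.sym_entry {R : Mat3} (hR : R ∈ SO3) (i j : Fin 3) :
    (1 + cosAngle R) * ((R i j + R j i) / 2 - cosAngle R * (1 : Mat3) i j) =
      axial R i * axial R j := by
  -- This is Rodrigues' formula multiplied by `1 + cos θ`, so that `(1 - cos θ)(1 + cos θ) = sin² θ`
  -- turns the axis into the axial vector. The orthogonality and cofactor relations imply it without
  -- choosing an axis.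
  have a01 := SO3.entry_transpose_mul hR 0 1
  have a02 := SO3.entry_transpose_mul hR 0 2
  have a12 := SO3.entry_transpose_mul hR 1 2
  have a00 := SO3.entry_transpose_mul hR 0 0
  have a11 := SO3.entry_transpose_mul hR 1 1
  have a22 := SO3.entry_transpose_mul hR 2 2
  have b01 := SO3.entry_mul_transpose hR 0 1
  have b02 := SO3.entry_mul_transpose hR 0 2
  have b12 := SO3.entry_mul_transpose hR 1 2
  have b00 := SO3.entry_mul_transpose hR 0 0
  have b11 := SO3.entry_mul_transpose hR 1 1
  have b22 := SO3.entry_mul_transpose hR 2 2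
  have c00 := SO3.cofactor hR 0 0
  have c01 := SO3.cofactor hR 0 1
  have c02 := SO3.cofactor hR 0 2
  have c10 := SO3.cofactor hR 1 0
  have c11 := SO3.cofactor hR 1 1
  have c12 := SO3.cofactor hR 1 2
  have c20 := SO3.cofactor hR 2 0
  have c21 := SO3.cofactor hR 2 1
  have c22 := SO3.cofactor hR 2 2
  simp [Matrix.adjugate_fin_three] at a01 a02 a12 a00 a11 a22 b01 b02 b12 b00 b11 b22 c00 c01 c02 c10 c11 c12 c20 c21 c22
  fin_cases i <;> fin_cases j <;>
    simp [cosAngle, axial, Matrix.trace, Fin.sum_univ_three]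
  all_goals grind

/-! ### The rotation angle and its quadratic estimates -/

section Angle
variable {R : Mat3}

/-- The trace of `SO3.sym_entry`; in terms of the angle, `sin² = (1 + cos)(1 - cos)`. -/
theorem SO3.axial_sq (hR : R ∈ SO3) :
    axial R ⬝ᵥ axial R = (1 + cosAngle R) * (1 - cosAngle R) := by
  have h0 := SO3.sym_entry hR 0 0
  have h1 := SO3.sym_entry hR 1 1
  have h2 := SO3.sym_entry hR 2 2
  simp only [Matrix.one_apply_eq] at h0 h1 h2
  have hc : cosAngle R = (R 0 0 + R 1 1 + R 2 2 - 1) / 2 := by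
    simp [cosAngle, Matrix.trace, Fin.sum_univ_three]
  simp only [dotProduct, Fin.sum_univ_three]
  rw [← h0, ← h1, ← h2]
  generalize cosAngle R = c at *
  linear_combination (-2) * (1 + c) * hc

theorem SO3.cosAngle_le (hR : R ∈ SO3) : cosAngle R ≤ 1 := by
  have a00 := SO3.entry_transpose_mul hR 0 0
  have a11 := SO3.entry_transpose_mul hR 1 1
  have a22 := SO3.entry_transpose_mul hR 2 2
  simp only [Matrix.one_apply_eq] at a00 a11 a22
  have hc : cosAngle R = (R 0 0 + R 1 1 + R 2 2 - 1) / 2 := by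
    simp [cosAngle, Matrix.trace, Fin.sum_univ_three]
  have h0 : R 0 0 ≤ 1 := by nlinarith [sq_nonneg (R 1 0), sq_nonneg (R 2 0)]
  have h1 : R 1 1 ≤ 1 := by nlinarith [sq_nonneg (R 0 1), sq_nonneg (R 2 1)]
  have h2 : R 2 2 ≤ 1 := by nlinarith [sq_nonneg (R 0 2), sq_nonneg (R 1 2)]
  linarith

theorem SO3.neg_one_le_cosAngle (hR : R ∈ SO3) : -1 ≤ cosAngle R := by
  have h := SO3.axial_sq hR
  have h1 := SO3.cosAngle_le hR
  have := dotProduct_self_nonneg' (axial R)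
  by_contra! hc
  nlinarith

theorem SO3.attDist_sq (hR : R ∈ SO3) : attDist R ^ 2 = (1 - cosAngle R) / 2 := by
  have e : (1 - R).trace / 4 = (1 - cosAngle R) / 2 := by
    rw [cosAngle, Matrix.trace_sub, Matrix.trace_one]
    simp
    ring
  rw [attDist, e, Real.sq_sqrt]
  linarith [SO3.cosAngle_le hR]

theorem attDist_nonneg (R : Mat3) : 0 ≤ attDist R := Real.sqrt_nonneg _

theorem SO3.frobSq_sub_one (hR : R ∈ SO3) : frobSq (R - 1) = 8 * attDist R ^ 2 := by
  rw [SO3.attDist_sq hR, frobSq_eq_trace]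
  have : (R - 1)ᵀ * (R - 1) = 1 - Rᵀ - R + 1 := by
    rw [transpose_sub, Matrix.sub_mul, Matrix.mul_sub, Matrix.mul_sub, hR.2.1]
    simp
    abel
  rw [this]
  simp only [Matrix.trace_add, Matrix.trace_sub, Matrix.trace_one, Matrix.trace_transpose, cosAngle]
  simp
  ring

theorem SO3.mulVec_dot_self (hR : R ∈ SO3) (x y : Vec3) : (R *ᵥ x) ⬝ᵥ (R *ᵥ y) = x ⬝ᵥ y := by
  rw [Matrix.dotProduct_mulVec, ← Matrix.mulVec_transpose, Matrix.mulVec_mulVec, hR.2.1,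
    Matrix.one_mulVec]

theorem SO3.transpose_mem (hR : R ∈ SO3) : Rᵀ ∈ SO3 :=
  ⟨by rw [transpose_transpose]; exact hR.2.1, by rw [transpose_transpose]; exact hR.1,
    by rw [det_transpose]; exact hR.2.2⟩

/-- Contracting `SO3.sym_entry` with `x` gives `(1 + cos)(xᵀRx - cos |x|²) = (r·x)²`, with `r` the
axial vector. At `cos = -1` the factor cannot be divided out, and Cauchy–Schwarz for `x` and `Rx`
takes over. -/
theorem SO3.cosAngle_mul_le (hR : R ∈ SO3) (x : Vec3) :
    cosAngle R * (x ⬝ᵥ x) ≤ x ⬝ᵥ R *ᵥ x := by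
  have h : (1 + cosAngle R) * (x ⬝ᵥ R *ᵥ x - cosAngle R * (x ⬝ᵥ x)) = (axial R ⬝ᵥ x) ^ 2 := by
    have h00 := SO3.sym_entry hR 0 0
    have h11 := SO3.sym_entry hR 1 1
    have h22 := SO3.sym_entry hR 2 2
    have h01 := SO3.sym_entry hR 0 1
    have h02 := SO3.sym_entry hR 0 2
    have h12 := SO3.sym_entry hR 1 2
    simp at h00 h11 h22 h01 h02 h12
    simp only [dotProduct, Matrix.mulVec, Fin.sum_univ_three]
    generalize cosAngle R = c at *
    generalize axial R = r at *
    linear_combination x 0 ^ 2 * h00 + x 1 ^ 2 * h11 + x 2 ^ 2 * h22 + 2 * x 0 * x 1 * h01 +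
      2 * x 0 * x 2 * h02 + 2 * x 1 * x 2 * h12
  rcases (SO3.neg_one_le_cosAngle hR).eq_or_lt with e | e
  · rw [← e]
    have h1 := dotProduct_sq_le x (R *ᵥ x)
    rw [SO3.mulVec_dot_self hR] at h1
    have h2 := dotProduct_self_nonneg' x
    nlinarith [abs_le_of_sq_le_sq' (by nlinarith : (x ⬝ᵥ R *ᵥ x) ^ 2 ≤ (x ⬝ᵥ x) ^ 2) h2]
  · have : 0 ≤ (1 + cosAngle R) * (x ⬝ᵥ R *ᵥ x - cosAngle R * (x ⬝ᵥ x)) := by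
      rw [h]; positivity
    have := nonneg_of_mul_nonneg_right this (by linarith)
    linarith

open scoped MatrixOrder in
theorem exists_eq_transpose_mul_self {n : Type*} [Fintype n] [DecidableEq n] {H : Matrix n n ℝ}
    (hH : H.PosSemidef) : ∃ B : Matrix n n ℝ, H = Bᵀ * B := by
  obtain ⟨B, hB⟩ := CStarAlgebra.nonneg_iff_eq_star_mul_self.mp hH.nonneg
  exact ⟨B, by rw [hB, star_eq_conjTranspose, conjTranspose_eq_transpose_of_trivial]⟩

/-- Write `H = BᵀB` and apply the vector estimate to the rows of `B`. With `H = M̄ - l I` and `H = L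
I - M̄` this yields both bounds of the potential. -/
theorem SO3.cosAngle_mul_trace_le (hR : R ∈ SO3) {H : Mat3} (hH : H.PosSemidef) :
    cosAngle R * H.trace ≤ (R * H).trace := by
  obtain ⟨B, rfl⟩ := exists_eq_transpose_mul_self hH
  have h0 := SO3.cosAngle_mul_le hR (B 0)
  have h1 := SO3.cosAngle_mul_le hR (B 1)
  have h2 := SO3.cosAngle_mul_le hR (B 2)
  simp [Matrix.trace, Matrix.mul_apply, Matrix.mulVec, dotProduct, Fin.sum_univ_three] at *
  generalize cosAngle R = c at *
  linarith

end Angle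

/-- The attitude innovation as a function of `M` and the attitude error. -/
noncomputable def sig (M R : Mat3) : Vec3 :=
  (1 / 2 : ℝ) • ![(M * R) 2 1 - (M * R) 1 2, (M * R) 0 2 - (M * R) 2 0, (M * R) 1 0 - (M * R) 0 1]

/-- The attitude potential. -/
noncomputable def pot (M R : Mat3) : ℝ := ((1 - R) * M).trace / 2

/-- `M̄ = (tr(M) I - M) / 2`. -/
noncomputable def mbar (M : Mat3) : Mat3 := (1 / 2 : ℝ) • (M.trace • (1 : Mat3) - M)

/-! ### The attitude potential and its gradient -/

section Innovation
variable {M R : Mat3}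

/-- The left side is the derivative of `pot M R` along `R' = -R η^×`, so `sig` plays the role of the
gradient of the potential. -/
theorem trace_mul_skew (hM : Mᵀ = M) (R : Mat3) (η : Vec3) :
    ((R * skew η) * M).trace / 2 = - (η ⬝ᵥ sig M R) := by
  have s : ∀ i j, M i j = M j i := fun i j => (congrFun (congrFun hM i) j).symm
  have h01 := s 1 0
  have h02 := s 2 0
  have h12 := s 2 1
  simp [sig, skew, Matrix.trace, Matrix.mul_apply, dotProduct, Fin.sum_univ_three, h01, h02, h12]
  ring

theorem sig_sub_one (hM : Mᵀ = M) (R : Mat3) : sig M (R - 1) = sig M R := by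
  have s : ∀ i j, M i j = M j i := fun i j => (congrFun (congrFun hM i) j).symm
  simp [sig, Matrix.mul_sub, s 1 0, s 2 0, s 2 1]

theorem sig_sq_le (M E : Mat3) : sig M E ⬝ᵥ sig M E ≤ 2 * (frobSq M * frobSq E) := by
  have key : ∀ i j : Fin 3, (M * E) i j ^ 2 ≤ (∑ a, M i a ^ 2) * ∑ a, E a j ^ 2 := fun i j => by
    rw [Matrix.mul_apply]
    exact Finset.sum_mul_sq_le_sq_mul_sq Finset.univ (fun a => M i a) (fun a => E a j)
  have hs : ∑ i, ∑ j, (M * E) i j ^ 2 ≤ frobSq M * frobSq E := by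
    have : frobSq E = ∑ j, ∑ a, E a j ^ 2 := Finset.sum_comm
    rw [this, frobSq, Finset.sum_mul_sum]
    exact Finset.sum_le_sum fun i _ => Finset.sum_le_sum fun j _ => key i j
  simp only [Fin.sum_univ_three] at hs
  simp [sig, dotProduct, Fin.sum_univ_three]
  generalize M * E = F at *
  nlinarith [sq_nonneg (F 2 1 + F 1 2), sq_nonneg (F 0 2 + F 2 0), sq_nonneg (F 1 0 + F 0 1),
    sq_nonneg (F 0 0), sq_nonneg (F 1 1), sq_nonneg (F 2 2), sq_nonneg (F 2 1),
    sq_nonneg (F 1 2), sq_nonneg (F 0 2), sq_nonneg (F 2 0), sq_nonneg (F 1 0), sq_nonneg (F 0 1)]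

/-- With `r` the axial vector and `w = M̄ r` one has `(1 + cos) σ = (1 + cos) w - r × w`, and `r ×
w` is orthogonal to `w`. The factor `1 + cos` stays because it vanishes at half turns. -/
theorem sig_dot_mbar_axial (hM : Mᵀ = M) (hR : R ∈ SO3) :
    (1 + cosAngle R) * (sig M R ⬝ᵥ (mbar M *ᵥ axial R)) =
      (1 + cosAngle R) * ((mbar M *ᵥ axial R) ⬝ᵥ (mbar M *ᵥ axial R)) := by
  have s : ∀ i j, M i j = M j i := fun i j => (congrFun (congrFun hM i) j).symm
  have k10 := s 1 0
  have k20 := s 2 0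
  have k21 := s 2 1
  have h00 := SO3.sym_entry hR 0 0
  have h11 := SO3.sym_entry hR 1 1
  have h22 := SO3.sym_entry hR 2 2
  have h01 := SO3.sym_entry hR 0 1
  have h02 := SO3.sym_entry hR 0 2
  have h12 := SO3.sym_entry hR 1 2
  simp at h00 h11 h22 h01 h02 h12
  have r0 : R 2 1 - R 1 2 = 2 * axial R 0 := by simp [axial]
  have r1 : R 0 2 - R 2 0 = 2 * axial R 1 := by simp [axial]
  have r2 : R 1 0 - R 0 1 = 2 * axial R 2 := by simp [axial]
  set w := mbar M *ᵥ axial R with hw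
  have w0 : w 0 = ((M 1 1 + M 2 2) * axial R 0 - M 0 1 * axial R 1 - M 0 2 * axial R 2) / 2 := by
    simp [hw, mbar, Matrix.mulVec, dotProduct, Fin.sum_univ_three, Matrix.trace, Matrix.one_apply]
    ring
  have w1 : w 1 = ((M 0 0 + M 2 2) * axial R 1 - M 0 1 * axial R 0 - M 1 2 * axial R 2) / 2 := by
    simp [hw, mbar, Matrix.mulVec, dotProduct, Fin.sum_univ_three, Matrix.trace, Matrix.one_apply,
      k10]
    ring
  have w2 : w 2 = ((M 0 0 + M 1 1) * axial R 2 - M 0 2 * axial R 0 - M 1 2 * axial R 1) / 2 := by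
    simp [hw, mbar, Matrix.mulVec, dotProduct, Fin.sum_univ_three, Matrix.trace, Matrix.one_apply,
      k20, k21]
    ring
  generalize cosAngle R = c at *
  generalize axial R = r at *
  have e0 : (1 + c) * sig M R 0 = (1 + c) * w 0 - (r 1 * w 2 - r 2 * w 1) := by
    simp [sig, Matrix.mul_apply, Fin.sum_univ_three, k10, k20, k21]
    rw [w0, w1, w2]
    grind
  have e1 : (1 + c) * sig M R 1 = (1 + c) * w 1 - (r 2 * w 0 - r 0 * w 2) := by
    simp [sig, Matrix.mul_apply, Fin.sum_univ_three, k10, k20, k21]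
    rw [w0, w1, w2]
    grind
  have e2 : (1 + c) * sig M R 2 = (1 + c) * w 2 - (r 0 * w 1 - r 1 * w 0) := by
    simp [sig, Matrix.mul_apply, Fin.sum_univ_three, k10, k20, k21]
    rw [w0, w1, w2]
    grind
  simp only [dotProduct, Fin.sum_univ_three]
  linear_combination w 0 * e0 + w 1 * e1 + w 2 * e2

theorem trace_mbar (M : Mat3) : (mbar M).trace = M.trace := by
  simp [mbar, Matrix.trace_smul, Matrix.trace_sub]
  ring

theorem pot_eq (M R : Mat3) : pot M R = (M.trace - (R * M).trace) / 2 := by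
  rw [pot, Matrix.sub_mul, Matrix.one_mul, Matrix.trace_sub]

theorem trace_mul_mbar_sub (M R : Mat3) (l : ℝ) :
    (R * (mbar M - l • 1)).trace = (M.trace * R.trace - (R * M).trace) / 2 - l * R.trace := by
  simp [mbar, Matrix.mul_sub, Matrix.trace_sub, Matrix.trace_smul]
  ring

theorem le_pot (hR : R ∈ SO3) {l : ℝ} (hl : (mbar M - l • (1 : Mat3)).PosSemidef) :
    2 * l * attDist R ^ 2 ≤ pot M R := by
  have h := SO3.cosAngle_mul_trace_le hR hl
  rw [trace_mul_mbar_sub, Matrix.trace_sub, trace_mbar, Matrix.trace_smul, Matrix.trace_one] at h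
  have e : R.trace = 2 * cosAngle R + 1 := by rw [cosAngle]; ring
  rw [e] at h
  rw [SO3.attDist_sq hR, pot_eq]
  simp at h
  linarith

theorem pot_le (hR : R ∈ SO3) {l : ℝ} (hl : (l • (1 : Mat3) - mbar M).PosSemidef) :
    pot M R ≤ 2 * l * attDist R ^ 2 := by
  have h := SO3.cosAngle_mul_trace_le hR hl
  rw [← neg_sub, Matrix.mul_neg, Matrix.trace_neg, Matrix.trace_neg,
    trace_mul_mbar_sub, Matrix.trace_sub, trace_mbar, Matrix.trace_smul, Matrix.trace_one] at h
  have e : R.trace = 2 * cosAngle R + 1 := by rw [cosAngle]; ring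
  rw [e] at h
  rw [SO3.attDist_sq hR, pot_eq]
  simp at h
  linarith

theorem quadForm_nonneg {n : Type*} [Fintype n] {H : Matrix n n ℝ} (hH : H.PosSemidef)
    (x : n → ℝ) : 0 ≤ x ⬝ᵥ H *ᵥ x := by
  simpa using hH.dotProduct_mulVec_nonneg x

theorem quadForm_sub_smul {n : Type*} [Fintype n] [DecidableEq n] (H : Matrix n n ℝ) (c : ℝ)
    (x : n → ℝ) : x ⬝ᵥ (H - c • 1) *ᵥ x = x ⬝ᵥ H *ᵥ x - c * (x ⬝ᵥ x) := by
  rw [Matrix.sub_mulVec, Matrix.smul_mulVec, Matrix.one_mulVec, dotProduct_sub, dotProduct_smul,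
    smul_eq_mul]

/-- The attitude innovation does not vanish away from the critical points of the potential. -/
theorem le_sig_sq (hM : Mᵀ = M) (hR : R ∈ SO3) {l : ℝ} (hl0 : 0 ≤ l)
    (hl : (mbar M - l • (1 : Mat3)).PosSemidef) (ha : attDist R < 1) :
    4 * l ^ 2 * attDist R ^ 2 * (1 - attDist R ^ 2) ≤ sig M R ⬝ᵥ sig M R := by
  have hq := SO3.attDist_sq hR
  have h1 : attDist R ^ 2 < 1 := by nlinarith [attDist_nonneg R]
  have hc : 0 < 1 + cosAngle R := by linarith
  -- Away from half turns the factor cancels and `σ·w = |w|²`. Two applications of Cauchy–Schwarz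
  -- give `l |r| ≤ |w| ≤ |σ|`, and `|r|² = sin² θ = 4 |R|_I² (1 - |R|_I²)`.
  have h := mul_left_cancel₀ hc.ne' (sig_dot_mbar_axial hM hR)
  have hax := SO3.axial_sq hR
  have hp := quadForm_nonneg hl (axial R)
  rw [quadForm_sub_smul] at hp
  set r := axial R
  set w := mbar M *ᵥ r
  have c1 := dotProduct_sq_le (sig M R) w
  have c2 := dotProduct_sq_le r w
  rw [h] at c1
  have hw := dotProduct_self_nonneg' w
  have hr := dotProduct_self_nonneg' r
  have hs := dotProduct_self_nonneg' (sig M R)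
  have hws : w ⬝ᵥ w ≤ sig M R ⬝ᵥ sig M R := by
    rcases hw.eq_or_lt with e | e
    · rw [← e]; exact hs
    · exact le_of_mul_le_mul_right (by rw [← sq]; exact c1) e
  have hrw : l ^ 2 * (r ⬝ᵥ r) ≤ w ⬝ᵥ w := by
    rcases hr.eq_or_lt with e | e
    · rw [← e]; simpa using hw
    · have : (l * (r ⬝ᵥ r)) ^ 2 ≤ (r ⬝ᵥ r) * (w ⬝ᵥ w) :=
        le_trans (pow_le_pow_left₀ (by positivity) (by linarith) 2) c2
      have h3 : (r ⬝ᵥ r) * (l ^ 2 * (r ⬝ᵥ r)) ≤ (r ⬝ᵥ r) * (w ⬝ᵥ w) := by nlinarith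
      exact le_of_mul_le_mul_left h3 e
  have e : 4 * l ^ 2 * attDist R ^ 2 * (1 - attDist R ^ 2) = l ^ 2 * (r ⬝ᵥ r) := by
    rw [hax, hq]; ring
  linarith

theorem sig_sq_le_attDist (hM : Mᵀ = M) (hR : R ∈ SO3) :
    sig M R ⬝ᵥ sig M R ≤ 16 * frobSq M * attDist R ^ 2 := by
  have h := sig_sq_le M (R - 1)
  rw [sig_sub_one hM, SO3.frobSq_sub_one hR] at h
  linarith

theorem frobSq_mul_skew (hR : R ∈ SO3) (η : Vec3) : frobSq (R * skew η) = 2 * (η ⬝ᵥ η) := by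
  rw [frobSq_eq_trace, transpose_mul, Matrix.mul_assoc, ← Matrix.mul_assoc Rᵀ, hR.2.1,
    Matrix.one_mul]
  simp [skew, Matrix.trace, Matrix.mul_apply, dotProduct, Fin.sum_univ_three]
  ring

theorem sqrt_frobSq_sub_one (hR : R ∈ SO3) : Real.sqrt (frobSq (R - 1)) = Real.sqrt 8 * attDist R := by
  rw [SO3.frobSq_sub_one hR, Real.sqrt_mul (by norm_num), Real.sqrt_sq (attDist_nonneg R)]

/-- The triangle inequality of the Frobenius norm. -/
theorem sqrt_frobSq_add_le (A B : Mat3) :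
    Real.sqrt (frobSq (A + B)) ≤ Real.sqrt (frobSq A) + Real.sqrt (frobSq B) := by
  refine Real.sqrt_le_iff.2 ⟨by positivity, ?_⟩
  have h := trace_transpose_mul_sq_le A B
  have e : frobSq (A + B) = frobSq A + 2 * (Aᵀ * B).trace + frobSq B := by
    simp [frobSq, Matrix.trace, Matrix.mul_apply, Fin.sum_univ_three]
    ring
  rw [e, add_sq, Real.sq_sqrt (frobSq_nonneg A), Real.sq_sqrt (frobSq_nonneg B)]
  have h2 : (Aᵀ * B).trace ≤ Real.sqrt (frobSq A) * Real.sqrt (frobSq B) := by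
    rw [← Real.sqrt_mul (frobSq_nonneg A)]
    exact Real.le_sqrt_of_sq_le h
  linarith

end Innovation

/-! ### The inertia matrix of the landmarks -/

theorem spectrum_bounds {n : Type*} [Fintype n] [DecidableEq n] [Nonempty n]
    {H : Matrix n n ℝ} (hH : H.PosDef) :
    0 < sInf (spectrum ℝ H) ∧ sInf (spectrum ℝ H) ≤ sSup (spectrum ℝ H) ∧
      (H - sInf (spectrum ℝ H) • (1 : Matrix n n ℝ)).PosSemidef ∧
      (sSup (spectrum ℝ H) • (1 : Matrix n n ℝ) - H).PosSemidef := by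
  have hs := hH.isHermitian.spectrum_real_eq_range_eigenvalues
  have hfin : (spectrum ℝ H).Finite := by rw [hs]; exact Set.finite_range _
  have hne : (spectrum ℝ H).Nonempty := by rw [hs]; exact Set.range_nonempty _
  have hmin := hne.csInf_mem hfin
  have hle : ∀ x ∈ spectrum ℝ H, sInf (spectrum ℝ H) ≤ x := fun x hx => csInf_le hfin.bddBelow hx
  have hge : ∀ x ∈ spectrum ℝ H, x ≤ sSup (spectrum ℝ H) := fun x hx => le_csSup hfin.bddAbove hx
  generalize hl : sInf (spectrum ℝ H) = l at *
  generalize hL : sSup (spectrum ℝ H) = L at *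
  refine ⟨?_, hge _ hmin, ?_, ?_⟩
  · rw [hs] at hmin
    obtain ⟨i, hi⟩ := hmin
    rw [← hi]
    exact hH.eigenvalues_pos i
  · refine posSemidef_iff_isHermitian_and_spectrum_nonneg.2
      ⟨hH.isHermitian.sub (by simp [Matrix.IsHermitian]), fun x hx => ?_⟩
    rw [← Algebra.algebraMap_eq_smul_one, ← spectrum.sub_singleton_eq] at hx
    obtain ⟨y, hy, z, hz, rfl⟩ := hx
    rw [Set.mem_singleton_iff] at hz
    have := hle y hy
    simp only [Set.mem_ofPred_eq]
    linarith
  · refine posSemidef_iff_isHermitian_and_spectrum_nonneg.2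
      ⟨IsHermitian.sub (by simp [Matrix.IsHermitian]) hH.isHermitian, fun x hx => ?_⟩
    rw [← Algebra.algebraMap_eq_smul_one, ← spectrum.singleton_sub_eq] at hx
    obtain ⟨y, hy, z, hz, rfl⟩ := hx
    rw [Set.mem_singleton_iff] at hy
    have := hge z hz
    simp only [Set.mem_ofPred_eq]
    linarith

namespace Setup
variable {N : ℕ} (D : Setup N)

theorem M_apply (a b : Fin 3) :
    D.M a b = ∑ i, D.k i * ((D.p i - D.pc) a * (D.p i - D.pc) b) := by
  simp [M, Matrix.sum_apply, vecMulVec_apply]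

theorem transpose_M : D.Mᵀ = D.M := by
  ext a b
  rw [transpose_apply, M_apply, M_apply]
  exact Finset.sum_congr rfl fun i _ => by ring

theorem Mbar_eq : D.Mbar = mbar D.M := rfl

theorem sum_smul_sub_pc (hk1 : ∑ i, D.k i = 1) : ∑ i, D.k i • (D.p i - D.pc) = 0 := by
  simp only [smul_sub, Finset.sum_sub_distrib, ← Finset.sum_smul, hk1, one_smul]
  simp [pc]

theorem dotProduct_Mbar (x : Vec3) :
    x ⬝ᵥ D.Mbar *ᵥ x = (∑ i, D.k i * (crossProduct x (D.p i - D.pc) ⬝ᵥ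
      crossProduct x (D.p i - D.pc))) / 2 := by
  have h : ∀ a b, D.M a b = ∑ i, D.k i * ((D.p i - D.pc) a * (D.p i - D.pc) b) := D.M_apply
  rw [Mbar_eq]
  have e : x ⬝ᵥ mbar D.M *ᵥ x = (x 0 ^ 2 * (D.M 1 1 + D.M 2 2) + x 1 ^ 2 * (D.M 0 0 + D.M 2 2) +
      x 2 ^ 2 * (D.M 0 0 + D.M 1 1) - 2 * x 0 * x 1 * D.M 0 1 - 2 * x 0 * x 2 * D.M 0 2 -
      2 * x 1 * x 2 * D.M 1 2) / 2 := by
    have s : ∀ i j, D.M i j = D.M j i := fun i j => (congrFun (congrFun D.transpose_M i) j).symm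
    simp [mbar, Matrix.mulVec, dotProduct, Fin.sum_univ_three, Matrix.trace, Matrix.one_apply,
      s 1 0, s 2 0, s 2 1]
    ring
  rw [e]
  simp only [h, Finset.mul_sum, ← Finset.sum_add_distrib, ← Finset.sum_sub_distrib]
  congr 1
  refine Finset.sum_congr rfl fun i _ => ?_
  generalize D.p i - D.pc = q
  simp [cross_apply, dotProduct, Fin.sum_univ_three]
  ring

/-- The form of `M̄` at `x` is half the weighted sum of `|x × (p_i - p_c)|²`. If it vanishes for
some `x ≠ 0`, every `p_i - p_c` is parallel to `x` and the landmarks lie on one line. -/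
theorem posDef_Mbar (hk : ∀ i, 0 < D.k i)
    (hp : ∃ i₁ i₂ i₃ : Fin N, ¬ Collinear ℝ {D.p i₁, D.p i₂, D.p i₃}) : D.Mbar.PosDef := by
  refine Matrix.PosDef.of_dotProduct_mulVec_pos ?_ fun x hx => ?_
  · have hM : D.Mᵀ = D.M := D.transpose_M
    simp [Matrix.IsHermitian, Mbar, conjTranspose_eq_transpose_of_trivial, hM]
  rw [star_trivial, dotProduct_Mbar]
  have hnn : ∀ i, 0 ≤ D.k i * (crossProduct x (D.p i - D.pc) ⬝ᵥ crossProduct x (D.p i - D.pc)) :=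
    fun i => mul_nonneg (hk i).le (dotProduct_self_nonneg' _)
  refine div_pos (lt_of_le_of_ne (Finset.sum_nonneg fun i _ => hnn i) fun h0 => ?_) two_pos
  rw [eq_comm, Finset.sum_eq_zero_iff_of_nonneg fun i _ => hnn i] at h0
  have hcross : ∀ i, crossProduct x (D.p i - D.pc) = 0 := fun i => by
    have h1 := h0 i (Finset.mem_univ i)
    have h2 := (mul_eq_zero.1 h1).resolve_left (hk i).ne'
    exact dotProduct_self_eq_zero.1 h2
  have hxx : x ⬝ᵥ x ≠ 0 := fun h => hx (dotProduct_self_eq_zero.1 h)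
  have hpar : ∀ i, D.p i = ((x ⬝ᵥ (D.p i - D.pc)) / (x ⬝ᵥ x)) • x + D.pc := fun i => by
    have h1 := hcross i
    have h2 : crossProduct x (crossProduct x (D.p i - D.pc)) = 0 := by rw [h1]; simp
    have h3 : crossProduct x (crossProduct x (D.p i - D.pc)) =
        (x ⬝ᵥ (D.p i - D.pc)) • x - (x ⬝ᵥ x) • (D.p i - D.pc) := by
      ext a
      fin_cases a <;> simp [cross_apply, dotProduct, Fin.sum_univ_three] <;> ring
    rw [h2, eq_comm, sub_eq_zero] at h3
    rw [div_eq_inv_mul, ← smul_smul, h3, smul_smul, inv_mul_cancel₀ hxx, one_smul]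
    abel
  obtain ⟨i₁, i₂, i₃, hcol⟩ := hp
  refine hcol ((collinear_iff_exists_forall_eq_smul_vadd _).2 ⟨D.pc, x, fun q hq => ?_⟩)
  simp only [Set.mem_insert_iff, Set.mem_singleton_iff] at hq
  rcases hq with rfl | rfl | rfl <;> exact ⟨_, hpar _⟩

/-- Each residual is `(I - R̃ᵀ)(p_i - p_c)` plus a vector common to all `i`. The common vector drops
out since `∑ k_i (p_i - p_c) = 0`, and what remains is the axial part of `M R̃`. This makes the
attitude error dynamics autonomous. -/
theorem sigmaR_eq (hk1 : ∑ i, D.k i = 1) (R Rh : Mat3) (p ph : Vec3) :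
    D.sigmaR Rh ph (D.meas R p) = sig D.M (R * Rhᵀ) := by
  set E := R * Rhᵀ with hE
  have e1 : ∀ i, D.p i - ph - Rh *ᵥ D.meas R p i =
      ((D.p i - D.pc) - Eᵀ *ᵥ (D.p i - D.pc)) + (D.pc - ph - Eᵀ *ᵥ (D.pc - p)) := fun i => by
    have : Rh *ᵥ D.meas R p i = Eᵀ *ᵥ (D.p i - D.pc) + Eᵀ *ᵥ (D.pc - p) := by
      rw [← Matrix.mulVec_add, sub_add_sub_cancel, hE, transpose_mul, transpose_transpose, meas,
        Matrix.mulVec_mulVec]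
    rw [this]
    abel
  have e2 : ∑ i, D.k i • (skew (D.p i - D.pc) *ᵥ (D.pc - ph - Eᵀ *ᵥ (D.pc - p))) = 0 := by
    have : ∀ i, D.k i • (skew (D.p i - D.pc) *ᵥ (D.pc - ph - Eᵀ *ᵥ (D.pc - p))) =
        crossProduct (D.k i • (D.p i - D.pc)) (D.pc - ph - Eᵀ *ᵥ (D.pc - p)) := fun i => by
      rw [skew_mulVec, map_smul, LinearMap.smul_apply]
    simp only [this]
    rw [← LinearMap.sum_apply, ← map_sum, D.sum_smul_sub_pc hk1]
    simp
  have e3 : D.sigmaR Rh ph (D.meas R p) = (1 / 2 : ℝ) • ∑ i, D.k i •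
      crossProduct (D.p i - D.pc) (-(Eᵀ *ᵥ (D.p i - D.pc))) := by
    rw [sigmaR]
    congr 1
    rw [← add_zero (∑ i, D.k i • crossProduct _ _), ← e2, ← Finset.sum_add_distrib]
    refine Finset.sum_congr rfl fun i _ => ?_
    rw [e1]
    generalize D.p i - D.pc = q
    rw [Matrix.mulVec_add, smul_add, skew_mulVec q (q - Eᵀ *ᵥ q), map_sub, cross_self, zero_sub,
      map_neg]
  rw [e3]
  have h : ∀ a b, D.M a b = ∑ i, D.k i * ((D.p i - D.pc) a * (D.p i - D.pc) b) := D.M_apply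
  rw [sig]
  congr 1
  ext a
  rw [Finset.sum_apply]
  fin_cases a <;>
  · simp only [Matrix.mul_apply, Fin.sum_univ_three, h, Finset.sum_mul, ← Finset.sum_add_distrib,
      ← Finset.sum_sub_distrib, Fin.zero_eta, Fin.mk_one, Fin.reduceFinMk, Matrix.cons_val_zero, Matrix.cons_val_one,
      Matrix.cons_val]
    refine Finset.sum_congr rfl fun i _ => ?_
    generalize D.p i - D.pc = q
    simp [cross_apply, Matrix.mulVec, dotProduct, Fin.sum_univ_three]
    ring

end Setup

/-! ### The discrete Riccati update -/

section Riccati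
variable {P : Mat9} {Q : Mat3}

/-- The discrete Riccati update. -/
noncomputable def riccati (P : Mat9) (Q : Mat3) : Mat9 :=
  P - P * Cᵀ * (C * P * Cᵀ + Q)⁻¹ * C * P

theorem transpose_innovation_cov (hP : Pᵀ = P) (hQ : Qᵀ = Q) :
    (C * P * Cᵀ + Q)ᵀ = C * P * Cᵀ + Q := by
  simp [transpose_mul, hP, hQ, Matrix.mul_assoc]

theorem transpose_riccati (hP : Pᵀ = P) (hQ : Qᵀ = Q) : (riccati P Q)ᵀ = riccati P Q := by
  have h := transpose_innovation_cov hP hQ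
  rw [riccati, transpose_sub, hP]
  congr 1
  simp only [transpose_mul, transpose_transpose, hP, transpose_nonsing_inv, h]
  simp only [Matrix.mul_assoc]

/-- Completion of the square in the discrete Riccati update. -/
theorem riccati_square (hP : Pᵀ = P) (hQ : Qᵀ = Q) (hS : IsUnit (C * P * Cᵀ + Q).det)
    (x : Idx9 → ℝ) (μ : Vec3) :
    (x - Cᵀ *ᵥ μ) ⬝ᵥ P *ᵥ (x - Cᵀ *ᵥ μ) + μ ⬝ᵥ Q *ᵥ μ =
      x ⬝ᵥ riccati P Q *ᵥ x +
        (μ - (gain P Q)ᵀ *ᵥ x) ⬝ᵥ (C * P * Cᵀ + Q) *ᵥ (μ - (gain P Q)ᵀ *ᵥ x) := by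
  have hSt := transpose_innovation_cov hP hQ
  set S := C * P * Cᵀ + Q with hSdef
  set g : Vec3 := C *ᵥ (P *ᵥ x) with hg
  set w : Vec3 := S⁻¹ *ᵥ g with hw
  have hSw : S *ᵥ w = g := by
    rw [hw, Matrix.mulVec_mulVec, Matrix.mul_nonsing_inv _ hS, Matrix.one_mulVec]
  have hgain : (gain P Q)ᵀ *ᵥ x = w := by
    rw [gain, transpose_mul, transpose_mul, transpose_transpose, hP, transpose_nonsing_inv, hSt,
      ← Matrix.mulVec_mulVec, ← Matrix.mulVec_mulVec]
  have adj : ∀ (y : Idx9 → ℝ) (ν : Vec3), (Cᵀ *ᵥ ν) ⬝ᵥ y = ν ⬝ᵥ C *ᵥ y := fun y ν => by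
    rw [Matrix.dotProduct_mulVec, ← Matrix.mulVec_transpose]
  have symP : ∀ y z : Idx9 → ℝ, y ⬝ᵥ P *ᵥ z = z ⬝ᵥ P *ᵥ y := fun y z => by
    rw [Matrix.dotProduct_mulVec, ← Matrix.mulVec_transpose, hP, dotProduct_comm]
  have symS : ∀ y z : Vec3, y ⬝ᵥ S *ᵥ z = z ⬝ᵥ S *ᵥ y := fun y z => by
    rw [Matrix.dotProduct_mulVec, ← Matrix.mulVec_transpose, hSt, dotProduct_comm]
  have hric : x ⬝ᵥ riccati P Q *ᵥ x = x ⬝ᵥ P *ᵥ x - g ⬝ᵥ w := by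
    rw [riccati, ← hSdef, Matrix.sub_mulVec, dotProduct_sub]
    congr 1
    rw [Matrix.mul_assoc, Matrix.mul_assoc, Matrix.mul_assoc, ← Matrix.mulVec_mulVec, symP,
      ← Matrix.mulVec_mulVec, adj, ← Matrix.mulVec_mulVec, ← Matrix.mulVec_mulVec, dotProduct_comm]
  have hCPC : (Cᵀ *ᵥ μ) ⬝ᵥ P *ᵥ (Cᵀ *ᵥ μ) + μ ⬝ᵥ Q *ᵥ μ = μ ⬝ᵥ S *ᵥ μ := by
    rw [adj, hSdef, Matrix.add_mulVec, dotProduct_add, ← Matrix.mulVec_mulVec,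
      ← Matrix.mulVec_mulVec]
  rw [hgain, hric]
  have e1 : (x - Cᵀ *ᵥ μ) ⬝ᵥ P *ᵥ (x - Cᵀ *ᵥ μ) =
      x ⬝ᵥ P *ᵥ x - 2 * (μ ⬝ᵥ g) + (Cᵀ *ᵥ μ) ⬝ᵥ P *ᵥ (Cᵀ *ᵥ μ) := by
    rw [Matrix.mulVec_sub, dotProduct_sub, sub_dotProduct, sub_dotProduct, symP x (Cᵀ *ᵥ μ),
      adj (P *ᵥ x), ← hg]
    ring
  have e2 : (μ - w) ⬝ᵥ S *ᵥ (μ - w) = μ ⬝ᵥ S *ᵥ μ - 2 * (μ ⬝ᵥ g) + g ⬝ᵥ w := by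
    rw [Matrix.mulVec_sub, dotProduct_sub, sub_dotProduct, sub_dotProduct, symS w μ, hSw,
      dotProduct_comm w g]
    ring
  rw [e1, e2, ← hCPC]
  ring

theorem posDef_innovation_cov (hP : Pᵀ = P) (hP0 : ∀ x, 0 ≤ x ⬝ᵥ P *ᵥ x) (hQ : Q.PosDef) :
    (C * P * Cᵀ + Q).PosDef := by
  refine PosDef.posSemidef_add ?_ hQ
  have h : P.PosSemidef := PosSemidef.of_dotProduct_mulVec_nonneg
    (by rw [Matrix.IsHermitian, conjTranspose_eq_transpose_of_trivial, hP])
    (fun x => by simpa using hP0 x)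
  have := h.mul_mul_conjTranspose_same C
  rwa [conjTranspose_eq_transpose_of_trivial] at this

theorem PosDef.transpose_eq {n : Type*} {H : Matrix n n ℝ} (hH : H.PosDef) : Hᵀ = H := by
  rw [← conjTranspose_eq_transpose_of_trivial]; exact hH.isHermitian

/-- The discrete Riccati update is optimal among all gains. -/
theorem riccati_le (hP : Pᵀ = P) (hP0 : ∀ x, 0 ≤ x ⬝ᵥ P *ᵥ x) (hQ : Q.PosDef)
    (x : Idx9 → ℝ) (μ : Vec3) :
    x ⬝ᵥ riccati P Q *ᵥ x ≤ (x - Cᵀ *ᵥ μ) ⬝ᵥ P *ᵥ (x - Cᵀ *ᵥ μ) + μ ⬝ᵥ Q *ᵥ μ := by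
  have hS := posDef_innovation_cov hP hP0 hQ
  rw [riccati_square hP (PosDef.transpose_eq hQ) ((Matrix.isUnit_iff_isUnit_det _).1 hS.isUnit)]
  have := quadForm_nonneg hS.posSemidef (μ - (gain P Q)ᵀ *ᵥ x)
  linarith

/-- The Kalman gain attains the optimum in `riccati_le`: the completed square vanishes at `μ = Kᵀ
x`. -/
theorem riccati_eq (hP : Pᵀ = P) (hP0 : ∀ x, 0 ≤ x ⬝ᵥ P *ᵥ x) (hQ : Q.PosDef) (x : Idx9 → ℝ) :
    x ⬝ᵥ riccati P Q *ᵥ x = (x - Cᵀ *ᵥ ((gain P Q)ᵀ *ᵥ x)) ⬝ᵥ P *ᵥ (x - Cᵀ *ᵥ ((gain P Q)ᵀ *ᵥ x)) +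
      ((gain P Q)ᵀ *ᵥ x) ⬝ᵥ Q *ᵥ ((gain P Q)ᵀ *ᵥ x) := by
  have hS := posDef_innovation_cov hP hP0 hQ
  rw [riccati_square hP (PosDef.transpose_eq hQ) ((Matrix.isUnit_iff_isUnit_det _).1 hS.isUnit)]
  simp

end Riccati

/-! ### Errors and costates in the inertial frame -/

/-- The vector `(Rᵀ a, Rᵀ b, Rᵀ c)`. -/
def stack (R : Mat3) (a b c : Vec3) : Idx9 → ℝ :=
  Sum.elim (Rᵀ *ᵥ a) (Sum.elim (Rᵀ *ᵥ b) (Rᵀ *ᵥ c))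

theorem sumElim_dotProduct {m n : Type*} [Fintype m] [Fintype n] (a a' : m → ℝ) (b b' : n → ℝ) :
    Sum.elim a b ⬝ᵥ Sum.elim a' b' = a ⬝ᵥ a' + b ⬝ᵥ b' := by
  simp [dotProduct]

theorem stack_dotProduct {R : Mat3} (hR : R ∈ SO3) (a b c a' b' c' : Vec3) :
    stack R a b c ⬝ᵥ stack R a' b' c' = a ⬝ᵥ a' + b ⬝ᵥ b' + c ⬝ᵥ c' := by
  have h := fun x y => SO3.mulVec_dot_self (SO3.transpose_mem hR) x y
  rw [stack, stack, sumElim_dotProduct, sumElim_dotProduct, h, h, h, add_assoc]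

theorem exists_eq_stack {R : Mat3} (hR : R ∈ SO3) (x : Idx9 → ℝ) : ∃ a b c, x = stack R a b c := by
  refine ⟨R *ᵥ (x ∘ Sum.inl), R *ᵥ (x ∘ Sum.inr ∘ Sum.inl), R *ᵥ (x ∘ Sum.inr ∘ Sum.inr), ?_⟩
  simp only [stack, Matrix.mulVec_mulVec, hR.2.1, Matrix.one_mulVec]
  ext i
  rcases i with i | i | i <;> rfl

theorem C_transpose_mulVec (μ : Vec3) : Cᵀ *ᵥ μ = Sum.elim μ (Sum.elim 0 0) := by
  ext i
  rcases i with i | i | i <;> simp [C, Matrix.mulVec, dotProduct, Matrix.one_apply]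

theorem C_mulVec (x y z : Vec3) : C *ᵥ Sum.elim x (Sum.elim y z) = x := by
  rw [C, fromCols_mulVec_sumElim]; simp

theorem stack_sub_C (R : Mat3) (a b c m : Vec3) :
    stack R a b c - Cᵀ *ᵥ (Rᵀ *ᵥ m) = stack R (a - m) b c := by
  rw [C_transpose_mulVec]
  ext i
  rcases i with i | i | i <;> simp [stack, Matrix.mulVec_sub]

theorem transpose_skew (w : Vec3) : (skew w)ᵀ = -skew w := by
  ext i j; fin_cases i <;> fin_cases j <;> simp [skew]

theorem A_transpose_mulVec {N : ℕ} (D : Setup N) (t : ℝ) (x y z : Vec3) :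
    (D.A t)ᵀ *ᵥ Sum.elim x (Sum.elim y z) = Sum.elim (skew (D.ω t) *ᵥ x)
      (Sum.elim (x + skew (D.ω t) *ᵥ y) (y + skew (D.ω t) *ᵥ z)) := by
  ext i
  rcases i with i | i | i <;>
    simp [Setup.A, fromBlocks_transpose, fromBlocks_mulVec, transpose_skew, fromRows_mulVec,
      transpose_fromCols]

theorem skew_add (x y : Vec3) : skew (x + y) = skew x + skew y := by
  ext i j; fin_cases i <;> fin_cases j <;> simp [skew] <;> ring

/-- Rotations preserve the cross product, since each entry of `R` equals its own cofactor. -/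
theorem SO3.skew_transpose_mulVec {R : Mat3} (hR : R ∈ SO3) (w : Vec3) :
    skew (Rᵀ *ᵥ w) * Rᵀ = Rᵀ * skew w := by
  have c00 := SO3.cofactor hR 0 0
  have c01 := SO3.cofactor hR 0 1
  have c02 := SO3.cofactor hR 0 2
  have c10 := SO3.cofactor hR 1 0
  have c11 := SO3.cofactor hR 1 1
  have c12 := SO3.cofactor hR 1 2
  have c20 := SO3.cofactor hR 2 0
  have c21 := SO3.cofactor hR 2 1
  have c22 := SO3.cofactor hR 2 2
  simp [Matrix.adjugate_fin_three] at c00 c01 c02 c10 c11 c12 c20 c21 c22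
  ext i j
  fin_cases i <;> fin_cases j <;>
    simp [skew, Matrix.mul_apply, Matrix.mulVec, dotProduct, Fin.sum_univ_three]
  all_goals grind


/-! ### Evolution along flows -/

/-- The solution of the adjoint equation `λ' = -Aᵀ λ` with value `(Rᵀ a, Rᵀ b, Rᵀ c)` at time
`t`, for the attitude `R` at time `r`. -/
noncomputable def costate (t : ℝ) (a b c : Vec3) (r : ℝ) (R : Mat3) : Idx9 → ℝ :=
  stack R a (b - (r - t) • a) (c - (r - t) • b + ((r - t) ^ 2 / 2) • a)

theorem costate_self (t : ℝ) (a b c : Vec3) (R : Mat3) :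
    costate t a b c t R = stack R a b c := by
  simp [costate]

theorem stack_hasAEDerivOn {s t : ℝ} {R R' : ℝ → Mat3} {a a' b b' c c' : ℝ → Vec3}
    (hR : HasAEDerivOn R R' s t) (ha : HasAEDerivOn a a' s t) (hb : HasAEDerivOn b b' s t)
    (hc : HasAEDerivOn c c' s t) : HasAEDerivOn (fun r => stack (R r) (a r) (b r) (c r))
      (fun r => stack (R' r) (a r) (b r) (c r) + stack (R r) (a' r) (b' r) (c' r)) s t := by
  refine HasAEDerivOn.pi fun i => ?_
  rcases i with i | i | i
  · exact (hR.transpose.mulVec ha).coord i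
  · exact (hR.transpose.mulVec hb).coord i
  · exact (hR.transpose.mulVec hc).coord i

namespace Setup
variable {N : ℕ} (D : Setup N)

/-- The attitude error `R̃ = R R̂ᵀ` of a state. -/
def attErr (z : State) : Mat3 := z.1 * z.2.2.2.1ᵀ

/-- The position error `p̃` of a state. -/
noncomputable def posErr (z : State) : Vec3 :=
  z.2.1 - attErr z *ᵥ z.2.2.2.2.2.1 - (1 - attErr z) *ᵥ D.pc

/-- The velocity error `ṽ` of a state. -/
def velErr (z : State) : Vec3 := z.2.2.1 - attErr z *ᵥ z.2.2.2.2.2.2.1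

/-- The gravity error `g̃` of a state. -/
def gravErr (z : State) : Vec3 := D.g - attErr z *ᵥ z.2.2.2.2.2.2.2.1

theorem err_eq (z : State) :
    D.err z = (attErr z, z.2.2.2.2.1, stack z.1 (D.posErr z) (velErr z) (D.gravErr z),
      z.2.2.2.2.2.2.2.2.2) := rfl

/-- `z` flows with the closed loop on `[s, t]`, with `R, R̂ ∈ SO(3)`. -/
structure FlowsOn (z : ℝ → State) (s t : ℝ) : Prop where
  le : s ≤ t
  deriv : HasAEDerivOn z (fun r => D.flowMap r (z r)) s t
  rot : ∀ r ∈ Icc s t, (z r).1 ∈ SO3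
  rotEst : ∀ r ∈ Icc s t, (z r).2.2.2.1 ∈ SO3

namespace FlowsOn
variable {D} {z : ℝ → State} {s t : ℝ}

theorem restrict (h : D.FlowsOn z s t) {r : ℝ} (hr : r ∈ Icc s t) : D.FlowsOn z s r := by
  have hs : uIcc s r ⊆ uIcc s t := by
    rw [uIcc_of_le hr.1, uIcc_of_le h.le]; exact Icc_subset_Icc_right hr.2
  exact ⟨hr.1, h.deriv.mono hs, fun q hq => h.rot q ⟨hq.1, hq.2.trans hr.2⟩,
    fun q hq => h.rotEst q ⟨hq.1, hq.2.trans hr.2⟩⟩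

theorem attErr_mem (h : D.FlowsOn z s t) {r : ℝ} (hr : r ∈ Icc s t) : attErr (z r) ∈ SO3 :=
  SO3.mul_transpose_mem (h.rot r hr) (h.rotEst r hr)

theorem rot_deriv (h : D.FlowsOn z s t) :
    HasAEDerivOn (fun r => (z r).1) (fun r => (z r).1 * skew (D.ω r)) s t :=
  h.deriv.fst

theorem eta_eq (h : D.FlowsOn z s t) : ∀ r ∈ Icc s t, (z r).2.2.2.2.1 = (z s).2.2.2.2.1 := by
  have := h.deriv.snd.snd.snd.snd.fst.eq_of_zero
  rwa [uIcc_of_le h.le] at this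

theorem timer_eq (h : D.FlowsOn z s t) :
    ∀ r ∈ Icc s t, (z r).2.2.2.2.2.2.2.2.2 = (z s).2.2.2.2.2.2.2.2.2 - (r - s) := by
  have h1 : HasAEDerivOn (fun r => (z r).2.2.2.2.2.2.2.2.2) (fun _ => -1) s t :=
    h.deriv.snd.snd.snd.snd.snd.snd.snd.snd.snd
  have h2 : HasAEDerivOn (fun r : ℝ => r) (fun _ => 1) s t :=
    HasAEDerivOn.of_hasDerivAt (fun r => hasDerivAt_id r) continuous_const
  have h3 := ((h1.add h2).congr_deriv (g' := fun _ => 0) fun r _ => by simp).eq_of_zero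
  rw [uIcc_of_le h.le] at h3
  intro r hr
  have := h3 r hr
  linarith

/-- Body and estimate rotate with the same `ω`, which cancels in `R R̂ᵀ`; only the correction `η`
survives. -/
theorem attErr_deriv (h : D.FlowsOn z s t) :
    HasAEDerivOn (fun r => attErr (z r)) (fun r => -(attErr (z r) * skew (z r).2.2.2.2.1)) s t := by
  have hR := h.rot_deriv
  have hRh : HasAEDerivOn (fun r => (z r).2.2.2.1)
    (fun r => (z r).2.2.2.1 * skew (D.ω r + (z r).2.2.2.1ᵀ *ᵥ (z r).2.2.2.2.1)) s t :=
    h.deriv.snd.snd.snd.fst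
  refine (hR.matMul hRh.transpose).congr_deriv fun r hr => ?_
  rw [uIcc_of_le h.le] at hr
  rw [transpose_mul, transpose_skew, skew_add, attErr, Matrix.mul_assoc _ _ (skew (z r).2.2.2.2.1),
    ← SO3.skew_transpose_mulVec (h.rotEst r hr)]
  simp [Matrix.add_mul, Matrix.mul_add, Matrix.mul_assoc]

/-- Since `p̃ = (p - p_c) - R̃ (p̂ - p_c)`, the term `η^×(p̂ - p_c)` of the observer cancels the
derivative of `R̃`. The same mechanism gives `ṽ' = g̃`, where `R a` cancels against `R̃ R̂ a`, and
`g̃' = 0`. -/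
theorem posErr_deriv (h : D.FlowsOn z s t) :
    HasAEDerivOn (fun r => D.posErr (z r)) (fun r => velErr (z r)) s t := by
  have h1 : HasAEDerivOn (fun r => (z r).2.1) (fun r => (z r).2.2.1) s t := h.deriv.snd.fst
  have h2 : HasAEDerivOn (fun r => (z r).2.2.2.2.2.1) (fun r => skew (z r).2.2.2.2.1 *ᵥ
    ((z r).2.2.2.2.2.1 - D.pc) + (z r).2.2.2.2.2.2.1) s t := h.deriv.snd.snd.snd.snd.snd.fst
  have hE := h.attErr_deriv
  refine ((h1.sub (hE.mulVec h2)).sub (((HasAEDerivOn.const 1).sub hE).mulVec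
    (HasAEDerivOn.const D.pc))).congr_deriv fun r _ => ?_
  simp only [velErr, Matrix.mulVec_add, Matrix.mulVec_sub, Matrix.neg_mulVec, Matrix.sub_mulVec,
    Matrix.mulVec_mulVec, Matrix.mulVec_zero, Matrix.zero_mulVec]
  abel

theorem velErr_deriv (h : D.FlowsOn z s t) :
    HasAEDerivOn (fun r => velErr (z r)) (fun r => D.gravErr (z r)) s t := by
  have h1 : HasAEDerivOn (fun r => (z r).2.2.1) (fun r => D.g + (z r).1 *ᵥ D.a r) s t :=
    h.deriv.snd.snd.fst
  have h2 : HasAEDerivOn (fun r => (z r).2.2.2.2.2.2.1) (fun r => skew (z r).2.2.2.2.1 *ᵥ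
    (z r).2.2.2.2.2.2.1 + (z r).2.2.2.2.2.2.2.1 + (z r).2.2.2.1 *ᵥ D.a r) s t :=
    h.deriv.snd.snd.snd.snd.snd.snd.fst
  have hE := h.attErr_deriv
  refine (h1.sub (hE.mulVec h2)).congr_deriv fun r hr => ?_
  rw [uIcc_of_le h.le] at hr
  have e : attErr (z r) *ᵥ ((z r).2.2.2.1 *ᵥ D.a r) = (z r).1 *ᵥ D.a r := by
    rw [attErr, Matrix.mulVec_mulVec, Matrix.mul_assoc, (h.rotEst r hr).2.1, Matrix.mul_one]
  simp only [gravErr, Matrix.mulVec_add, e, Matrix.neg_mulVec]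
  simp only [Matrix.mulVec_mulVec]
  abel

theorem gravErr_deriv (h : D.FlowsOn z s t) :
    HasAEDerivOn (fun r => D.gravErr (z r)) (fun _ => 0) s t := by
  have h2 : HasAEDerivOn (fun r => (z r).2.2.2.2.2.2.2.1) (fun r => skew (z r).2.2.2.2.1 *ᵥ
    (z r).2.2.2.2.2.2.2.1) s t := h.deriv.snd.snd.snd.snd.snd.snd.snd.fst
  have hE := h.attErr_deriv
  refine ((HasAEDerivOn.const D.g).sub (hE.mulVec h2)).congr_deriv fun r hr => ?_
  simp only [Matrix.neg_mulVec, Matrix.mulVec_mulVec]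
  abel

theorem gravErr_eq (h : D.FlowsOn z s t) :
    ∀ r ∈ Icc s t, D.gravErr (z r) = D.gravErr (z s) := by
  have := h.gravErr_deriv.eq_of_zero
  rwa [uIcc_of_le h.le] at this

theorem velErr_eq (h : D.FlowsOn z s t) :
    ∀ r ∈ Icc s t, velErr (z r) = velErr (z s) + (r - s) • D.gravErr (z s) := by
  have h1 := (h.velErr_deriv.sub ((HasAEDerivOn.id_sub s s t).smul
    (HasAEDerivOn.const (D.gravErr (z s))))).congr_deriv (g' := fun _ => 0) fun r hr => by
      rw [uIcc_of_le h.le] at hr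
      rw [h.gravErr_eq r hr]; simp
  have h2 := h1.eq_of_zero
  rw [uIcc_of_le h.le] at h2
  intro r hr
  have := h2 r hr
  simp only [sub_self, zero_smul, sub_zero] at this
  rw [← this]; abel

theorem posErr_eq (h : D.FlowsOn z s t) :
    ∀ r ∈ Icc s t, D.posErr (z r) = D.posErr (z s) + (r - s) • velErr (z s) +
      ((r - s) ^ 2 / 2) • D.gravErr (z s) := by
  have h1 := ((h.posErr_deriv.sub ((HasAEDerivOn.id_sub s s t).smul
    (HasAEDerivOn.const (velErr (z s))))).sub ((HasAEDerivOn.id_sub_sq s s t).smul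
    (HasAEDerivOn.const (D.gravErr (z s))))).congr_deriv (g' := fun _ => 0) fun r hr => by
      rw [uIcc_of_le h.le] at hr
      rw [h.velErr_eq r hr]; simp
  have h2 := h1.eq_of_zero
  rw [uIcc_of_le h.le] at h2
  intro r hr
  have := h2 r hr
  simp only [sub_self, zero_smul, sub_zero, ne_eq, OfNat.ofNat_ne_zero, not_false_eq_true,
    zero_pow, zero_div] at this
  rw [← this]; abel

end FlowsOn

namespace FlowsOn
variable {D} {z : ℝ → State} {s t : ℝ}

theorem costate_deriv (h : D.FlowsOn z s t) (q : ℝ) (a b c : Vec3) :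
    HasAEDerivOn (fun r => costate q a b c r (z r).1)
      (fun r => -((D.A r)ᵀ *ᵥ costate q a b c r (z r).1)) s t := by
  have ha : HasAEDerivOn (fun _ : ℝ => a) (fun _ => 0) s t := HasAEDerivOn.const a
  have hb := (HasAEDerivOn.const (a := s) (b := t) b).sub ((HasAEDerivOn.id_sub q s t).smul ha)
  have hc := ((HasAEDerivOn.const (a := s) (b := t) c).sub ((HasAEDerivOn.id_sub q s t).smul
    (HasAEDerivOn.const b))).add ((HasAEDerivOn.id_sub_sq q s t).smul ha)
  refine (stack_hasAEDerivOn h.rot_deriv ha hb hc).congr_deriv fun r hr => ?_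
  simp only [costate, stack]
  rw [A_transpose_mulVec]
  ext i
  rcases i with i | i | i
  · simp [transpose_mul, transpose_skew, Matrix.neg_mulVec, Matrix.mulVec_mulVec]
  · simp [transpose_mul, transpose_skew, Matrix.neg_mulVec, Matrix.mulVec_mulVec, Matrix.mulVec_neg]
  · simp [transpose_mul, transpose_skew, Matrix.neg_mulVec, Matrix.mulVec_mulVec, Matrix.mulVec_add,
      Matrix.mulVec_sub, Matrix.mulVec_neg, Matrix.mulVec_smul]
    ring

theorem bilin_deriv (h : D.FlowsOn z s t) {P P' : ℝ → Mat9}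
    (hP : HasAEDerivOn P P' s t) (q : ℝ) (a b c a' b' c' : Vec3) :
    HasAEDerivOn (fun r => costate q a b c r (z r).1 ⬝ᵥ P r *ᵥ costate q a' b' c' r (z r).1)
      (fun r => costate q a b c r (z r).1 ⬝ᵥ (P' r - D.A r * P r - P r * (D.A r)ᵀ) *ᵥ
        costate q a' b' c' r (z r).1) s t := by
  have h1 := h.costate_deriv q a b c
  have h2 := h.costate_deriv q a' b' c'
  refine (h1.dot (hP.mulVec h2)).congr_deriv fun r _ => ?_
  generalize costate q a b c r (z r).1 = x
  generalize costate q a' b' c' r (z r).1 = y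
  have e : ((D.A r)ᵀ *ᵥ x) ⬝ᵥ P r *ᵥ y = x ⬝ᵥ (D.A r * P r) *ᵥ y := by
    rw [← Matrix.mulVec_mulVec, Matrix.dotProduct_mulVec x, ← Matrix.mulVec_transpose]
  simp only [Matrix.sub_mulVec, dotProduct_sub, neg_dotProduct, e, dotProduct_add,
    Matrix.mulVec_neg, dotProduct_neg, Matrix.mulVec_mulVec]
  ring

/-- Costates solve the adjoint equation, so the drift `A P + P Aᵀ` cancels and only the noise `V`
contributes. The growth of the covariance over an interval is then the integral of a quadratic form
along an explicit curve. -/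
theorem cov_deriv (h : D.FlowsOn z s t) (q : ℝ) (a b c a' b' c' : Vec3) :
    HasAEDerivOn (fun r => costate q a b c r (z r).1 ⬝ᵥ (z r).2.2.2.2.2.2.2.2.1 *ᵥ
        costate q a' b' c' r (z r).1)
      (fun r => costate q a b c r (z r).1 ⬝ᵥ D.V r *ᵥ costate q a' b' c' r (z r).1) s t := by
  have hP : HasAEDerivOn (fun r => (z r).2.2.2.2.2.2.2.2.1)
    (fun r => D.A r * (z r).2.2.2.2.2.2.2.2.1 + (z r).2.2.2.2.2.2.2.2.1 * (D.A r)ᵀ + D.V r) s t :=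
    h.deriv.snd.snd.snd.snd.snd.snd.snd.snd.fst
  refine (h.bilin_deriv hP q a b c a' b' c').congr_deriv fun r _ => ?_
  congr 2
  abel

end FlowsOn
end Setup

/-! ### The error covariance along flows and at jumps -/

/-- The squared norm of a triple of vectors. -/
def sqn (a b c : Vec3) : ℝ := a ⬝ᵥ a + b ⬝ᵥ b + c ⬝ᵥ c

theorem sqn_nonneg (a b c : Vec3) : 0 ≤ sqn a b c :=
  add_nonneg (add_nonneg (dotProduct_self_nonneg' a) (dotProduct_self_nonneg' b))
    (dotProduct_self_nonneg' c)

/-- A bound of the squared norm of the transition matrix of the triple integrator over times up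
to `T`. -/
def transBound (T : ℝ) : ℝ := 3 * (1 + T ^ 2 + T ^ 4)

theorem transBound_pos (T : ℝ) : 0 < transBound T := by unfold transBound; positivity

theorem one_le_transBound (T : ℝ) : 1 ≤ transBound T := by
  unfold transBound; nlinarith [sq_nonneg T, sq_nonneg (T ^ 2)]

theorem sqn_shift_le {h T : ℝ} (hT : |h| ≤ T) (a b c : Vec3) :
    sqn a (b + h • a) (c + h • b + (h ^ 2 / 2) • a) ≤ transBound T * sqn a b c := by
  have h2 : h ^ 2 ≤ T ^ 2 := sq_le_sq' (by linarith [neg_abs_le h]) (by linarith [le_abs_self h])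
  have h4 : h ^ 4 ≤ T ^ 4 := by nlinarith [sq_nonneg h, sq_nonneg T]
  have key : ∀ x y w : ℝ, x * x + (y + h * x) * (y + h * x) +
      (w + h * y + h ^ 2 / 2 * x) * (w + h * y + h ^ 2 / 2 * x) ≤
      transBound T * (x * x + y * y + w * w) := fun x y w => by
    have e1 : (y + h * x) * (y + h * x) ≤ 2 * (y * y) + 2 * (h ^ 2 * (x * x)) := by
      nlinarith [sq_nonneg (y - h * x)]
    have e2 : (w + h * y + h ^ 2 / 2 * x) * (w + h * y + h ^ 2 / 2 * x) ≤
        3 * (w * w) + 3 * (h ^ 2 * (y * y)) + 3 / 4 * (h ^ 4 * (x * x)) := by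
      nlinarith [sq_nonneg (w - h * y), sq_nonneg (w - h ^ 2 / 2 * x),
        sq_nonneg (h * y - h ^ 2 / 2 * x)]
    have e3 : h ^ 2 * (x * x) ≤ T ^ 2 * (x * x) := mul_le_mul_of_nonneg_right h2 (mul_self_nonneg x)
    have e4 : h ^ 2 * (y * y) ≤ T ^ 2 * (y * y) := mul_le_mul_of_nonneg_right h2 (mul_self_nonneg y)
    have e5 : h ^ 4 * (x * x) ≤ T ^ 4 * (x * x) := mul_le_mul_of_nonneg_right h4 (mul_self_nonneg x)
    have e6 : 0 ≤ T ^ 4 * (y * y) := mul_nonneg (by positivity) (mul_self_nonneg y)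
    have e7 : 0 ≤ (T ^ 2 + T ^ 4) * (w * w) := mul_nonneg (by positivity) (mul_self_nonneg w)
    have e8 : 0 ≤ (T ^ 2 + T ^ 4) * (x * x) := mul_nonneg (by positivity) (mul_self_nonneg x)
    unfold transBound
    nlinarith [mul_self_nonneg x, mul_self_nonneg y, mul_self_nonneg w, sq_nonneg T]
  have k0 := key (a 0) (b 0) (c 0)
  have k1 := key (a 1) (b 1) (c 1)
  have k2 := key (a 2) (b 2) (c 2)
  simp only [sqn, dotProduct, Fin.sum_univ_three, Pi.add_apply, Pi.smul_apply, smul_eq_mul]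
  linarith

theorem abs_quadForm_le {n : Type*} [Fintype n] {H : Matrix n n ℝ} {β : ℝ}
    (hβ : ∀ i j, |H i j| ≤ β) (x : n → ℝ) :
    x ⬝ᵥ H *ᵥ x ≤ β * Fintype.card n * (x ⬝ᵥ x) := by
  have h1 : x ⬝ᵥ H *ᵥ x = ∑ i, ∑ j, x i * (H i j * x j) := by
    simp only [dotProduct, Matrix.mulVec, Finset.mul_sum]
  have h2 : ∀ i j, x i * (H i j * x j) ≤ β * ((x i * x i + x j * x j) / 2) := fun i j => by
    have hb := hβ i j
    have h0 : 0 ≤ β := (abs_nonneg _).trans hb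
    calc x i * (H i j * x j) ≤ |x i * (H i j * x j)| := le_abs_self _
      _ = |H i j| * (|x i| * |x j|) := by rw [abs_mul, abs_mul]; ring
      _ ≤ β * (|x i| * |x j|) := mul_le_mul_of_nonneg_right hb (by positivity)
      _ ≤ β * ((x i * x i + x j * x j) / 2) := by
        refine mul_le_mul_of_nonneg_left ?_ h0
        nlinarith [sq_nonneg (|x i| - |x j|), abs_mul_abs_self (x i), abs_mul_abs_self (x j)]
  calc x ⬝ᵥ H *ᵥ x ≤ ∑ i, ∑ j, β * ((x i * x i + x j * x j) / 2) := by
        rw [h1]; exact Finset.sum_le_sum fun i _ => Finset.sum_le_sum fun j _ => h2 i j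
    _ = β * Fintype.card n * (x ⬝ᵥ x) := by
        simp only [← Finset.mul_sum, ← Finset.sum_div, Finset.sum_add_distrib, Finset.sum_const,
          Finset.card_univ, nsmul_eq_mul, dotProduct]
        have e : ∑ i, x i * ((Fintype.card n : ℝ) * x i) = Fintype.card n * ∑ i, x i * x i := by
          rw [Finset.mul_sum]
          exact Finset.sum_congr rfl fun i _ => by ring
        rw [e]
        ring

namespace Setup
variable {N : ℕ} (D : Setup N)

/-- The Riccati matrix of a state. -/
abbrev cov (z : State) : Mat9 := z.2.2.2.2.2.2.2.2.1

/-- The quadratic form of the Riccati matrix in the inertial frame. -/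
def covForm (z : State) (a b c : Vec3) : ℝ := stack z.1 a b c ⬝ᵥ cov z *ᵥ stack z.1 a b c

/-- The pairing of a triple of vectors with the errors `p̃, ṽ, g̃`. -/
noncomputable def pairing (z : State) (a b c : Vec3) : ℝ :=
  a ⬝ᵥ D.posErr z + b ⬝ᵥ velErr z + c ⬝ᵥ D.gravErr z

theorem covForm_nonneg {z : State} (h : ∀ x, 0 ≤ x ⬝ᵥ cov z *ᵥ x) (a b c : Vec3) :
    0 ≤ covForm z a b c := h _

theorem pairing_eq {z : State} (hz : z.1 ∈ SO3) (a b c : Vec3) :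
    D.pairing z a b c = stack z.1 a b c ⬝ᵥ stack z.1 (D.posErr z) (velErr z) (D.gravErr z) := by
  rw [stack_dotProduct hz]; rfl

theorem quadForm_nonneg_of_covForm {z : State} (hz : z.1 ∈ SO3)
    (h : ∀ a b c, 0 ≤ covForm z a b c) (x : Idx9 → ℝ) : 0 ≤ x ⬝ᵥ cov z *ᵥ x := by
  obtain ⟨a, b, c, rfl⟩ := exists_eq_stack hz x
  exact h a b c

theorem cov_ext {R : Mat3} (hR : R ∈ SO3) {P P' : Mat9}
    (h : ∀ a b c a' b' c', stack R a b c ⬝ᵥ P *ᵥ stack R a' b' c' =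
      stack R a b c ⬝ᵥ P' *ᵥ stack R a' b' c') : P = P' := by
  ext i j
  obtain ⟨a, b, c, hx⟩ := exists_eq_stack hR (Pi.single i 1)
  obtain ⟨a', b', c', hy⟩ := exists_eq_stack hR (Pi.single j 1)
  have := h a b c a' b' c'
  rw [← hx, ← hy] at this
  simpa using this

namespace FlowsOn
variable {D} {z : ℝ → State} {s t : ℝ}

theorem costate_start (R : Mat3) (a b c : Vec3) : costate t a b c s R =
    stack R a (b + (t - s) • a) (c + (t - s) • b + ((t - s) ^ 2 / 2) • a) := by
  rw [costate]
  congr 1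
  · rw [← neg_sub t s, neg_smul, sub_neg_eq_add]
  · rw [← neg_sub t s, neg_smul, sub_neg_eq_add, neg_sq]

/-- The pairing of a costate with the error is constant along a flow; the right side is the costate
with final value `(a, b, c)`, evaluated at the start. -/
theorem pairing_flow (h : D.FlowsOn z s t) (a b c : Vec3) :
    D.pairing (z t) a b c = D.pairing (z s) a (b + (t - s) • a)
      (c + (t - s) • b + ((t - s) ^ 2 / 2) • a) := by
  have ht : t ∈ Icc s t := ⟨h.le, le_rfl⟩
  rw [pairing, pairing, h.posErr_eq t ht, h.velErr_eq t ht, h.gravErr_eq t ht]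
  simp only [dotProduct_add, add_dotProduct, dotProduct_smul, smul_dotProduct, smul_eq_mul]
  ring

/-- The bilinear form of `P` and its transpose have the same derivative along costates, because `V`
is symmetric. -/
theorem cov_symm (h : D.FlowsOn z s t) (hV : ∀ r ∈ Icc s t, (D.V r)ᵀ = D.V r)
    (hs : (cov (z s))ᵀ = cov (z s)) : (cov (z t))ᵀ = cov (z t) := by
  have ht : t ∈ Icc s t := ⟨h.le, le_rfl⟩
  have tr : ∀ (H : Mat9) (x y : Idx9 → ℝ), x ⬝ᵥ Hᵀ *ᵥ y = y ⬝ᵥ H *ᵥ x := fun H x y => by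
    rw [Matrix.dotProduct_mulVec, ← Matrix.mulVec_transpose, transpose_transpose, dotProduct_comm]
  refine cov_ext (h.rot t ht) fun a b c a' b' c' => ?_
  have h1 := ((h.cov_deriv t a' b' c' a b c).sub (h.cov_deriv t a b c a' b' c')).congr_deriv
    (g' := fun _ => 0) fun r hr => by
      rw [uIcc_of_le h.le] at hr
      rw [← tr, hV r hr, sub_self]
  have h2 := h1.eq_of_zero t (by simp)
  simp only [costate_self] at h2
  have h3 : costate t a' b' c' s (z s).1 ⬝ᵥ (z s).2.2.2.2.2.2.2.2.1 *ᵥ costate t a b c s (z s).1 =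
      costate t a b c s (z s).1 ⬝ᵥ (z s).2.2.2.2.2.2.2.2.1 *ᵥ costate t a' b' c' s (z s).1 := by
    rw [← tr, show (z s).2.2.2.2.2.2.2.2.1ᵀ = (z s).2.2.2.2.2.2.2.2.1 from hs]
  rw [h3, sub_self, sub_eq_zero] at h2
  rw [tr]
  exact h2

theorem costate_sq_le (h : D.FlowsOn z s t) {T : ℝ} (hT : t - s ≤ T) {r : ℝ} (hr : r ∈ Icc s t)
    (a b c : Vec3) : costate t a b c r (z r).1 ⬝ᵥ costate t a b c r (z r).1 ≤
      transBound T * sqn a b c := by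
  rw [costate_start, stack_dotProduct (h.rot r hr)]
  exact sqn_shift_le (by rw [abs_of_nonneg (by linarith [hr.2])]; linarith [hr.1]) a b c

theorem le_costate_sq (h : D.FlowsOn z s t) {T : ℝ} (hT : t - s ≤ T) {r : ℝ} (hr : r ∈ Icc s t)
    (a b c : Vec3) : sqn a (b + (t - s) • a) (c + (t - s) • b + ((t - s) ^ 2 / 2) • a) ≤
      transBound T * (costate t a b c r (z r).1 ⬝ᵥ costate t a b c r (z r).1) := by
  rw [costate_start, stack_dotProduct (h.rot r hr)]
  have := sqn_shift_le (h := r - s) (T := T) (by rw [abs_of_nonneg (by linarith [hr.1])]; linarith [hr.2])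
    a (b + (t - r) • a) (c + (t - r) • b + ((t - r) ^ 2 / 2) • a)
  refine le_trans (le_of_eq ?_) this
  congr 1
  · module
  · module

theorem covForm_flow_le (h : D.FlowsOn z s t) {T β : ℝ} (hT : t - s ≤ T) (hβ : 0 ≤ β)
    (hV : ∀ r ∈ Icc s t, ∀ x, x ⬝ᵥ D.V r *ᵥ x ≤ β * (x ⬝ᵥ x)) (a b c : Vec3) :
    covForm (z t) a b c ≤ covForm (z s) a (b + (t - s) • a)
      (c + (t - s) • b + ((t - s) ^ 2 / 2) • a) + β * transBound T * T * sqn a b c := by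
  have h1 := (h.cov_deriv t a b c a b c).sub_le_sub h.le
    (((HasAEDerivOn.id_sub s s t).smul (HasAEDerivOn.const (β * transBound T * sqn a b c))))
    (fun r hr => by
      refine (hV r hr _).trans ?_
      have := mul_le_mul_of_nonneg_left (h.costate_sq_le hT hr a b c) hβ
      simpa [mul_assoc] using this)
  simp only [costate_self, costate_start] at h1
  have h2 : (t - s) * (β * transBound T * sqn a b c) ≤ T * (β * transBound T * sqn a b c) :=
    mul_le_mul_of_nonneg_right hT
      (mul_nonneg (mul_nonneg hβ (transBound_pos T).le) (sqn_nonneg a b c))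
  simp only [covForm, cov]
  simp only [smul_eq_mul, sub_self, zero_mul, sub_zero] at h1
  linarith

/-- The gain from the noise is expressed by the costate at the start, because there it is compared
with the upper bound of the covariance in `ErrLe.flow_contract`. -/
theorem covForm_flow_ge (h : D.FlowsOn z s t) {T β : ℝ} (hT : t - s ≤ T) (hβ : 0 ≤ β)
    (hV : ∀ r ∈ Icc s t, ∀ x, β * (x ⬝ᵥ x) ≤ x ⬝ᵥ D.V r *ᵥ x) (a b c : Vec3) :
    covForm (z s) a (b + (t - s) • a) (c + (t - s) • b + ((t - s) ^ 2 / 2) • a) +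
      β / transBound T * (t - s) *
        sqn a (b + (t - s) • a) (c + (t - s) • b + ((t - s) ^ 2 / 2) • a) ≤ covForm (z t) a b c := by
  have hK := transBound_pos T
  have h1 := HasAEDerivOn.sub_le_sub h.le ((HasAEDerivOn.id_sub s s t).smul (HasAEDerivOn.const
    (β / transBound T * sqn a (b + (t - s) • a) (c + (t - s) • b + ((t - s) ^ 2 / 2) • a))))
    (h.cov_deriv t a b c a b c) (fun r hr => by
      refine le_trans ?_ (hV r hr _)
      have := mul_le_mul_of_nonneg_left (h.le_costate_sq hT hr a b c) (div_nonneg hβ hK.le)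
      rw [← mul_assoc, div_mul_cancel₀ _ hK.ne'] at this
      simpa using this)
  simp only [costate_self, costate_start] at h1
  simp only [covForm, cov]
  simp only [smul_eq_mul, sub_self, zero_mul, sub_zero] at h1
  linarith

end FlowsOn

/-! ### Errors and covariance across a jump -/

section Jump
variable {D} {z z' : State} {kR t : ℝ}

theorem jump_rot (h : z' ∈ D.jumpMap kR t z) : z'.1 = z.1 := by
  obtain ⟨ν, -, rfl⟩ := h; rfl

theorem jump_rotEst (h : z' ∈ D.jumpMap kR t z) : z'.2.2.2.1 = z.2.2.2.1 := by
  obtain ⟨ν, -, rfl⟩ := h; rfl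

theorem jump_attErr (h : z' ∈ D.jumpMap kR t z) : attErr z' = attErr z := by
  rw [attErr, attErr, jump_rot h, jump_rotEst h]

theorem jump_cov (h : z' ∈ D.jumpMap kR t z) : cov z' = riccati (cov z) (D.Q t) := by
  obtain ⟨ν, -, rfl⟩ := h; rfl

theorem jump_timer (h : z' ∈ D.jumpMap kR t z) :
    z'.2.2.2.2.2.2.2.2.2 ∈ Icc D.Tm D.TM := by
  obtain ⟨ν, hν, rfl⟩ := h; exact hν

theorem jump_eta (hk1 : ∑ i, D.k i = 1) (h : z' ∈ D.jumpMap kR t z) :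
    z'.2.2.2.2.1 = kR • sig D.M (attErr z) := by
  obtain ⟨ν, -, rfl⟩ := h
  exact congrArg (kR • ·) (D.sigmaR_eq hk1 _ _ _ _)

/-- As the weights sum to `1`, the averaged residual involves the landmarks only through `p_c`, the
point about which `p̃` is defined. Seen through `R̂ᵀ`, it is exactly `Rᵀ p̃`, free of the attitude
error. -/
theorem rotEst_transpose_mulVec_innov (hk1 : ∑ i, D.k i = 1) (hz : z.1 ∈ SO3)
    (hz' : z.2.2.2.1 ∈ SO3) :
    z.2.2.2.1ᵀ *ᵥ D.innov z.2.2.2.1 z.2.2.2.2.2.1 (D.meas z.1 z.2.1) =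
      z.1ᵀ *ᵥ D.posErr z := by
  have e : D.innov z.2.2.2.1 z.2.2.2.2.2.1 (D.meas z.1 z.2.1) =
      D.pc - z.2.2.2.2.2.1 - (attErr z)ᵀ *ᵥ (D.pc - z.2.1) := by
    have h1 : ∀ i, D.k i • (D.p i - z.2.2.2.2.2.1 - z.2.2.2.1 *ᵥ D.meas z.1 z.2.1 i) =
        (1 - (attErr z)ᵀ) *ᵥ (D.k i • D.p i) +
          D.k i • ((attErr z)ᵀ *ᵥ z.2.1 - z.2.2.2.2.2.1) := fun i => by
      have : z.2.2.2.1 *ᵥ D.meas z.1 z.2.1 i =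
          (attErr z)ᵀ *ᵥ D.p i - (attErr z)ᵀ *ᵥ z.2.1 := by
        rw [meas, Matrix.mulVec_mulVec, attErr, transpose_mul, transpose_transpose,
          Matrix.mulVec_sub]
      rw [this, Matrix.sub_mulVec, Matrix.one_mulVec, Matrix.mulVec_smul]
      module
    rw [innov, Finset.sum_congr rfl fun i _ => h1 i, Finset.sum_add_distrib, ← Finset.sum_smul, hk1,
      ← Matrix.mulVec_sum]
    change (1 - (attErr z)ᵀ) *ᵥ D.pc + _ = _
    rw [Matrix.sub_mulVec, Matrix.one_mulVec, Matrix.mulVec_sub]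
    module
  have hE : z.1ᵀ *ᵥ (attErr z *ᵥ (D.pc - z.2.2.2.2.2.1)) = z.2.2.2.1ᵀ *ᵥ (D.pc - z.2.2.2.2.2.1) := by
    rw [Matrix.mulVec_mulVec, attErr, ← Matrix.mul_assoc, hz.2.1, Matrix.one_mul]
  have hE' : z.2.2.2.1ᵀ *ᵥ ((attErr z)ᵀ *ᵥ (D.pc - z.2.1)) = z.1ᵀ *ᵥ (D.pc - z.2.1) := by
    rw [Matrix.mulVec_mulVec, attErr, transpose_mul, transpose_transpose, ← Matrix.mul_assoc,
      hz'.2.1, Matrix.one_mul]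
  have hp : D.posErr z = attErr z *ᵥ (D.pc - z.2.2.2.2.2.1) - (D.pc - z.2.1) := by
    rw [posErr, Matrix.sub_mulVec, Matrix.one_mulVec, Matrix.mulVec_sub]
    abel
  rw [e, hp, Matrix.mulVec_sub, hE', Matrix.mulVec_sub _ (attErr z *ᵥ _), hE]

/-- The attitude error does not jump and `R̃ R̂ = R`, so the corrections `R̂ K R̂ᵀ y` become `K C x`
in body coordinates: the error update of a linear Kalman filter. -/
theorem jump_errors (hk1 : ∑ i, D.k i = 1) (hz : z.1 ∈ SO3) (hz' : z.2.2.2.1 ∈ SO3)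
    (h : z' ∈ D.jumpMap kR t z) :
    stack z'.1 (D.posErr z') (velErr z') (D.gravErr z') =
      stack z.1 (D.posErr z) (velErr z) (D.gravErr z) - gain (cov z) (D.Q t) *ᵥ (C *ᵥ
        stack z.1 (D.posErr z) (velErr z) (D.gravErr z)) := by
  have hy := rotEst_transpose_mulVec_innov hk1 hz hz'
  have hE := jump_attErr h
  have key : ∀ (K : Mat3) (w : Vec3), z.1ᵀ *ᵥ (attErr z *ᵥ ((z.2.2.2.1 * K * z.2.2.2.1ᵀ) *ᵥ w)) =
      K *ᵥ (z.2.2.2.1ᵀ *ᵥ w) := fun K w => by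
    rw [Matrix.mulVec_mulVec, Matrix.mulVec_mulVec, attErr, Matrix.mulVec_mulVec]
    congr 1
    calc z.1ᵀ * (z.1 * z.2.2.2.1ᵀ) * (z.2.2.2.1 * K * z.2.2.2.1ᵀ) =
        (z.1ᵀ * z.1) * ((z.2.2.2.1ᵀ * z.2.2.2.1) * (K * z.2.2.2.1ᵀ)) := by
          simp only [Matrix.mul_assoc]
      _ = K * z.2.2.2.1ᵀ := by rw [hz.2.1, hz'.2.1, Matrix.one_mul, Matrix.one_mul]
  have hC : C *ᵥ stack z.1 (D.posErr z) (velErr z) (D.gravErr z) = z.1ᵀ *ᵥ D.posErr z := by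
    rw [stack, C_mulVec]
  rw [hC, ← hy]
  set K := gain (cov z) (D.Q t) with hK
  set y := D.innov z.2.2.2.1 z.2.2.2.2.2.1 (D.meas z.1 z.2.1) with hyd
  have hKw : ∀ w, K *ᵥ w = Sum.elim (gainP K *ᵥ w) (Sum.elim (gainV K *ᵥ w) (gainG K *ᵥ w)) :=
    fun w => by ext i; rcases i with i | i | i <;> rfl
  have hp : D.posErr z' = D.posErr z - attErr z *ᵥ ((z.2.2.2.1 * gainP K * z.2.2.2.1ᵀ) *ᵥ y) := by
    rw [posErr, posErr, hE]
    obtain ⟨ν, -, rfl⟩ := h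
    change _ - attErr z *ᵥ (_ + (z.2.2.2.1 * gainP K * z.2.2.2.1ᵀ) *ᵥ y) - _ = _
    rw [Matrix.mulVec_add]
    abel
  have hv : velErr z' = velErr z - attErr z *ᵥ ((z.2.2.2.1 * gainV K * z.2.2.2.1ᵀ) *ᵥ y) := by
    rw [velErr, velErr, hE]
    obtain ⟨ν, -, rfl⟩ := h
    change _ - attErr z *ᵥ (_ + (z.2.2.2.1 * gainV K * z.2.2.2.1ᵀ) *ᵥ y) = _
    rw [Matrix.mulVec_add]
    abel
  have hg : D.gravErr z' = D.gravErr z - attErr z *ᵥ ((z.2.2.2.1 * gainG K * z.2.2.2.1ᵀ) *ᵥ y) := by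
    rw [gravErr, gravErr, hE]
    obtain ⟨ν, -, rfl⟩ := h
    change _ - attErr z *ᵥ (_ + (z.2.2.2.1 * gainG K * z.2.2.2.1ᵀ) *ᵥ y) = _
    rw [Matrix.mulVec_add]
    abel
  rw [hKw, jump_rot h, hp, hv, hg]
  simp only [stack, Matrix.mulVec_sub, key]
  ext i
  rcases i with i | i | i <;> rfl

variable (hP : (cov z)ᵀ = cov z) (hP0 : ∀ x, 0 ≤ x ⬝ᵥ cov z *ᵥ x) (hQ : (D.Q t).PosDef)

include hP hP0 hQ

/-- The vector `m` is free: it stands for an arbitrary, possibly suboptimal, gain with which the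
Kalman update is compared. -/
theorem covForm_jump_le (hz : z.1 ∈ SO3) (h : z' ∈ D.jumpMap kR t z) {β : ℝ}
    (hβ : ∀ x, x ⬝ᵥ D.Q t *ᵥ x ≤ β * (x ⬝ᵥ x)) (a b c m : Vec3) :
    covForm z' a b c ≤ covForm z (a - m) b c + β * (m ⬝ᵥ m) := by
  rw [covForm, covForm, jump_cov h, jump_rot h, ← stack_sub_C]
  refine (riccati_le hP hP0 hQ _ (z.1ᵀ *ᵥ m)).trans (by
    have := hβ (z.1ᵀ *ᵥ m)
    rw [SO3.mulVec_dot_self (SO3.transpose_mem hz)] at this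
    linarith)

/-- The witness is `m = R Kᵀ λ`: pulling `λ` back through `x⁺ = x - K C x` gives `λ - CᵀKᵀλ`, the
minimizer in the Riccati update. The form drops by the nonnegative `Q`-term. -/
theorem exists_pairing_jump (hk1 : ∑ i, D.k i = 1) (hz : z.1 ∈ SO3) (hz' : z.2.2.2.1 ∈ SO3)
    (h : z' ∈ D.jumpMap kR t z) (a b c : Vec3) :
    ∃ m, D.pairing z' a b c = D.pairing z (a - m) b c ∧
      covForm z (a - m) b c ≤ covForm z' a b c := by
  have hm : Cᵀ *ᵥ ((gain (cov z) (D.Q t))ᵀ *ᵥ stack z.1 a b c) = Cᵀ *ᵥ (z.1ᵀ *ᵥ (z.1 *ᵥ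
      ((gain (cov z) (D.Q t))ᵀ *ᵥ stack z.1 a b c))) := by
    rw [Matrix.mulVec_mulVec _ z.1ᵀ z.1, hz.2.1, Matrix.one_mulVec]
  refine ⟨z.1 *ᵥ ((gain (cov z) (D.Q t))ᵀ *ᵥ stack z.1 a b c), ?_, ?_⟩
  · have hz1 : z'.1 ∈ SO3 := by rw [jump_rot h]; exact hz
    rw [pairing_eq D hz1, pairing_eq D hz, jump_errors hk1 hz hz' h, jump_rot h, ← stack_sub_C, ← hm,
      dotProduct_sub, sub_dotProduct]
    congr 1
    rw [Matrix.dotProduct_mulVec, ← Matrix.mulVec_transpose, Matrix.dotProduct_mulVec,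
      ← Matrix.mulVec_transpose]
  · rw [covForm, covForm, jump_cov h, jump_rot h, ← stack_sub_C, ← hm, riccati_eq hP hP0 hQ]
    have := quadForm_nonneg hQ.posSemidef ((gain (cov z) (D.Q t))ᵀ *ᵥ stack z.1 a b c)
    linarith

theorem cov_nonneg_jump (h : z' ∈ D.jumpMap kR t z) (x : Idx9 → ℝ) :
    0 ≤ x ⬝ᵥ cov z' *ᵥ x := by
  rw [jump_cov h, riccati_eq hP hP0 hQ]
  exact add_nonneg (hP0 _) (quadForm_nonneg hQ.posSemidef _)

end Jump
end Setup

/-! ### Global existence for linear differential equations -/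

section LinearODE
variable {E : Type*} [NormedAddCommGroup E] [NormedSpace ℝ E]

theorem HasAEDerivOn.of_hasDerivWithinAt {f f' : ℝ → E} {a b C : ℝ} (hab : a ≤ b)
    (hf : ∀ t ∈ Icc a b, HasDerivWithinAt f (f' t) (Icc a b) t) (hC : ∀ t ∈ Icc a b, ‖f' t‖ ≤ C) :
    HasAEDerivOn f f' a b := by
  constructor
  · refine LipschitzOnWith.absolutelyContinuousOnInterval (K := C.toNNReal) ?_
    rw [uIcc_of_le hab]
    refine (convex_Icc a b).lipschitzOnWith_of_nnnorm_hasDerivWithin_le hf fun t ht => ?_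
    rw [← NNReal.coe_le_coe, coe_nnnorm]
    exact (hC t ht).trans (Real.le_coe_toNNReal C)
  · have := (Set.Finite.measure_zero (s := ({a, b} : Set ℝ)) (by simp) volume)
    rw [measure_eq_zero_iff_ae_notMem] at this
    filter_upwards [this] with t ht hm
    rw [uIcc_of_le hab] at hm
    simp only [Set.mem_insert_iff, Set.mem_singleton_iff, not_or] at ht
    exact (hf t hm).hasDerivAt (Icc_mem_nhds (lt_of_le_of_ne hm.1 (Ne.symm ht.1))
      (lt_of_le_of_ne hm.2 ht.2))

theorem hasDerivWithinAt_glue {α β : ℝ → E} {f : ℝ → E → E} {a b c : ℝ} (hab : a ≤ b) (hbc : b ≤ c)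
    (hα : ∀ t ∈ Icc a b, HasDerivWithinAt α (f t (α t)) (Icc a b) t)
    (hβ : ∀ t ∈ Icc b c, HasDerivWithinAt β (f t (β t)) (Icc b c) t) (he : β b = α b) :
    ∀ t ∈ Icc a c, HasDerivWithinAt (fun s => if s ≤ b then α s else β s)
      (f t (if t ≤ b then α t else β t)) (Icc a c) t := by
  set γ : ℝ → E := fun s => if s ≤ b then α s else β s with hγ
  have eα : ∀ s ∈ Icc a b, γ s = α s := fun s hs => by simp [hγ, hs.2]
  have eβ : ∀ s ∈ Icc b c, γ s = β s := fun s hs => by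
    rcases hs.1.eq_or_lt with e | e
    · simp [hγ, ← e, he]
    · simp [hγ, not_le.2 e]
  have h1 : ∀ t ∈ Icc a b, HasDerivWithinAt γ (f t (γ t)) (Icc a b) t := fun t ht => by
    rw [eα t ht]; exact (hα t ht).congr eα (eα t ht)
  have h2 : ∀ t ∈ Icc b c, HasDerivWithinAt γ (f t (γ t)) (Icc b c) t := fun t ht => by
    rw [eβ t ht]; exact (hβ t ht).congr eβ (eβ t ht)
  intro t ht
  change HasDerivWithinAt γ (f t (γ t)) (Icc a c) t
  rcases lt_trichotomy t b with e | e | e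
  · refine (h1 t ⟨ht.1, e.le⟩).mono_of_mem_nhdsWithin ?_
    filter_upwards [self_mem_nhdsWithin, mem_nhdsWithin_of_mem_nhds (Iio_mem_nhds e)] with s hs hs'
    exact ⟨hs.1, hs'.le⟩
  · have h := (h1 t ⟨ht.1, e.le⟩).union (h2 t ⟨e.ge, ht.2⟩)
    rwa [Icc_union_Icc_eq_Icc hab hbc] at h
  · refine (h2 t ⟨e.le, ht.2⟩).mono_of_mem_nhdsWithin ?_
    filter_upwards [self_mem_nhdsWithin, mem_nhdsWithin_of_mem_nhds (Ioi_mem_nhds e)] with s hs hs'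
    exact ⟨hs'.le, hs.2⟩

variable [CompleteSpace E]

/-- The admissible length depends only on the bound of the coefficients and not on the initial
value, so finitely many steps cover any compact interval. -/
theorem exists_linear_ode_step {L : ℝ → E →L[ℝ] E} {u : ℝ → E} {a b : ℝ} {K : NNReal} {B : ℝ}
    (hab : a ≤ b) (hL : ContinuousOn L (Icc a b)) (hu : ContinuousOn u (Icc a b))
    (hK : ∀ t ∈ Icc a b, ‖L t‖ ≤ K) (hB : ∀ t ∈ Icc a b, ‖u t‖ ≤ B)
    (hδ : (1 + 2 * K) * (b - a) ≤ 1) (x : E) :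
    ∃ α : ℝ → E, α a = x ∧
      ∀ t ∈ Icc a b, HasDerivWithinAt α (L t (α t) + u t) (Icc a b) t := by
  have hB0 : 0 ≤ B := (norm_nonneg _).trans (hB a ⟨le_rfl, hab⟩)
  -- In the ball of radius `r` about `x` one has `‖y‖ ≤ 2r`, and the choice of `r` bounds the speed
  -- by `2 K r + B ≤ (1 + 2K) r`. Over the allowed length the solution therefore cannot leave the
  -- ball.
  set r : NNReal := ⟨‖x‖ + B + 1, by positivity⟩ with hr
  have hpl : IsPicardLindelof (fun t y => L t y + u t) (⟨a, le_rfl, hab⟩ : Icc a b) x r 0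
      ((1 + 2 * K) * r) K := by
    refine ⟨fun t ht => ?_, fun y _ => ?_, fun t ht y hy => ?_, ?_⟩
    · refine LipschitzOnWith.of_dist_le_mul fun y _ w _ => ?_
      rw [dist_add_right, dist_eq_norm, dist_eq_norm, ← map_sub]
      exact (L t).le_of_opNorm_le (hK t ht) _
    · exact (hL.clm_apply continuousOn_const).add hu
    · have hy' : ‖y‖ ≤ ‖x‖ + r := by
        have := norm_sub_norm_le y x
        rw [Metric.mem_closedBall, dist_eq_norm] at hy
        linarith
      have h1 := (L t).le_of_opNorm_le (hK t ht) y
      have h2 := hB t ht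
      have h3 : (r : ℝ) = ‖x‖ + B + 1 := rfl
      have h4 : (K : ℝ) * ‖y‖ ≤ K * (2 * r) := by
        refine mul_le_mul_of_nonneg_left ?_ K.2
        linarith
      have h5 := norm_add_le (L t y) (u t)
      push_cast
      nlinarith [norm_nonneg x]
    · have h3 : (0 : ℝ) ≤ r := r.2
      simp only [sub_self, NNReal.coe_zero, sub_zero]
      rw [max_eq_left (by linarith)]
      push_cast
      nlinarith
  exact hpl.exists_eq_forall_mem_Icc_hasDerivWithinAt₀

theorem exists_linear_ode {L : ℝ → E →L[ℝ] E} {u : ℝ → E} {a b : ℝ} (hab : a ≤ b)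
    (hL : ContinuousOn L (Icc a b)) (hu : ContinuousOn u (Icc a b)) (x : E) :
    ∃ α : ℝ → E, α a = x ∧ HasAEDerivOn α (fun t => L t (α t) + u t) a b := by
  obtain ⟨K', hK'⟩ := isCompact_Icc.exists_bound_of_continuousOn hL
  obtain ⟨B, hB⟩ := isCompact_Icc.exists_bound_of_continuousOn hu
  set K := K'.toNNReal
  have hK : ∀ t ∈ Icc a b, ‖L t‖ ≤ K := fun t ht => (hK' t ht).trans (Real.le_coe_toNNReal K')
  set δ : ℝ := 1 / (1 + 2 * K) with hδ
  have hpos : (0 : ℝ) < 1 + 2 * K := by positivity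
  have hδ0 : 0 < δ := by positivity
  have step : ∀ n : ℕ, ∃ α : ℝ → E, α a = x ∧ ∀ t ∈ Icc a (min b (a + n * δ)),
      HasDerivWithinAt α (L t (α t) + u t) (Icc a (min b (a + n * δ))) t := by
    intro n
    induction n with
    | zero =>
      refine ⟨fun _ => x, rfl, fun t _ => ?_⟩
      have e : Icc a (min b (a + (0 : ℕ) * δ)) = {a} := by simp [hab]
      rw [e]
      exact hasDerivWithinAt_iff_hasFDerivWithinAt.2
        (HasFDerivWithinAt.of_subsingleton Set.subsingleton_singleton)
    | succ n ih =>
      obtain ⟨α, h0, hα⟩ := ih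
      set c := min b (a + n * δ) with hc
      set d := min b (a + (n + 1 : ℕ) * δ) with hd
      have hac : a ≤ c := le_min hab (by nlinarith [Nat.cast_nonneg (α := ℝ) n])
      have hcd : c ≤ d := min_le_min le_rfl (by push_cast; nlinarith)
      have hdb : d ≤ b := min_le_left _ _
      have hsub : Icc c d ⊆ Icc a b := Icc_subset_Icc hac hdb
      have hlen : d - c ≤ δ := by
        rw [hc, hd]
        push_cast
        rcases min_cases b (a + n * δ) with ⟨e1, e2⟩ | ⟨e1, e2⟩
        · rw [e1]; linarith [min_le_left b (a + (n + 1) * δ)]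
        · rw [e1]; linarith [min_le_right b (a + (n + 1) * δ)]
      obtain ⟨β, hβ0, hβ⟩ := exists_linear_ode_step hcd (hL.mono hsub) (hu.mono hsub)
        (fun t ht => hK t (hsub ht)) (fun t ht => hB t (hsub ht)) (by
          calc (1 + 2 * (K : ℝ)) * (d - c) ≤ (1 + 2 * K) * δ :=
                mul_le_mul_of_nonneg_left hlen hpos.le
            _ = 1 := by rw [hδ]; field_simp) (α c)
      refine ⟨fun s => if s ≤ c then α s else β s, by simp [hac, h0], ?_⟩
      exact hasDerivWithinAt_glue (f := fun t y => L t y + u t) hac hcd hα hβ hβ0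
  obtain ⟨n, hn⟩ := exists_nat_ge ((b - a) / δ)
  obtain ⟨α, h0, hα⟩ := step n
  have e : min b (a + n * δ) = b := min_eq_left (by
    rw [div_le_iff₀ hδ0] at hn; linarith)
  rw [e] at hα
  have hc : ContinuousOn α (Icc a b) := fun t ht => (hα t ht).continuousWithinAt
  obtain ⟨C, hC⟩ := isCompact_Icc.exists_bound_of_continuousOn ((hL.clm_apply hc).add hu)
  exact ⟨α, h0, HasAEDerivOn.of_hasDerivWithinAt hab hα hC⟩

theorem exists_bilinear_ode {E F : Type*} [NormedAddCommGroup E] [NormedSpace ℝ E]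
    [FiniteDimensional ℝ E] [NormedAddCommGroup F] [NormedSpace ℝ F] [FiniteDimensional ℝ F]
    (B : F →ₗ[ℝ] E →ₗ[ℝ] E) {c : ℝ → F} {u : ℝ → E} {a b : ℝ} (hab : a ≤ b)
    (hc : ContinuousOn c (Icc a b)) (hu : ContinuousOn u (Icc a b)) (x : E) :
    ∃ α : ℝ → E, α a = x ∧ HasAEDerivOn α (fun t => B (c t) (α t) + u t) a b := by
  have : CompleteSpace E := FiniteDimensional.complete ℝ E
  let Φ : F →ₗ[ℝ] (E →L[ℝ] E) := LinearMap.toContinuousLinearMap.toLinearMap ∘ₗ B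
  have hΦ : Continuous Φ := LinearMap.continuous_of_finiteDimensional Φ
  exact exists_linear_ode (L := fun t => Φ (c t)) hab (hΦ.comp_continuousOn hc) hu x

end LinearODE

/-! ### Attitude kinematics -/

/-- Two solutions driven by the same skew generator have constant relative rotation `X Yᵀ`. With `Y
= X` this is preservation of orthogonality; with equal initial values it is uniqueness. -/
theorem HasAEDerivOn.mul_transpose_eq {X Y S : ℝ → Mat3} {a b : ℝ}
    (hX : HasAEDerivOn X (fun r => X r * S r) a b) (hY : HasAEDerivOn Y (fun r => Y r * S r) a b)
    (hS : ∀ r ∈ uIcc a b, (S r)ᵀ = -S r) : ∀ r ∈ uIcc a b, X r * (Y r)ᵀ = X a * (Y a)ᵀ :=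
  ((hX.matMul hY.transpose).congr_deriv (g' := fun _ => 0) fun r hr => by
    rw [transpose_mul, hS r hr, Matrix.neg_mul, Matrix.mul_neg, Matrix.mul_assoc,
      add_neg_cancel]).eq_of_zero

/-- Orthogonality leaves `det = ±1`, and the determinant is continuous with value `1` at the start.
-/
theorem HasAEDerivOn.mem_SO3 {X S : ℝ → Mat3} {a b : ℝ} (hab : a ≤ b)
    (hX : HasAEDerivOn X (fun r => X r * S r) a b)
    (hS : ∀ r ∈ uIcc a b, (S r)ᵀ = -S r) (h0 : X a ∈ SO3) : ∀ r ∈ Icc a b, X r ∈ SO3 := by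
  have h1 : ∀ r ∈ Icc a b, X r * (X r)ᵀ = 1 := fun r hr => by
    rw [hX.mul_transpose_eq hX hS r (by rwa [uIcc_of_le hab]), h0.1]
  have hsq : ∀ r ∈ Icc a b, (X r).det = 1 ∨ (X r).det = -1 := fun r hr => by
    have := congrArg Matrix.det (h1 r hr)
    rw [det_mul, det_transpose, det_one] at this
    exact mul_self_eq_one_iff.1 this
  have hc : ContinuousOn (fun r => (X r).det) (Icc a b) := by
    have := hX.ac.continuousOn
    rw [uIcc_of_le hab] at this
    exact Continuous.comp_continuousOn (continuous_id.matrix_det) this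
  intro r hr
  refine ⟨h1 r hr, mul_eq_one_comm.1 (h1 r hr), ?_⟩
  rcases hsq r hr with e | e
  · exact e
  · exfalso
    have hsub : Icc a r ⊆ Icc a b := Icc_subset_Icc_right hr.2
    obtain ⟨q, hq, hq0⟩ := intermediate_value_Icc' hr.1 (hc.mono hsub)
      (show (0 : ℝ) ∈ Icc ((X r).det) ((X a).det) by rw [e, h0.2.2]; constructor <;> norm_num)
    have hq0' : (X q).det = 0 := hq0
    rcases hsq q (hsub hq) with e' | e' <;> rw [hq0'] at e' <;> norm_num at e'

theorem SO3.mul_skew {R : Mat3} (hR : R ∈ SO3) (w : Vec3) :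
    R * skew (Rᵀ *ᵥ w) = skew w * R := by
  have := congrArg Matrix.transpose (SO3.skew_transpose_mulVec hR w)
  simpa [transpose_mul, transpose_skew] using this

theorem eq_of_mul_transpose_eq_one {X Y : Mat3} (hY : Y ∈ SO3) (h : X * Yᵀ = 1) : X = Y := by
  calc X = X * (Yᵀ * Y) := by rw [hY.2.1, Matrix.mul_one]
    _ = Y := by rw [← Matrix.mul_assoc, h, Matrix.one_mul]

namespace Setup
variable {N : ℕ} {D : Setup N}

/-! ### Uniqueness of flows -/

theorem rotEst_eq {z : State} (hz : z.1 ∈ SO3) : z.2.2.2.1 = (attErr z)ᵀ * z.1 := by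
  rw [attErr, transpose_mul, transpose_transpose, Matrix.mul_assoc, hz.2.1, Matrix.mul_one]

theorem posEst_eq {z : State} (hE : attErr z ∈ SO3) :
    z.2.2.2.2.2.1 = (attErr z)ᵀ *ᵥ (z.2.1 - D.pc - D.posErr z) + D.pc := by
  have : z.2.1 - D.pc - D.posErr z = attErr z *ᵥ (z.2.2.2.2.2.1 - D.pc) := by
    rw [posErr, Matrix.sub_mulVec, Matrix.one_mulVec, Matrix.mulVec_sub]; abel
  rw [this, Matrix.mulVec_mulVec, hE.2.1, Matrix.one_mulVec, sub_add_cancel]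

theorem velEst_eq {z : State} (hE : attErr z ∈ SO3) :
    z.2.2.2.2.2.2.1 = (attErr z)ᵀ *ᵥ (z.2.2.1 - velErr z) := by
  rw [velErr, sub_sub_cancel, Matrix.mulVec_mulVec, hE.2.1, Matrix.one_mulVec]

theorem gravEst_eq {z : State} (hE : attErr z ∈ SO3) :
    z.2.2.2.2.2.2.2.1 = (attErr z)ᵀ *ᵥ (D.g - D.gravErr z) := by
  rw [gravErr, sub_sub_cancel, Matrix.mulVec_mulVec, hE.2.1, Matrix.one_mulVec]

/-- No Gronwall argument is needed: `R` and `R̃` have constant relative rotations, the translational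
errors are explicit polynomials, and the quadratic data of `P` have equal derivatives. The estimates
are then recovered from the body state and the errors. -/
theorem FlowsOn.unique {z z' : ℝ → State} {s t : ℝ} (h : D.FlowsOn z s t) (h' : D.FlowsOn z' s t)
    (h0 : z s = z' s) : z t = z' t := by
  have ht : t ∈ Icc s t := ⟨h.le, le_rfl⟩
  have hs : s ∈ Icc s t := ⟨le_rfl, h.le⟩
  have hu : uIcc s t = Icc s t := uIcc_of_le h.le
  have hR : ∀ r ∈ Icc s t, (z r).1 = (z' r).1 := fun r hr => by
    refine eq_of_mul_transpose_eq_one (h'.rot r hr) ?_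
    rw [h.rot_deriv.mul_transpose_eq h'.rot_deriv (fun r _ => transpose_skew _) r (by rwa [hu]), h0]
    exact (h'.rot s hs).1
  have hη : (z t).2.2.2.2.1 = (z' t).2.2.2.2.1 := by rw [h.eta_eq t ht, h'.eta_eq t ht, h0]
  have hE : attErr (z t) = attErr (z' t) := by
    refine eq_of_mul_transpose_eq_one (h'.attErr_mem ht) ?_
    have e : HasAEDerivOn (fun r => attErr (z r))
        (fun r => attErr (z r) * (-skew (z s).2.2.2.2.1)) s t :=
      h.attErr_deriv.congr_deriv fun r hr => by
        rw [hu] at hr; rw [h.eta_eq r hr, Matrix.mul_neg]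
    have e' : HasAEDerivOn (fun r => attErr (z' r))
        (fun r => attErr (z' r) * (-skew (z s).2.2.2.2.1)) s t :=
      h'.attErr_deriv.congr_deriv fun r hr => by
        rw [hu] at hr; rw [h'.eta_eq r hr, Matrix.mul_neg, h0]
    rw [e.mul_transpose_eq e' (fun r _ => by rw [transpose_neg, transpose_skew]) t (by simp), h0]
    exact (h'.attErr_mem hs).1
  have hg : D.gravErr (z t) = D.gravErr (z' t) := by
    rw [h.gravErr_eq t ht, h'.gravErr_eq t ht, h0]
  have hv : velErr (z t) = velErr (z' t) := by
    rw [h.velErr_eq t ht, h'.velErr_eq t ht, h0]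
  have hp : D.posErr (z t) = D.posErr (z' t) := by
    rw [h.posErr_eq t ht, h'.posErr_eq t ht, h0]
  have dv : ∀ {z : ℝ → State}, D.FlowsOn z s t → HasAEDerivOn (fun r => (z r).2.2.1)
      (fun r => D.g + (z r).1 *ᵥ D.a r) s t := fun h => h.deriv.snd.snd.fst
  have dp : ∀ {z : ℝ → State}, D.FlowsOn z s t → HasAEDerivOn (fun r => (z r).2.1)
      (fun r => (z r).2.2.1) s t := fun h => h.deriv.snd.fst
  have hvel : ∀ r ∈ Icc s t, (z r).2.2.1 = (z' r).2.2.1 := fun r hr => by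
    have := ((dv h).sub (dv h')).congr_deriv (g' := fun _ => 0) (fun r hr => by
      rw [hu] at hr; rw [hR r hr, sub_self]) |>.eq_of_zero r (by rwa [hu])
    simp only [h0, sub_self] at this
    exact sub_eq_zero.1 this
  have hpos : (z t).2.1 = (z' t).2.1 := by
    have := ((dp h).sub (dp h')).congr_deriv (g' := fun _ => 0) (fun r hr => by
      rw [hu] at hr; rw [hvel r hr, sub_self]) |>.eq_of_zero t (by simp)
    simp only [h0, sub_self] at this
    exact sub_eq_zero.1 this
  have hτ : (z t).2.2.2.2.2.2.2.2.2 = (z' t).2.2.2.2.2.2.2.2.2 := by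
    rw [h.timer_eq t ht, h'.timer_eq t ht, h0]
  have hP : cov (z t) = cov (z' t) := by
    refine cov_ext (h.rot t ht) fun a b c a' b' c' => ?_
    have hd := ((h.cov_deriv t a b c a' b' c').sub (h'.cov_deriv t a b c a' b' c')).congr_deriv
      (g' := fun _ => 0) fun r hr => by rw [hu] at hr; rw [hR r hr, sub_self]
    have h2 := hd.eq_of_zero t (by simp)
    simp only [costate_self, h0, sub_self] at h2
    have h3 := sub_eq_zero.1 h2
    rw [hR t ht]
    rw [hR t ht] at h3
    exact h3
  have hRt := hR t ht
  have hvt := hvel t ht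
  have hRh : (z t).2.2.2.1 = (z' t).2.2.2.1 := by
    rw [rotEst_eq (h.rot t ht), rotEst_eq (h'.rot t ht), hE, hRt]
  have hph : (z t).2.2.2.2.2.1 = (z' t).2.2.2.2.2.1 := by
    rw [posEst_eq (D := D) (h.attErr_mem ht), posEst_eq (D := D) (h'.attErr_mem ht), hE, hpos, hp]
  have hvh : (z t).2.2.2.2.2.2.1 = (z' t).2.2.2.2.2.2.1 := by
    rw [velEst_eq (h.attErr_mem ht), velEst_eq (h'.attErr_mem ht), hE, hvt, hv]
  have hgh : (z t).2.2.2.2.2.2.2.1 = (z' t).2.2.2.2.2.2.2.1 := by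
    rw [gravEst_eq (D := D) (h.attErr_mem ht), gravEst_eq (D := D) (h'.attErr_mem ht), hE, hg]
  exact Prod.ext hRt (Prod.ext hpos (Prod.ext hvt (Prod.ext hRh (Prod.ext hη (Prod.ext hph
    (Prod.ext hvh (Prod.ext hgh (Prod.ext hP hτ))))))))

end Setup

/-! ### Existence of flows -/

theorem exists_primitive {n : Type*} [Fintype n] {f : ℝ → n → ℝ} {a b : ℝ}
    (hf : ∀ i, IntervalIntegrable (fun t => f t i) volume a b) (x : n → ℝ) :
    ∃ F : ℝ → n → ℝ, F a = x ∧ HasAEDerivOn F f a b := by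
  refine ⟨fun t i => x i + ∫ s in a..t, f s i, by simp, HasAEDerivOn.pi fun i => ?_⟩
  have h : HasAEDerivOn (fun t => ∫ s in a..t, f s i) (fun t => f t i) a b :=
    ⟨(hf i).absolutelyContinuousOnInterval_intervalIntegral (by simp), by
      filter_upwards [(hf i).ae_hasDerivAt_integral] with t ht hm using ht hm a (by simp)⟩
  exact ((HasAEDerivOn.const (x i)).add h).congr_deriv fun t _ => by simp

theorem continuous_skew : Continuous skew := by
  refine continuous_matrix fun i j => ?_
  fin_cases i <;> fin_cases j <;> simp [skew] <;> fun_prop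

theorem exists_rotation {w : ℝ → Vec3} {a b : ℝ} (hab : a ≤ b) (hw : ContinuousOn w (Icc a b))
    {X : Mat3} (hX : X ∈ SO3) : ∃ R : ℝ → Mat3, R a = X ∧
      HasAEDerivOn R (fun t => R t * skew (w t)) a b ∧ ∀ t ∈ Icc a b, R t ∈ SO3 := by
  obtain ⟨R, h0, hR⟩ := exists_bilinear_ode
    (LinearMap.mk₂ ℝ (fun S X : Mat3 => X * S) (fun _ _ _ => Matrix.mul_add _ _ _)
      (fun _ _ _ => Matrix.mul_smul _ _ _) (fun _ _ _ => Matrix.add_mul _ _ _)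
      (fun _ _ _ => Matrix.smul_mul _ _ _)) hab (continuous_skew.comp_continuousOn hw)
      (continuousOn_const (c := (0 : Mat3))) X
  have hR' : HasAEDerivOn R (fun t => R t * skew (w t)) a b :=
    hR.congr_deriv fun t _ => by simp
  exact ⟨R, h0, hR', hR'.mem_SO3 hab (fun r _ => transpose_skew _) (h0 ▸ hX)⟩

namespace Setup
variable {N : ℕ} {D : Setup N}

theorem continuousOn_A {s : Set ℝ} (hω : ContinuousOn D.ω s) : ContinuousOn D.A s := by
  have h : Continuous (fun w : Vec3 => (fromBlocks (-skew w) (fromCols (1 : Mat3) (0 : Mat3)) 0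
      (fromBlocks (-skew w) (1 : Mat3) (0 : Mat3) (-skew w)) : Mat9)) := by
    have hs := continuous_skew.neg
    exact hs.matrix_fromBlocks continuous_const continuous_const
      (hs.matrix_fromBlocks continuous_const continuous_const hs)
  exact h.comp_continuousOn hω

/-- Only `R`, `R̃` and `P` require a differential equation, and these are linear. Velocity and
position are successive primitives, as `a` is merely locally integrable; the translational errors
are written down explicitly, and the observer states are defined by inverting the error formulas. -/
theorem exists_flow (ha : LocallyIntegrableOn D.a (Ici 0)) (hω : ContinuousOn D.ω (Ici 0))
    (hV : ContinuousOn D.V (Ici 0)) {s t : ℝ} (hs : 0 ≤ s) (hst : s ≤ t) {z₀ : State}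
    (hR₀ : z₀.1 ∈ SO3) (hRh₀ : z₀.2.2.2.1 ∈ SO3) :
    ∃ z : ℝ → State, z s = z₀ ∧ D.FlowsOn z s t := by
  have hsub : Icc s t ⊆ Ici 0 := fun r hr => hs.trans hr.1
  have hu : uIcc s t = Icc s t := uIcc_of_le hst
  have hE₀ : attErr z₀ ∈ SO3 := SO3.mul_transpose_mem hR₀ hRh₀
  set η := z₀.2.2.2.2.1 with hη
  obtain ⟨R, hRs, hR, hRmem⟩ := exists_rotation hst (hω.mono hsub) hR₀
  obtain ⟨E, hEs, hE, hEmem⟩ := exists_rotation (w := fun _ => -η) hst continuousOn_const hE₀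
  obtain ⟨P, hPs, hP⟩ := exists_bilinear_ode
    (LinearMap.mk₂ ℝ (fun A X : Mat9 => A * X + X * Aᵀ)
      (fun A A' X => by rw [transpose_add, Matrix.add_mul, Matrix.mul_add]; abel)
      (fun c A X => by rw [transpose_smul, Matrix.smul_mul, Matrix.mul_smul, smul_add])
      (fun A X X' => by rw [Matrix.mul_add, Matrix.add_mul]; abel)
      (fun c A X => by rw [Matrix.mul_smul, Matrix.smul_mul, smul_add]))
    hst (continuousOn_A (hω.mono hsub)) (hV.mono hsub) (cov z₀)
  have hint : ∀ i, IntervalIntegrable (fun r => (D.g + R r *ᵥ D.a r) i) volume s t := fun i => by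
    have haI : IntegrableOn D.a (Icc s t) := ha.integrableOn_compact_subset hsub isCompact_Icc
    have hai : ∀ j, IntervalIntegrable (fun r => D.a r j) volume s t := fun j => by
      rw [intervalIntegrable_iff_integrableOn_Icc_of_le hst]
      exact (ContinuousLinearMap.proj (R := ℝ) (φ := fun _ : Fin 3 => ℝ) j).integrable_comp haI
    have hRc : ∀ j, ContinuousOn (fun r => R r i j) (uIcc s t) := fun j =>
      (hR.entry i j).ac.continuousOn
    have h0 := (hai 0).continuousOn_mul (hRc 0)
    have h1 := (hai 1).continuousOn_mul (hRc 1)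
    have h2 := (hai 2).continuousOn_mul (hRc 2)
    have h3 : IntervalIntegrable (fun _ : ℝ => D.g i) volume s t := intervalIntegrable_const
    have := h3.add ((h0.add h1).add h2)
    refine this.congr ?_
    intro r _
    simp [Matrix.mulVec, dotProduct, Fin.sum_univ_three]
  obtain ⟨v, hvs, hv⟩ := exists_primitive hint z₀.2.2.1
  obtain ⟨p, hps, hp⟩ := exists_primitive (f := v) (a := s) (b := t) (fun i =>
    (hv.coord i).ac.continuousOn.intervalIntegrable) z₀.2.1
  have hτ : HasAEDerivOn (fun r => z₀.2.2.2.2.2.2.2.2.2 - (r - s)) (fun _ => -1) s t :=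
    ((HasAEDerivOn.const _).sub (HasAEDerivOn.id_sub s s t)).congr_deriv fun r _ => by simp
  set vt : ℝ → Vec3 := fun r => velErr z₀ + (r - s) • D.gravErr z₀ with hvt
  set pt : ℝ → Vec3 := fun r => D.posErr z₀ + (r - s) • velErr z₀ +
    ((r - s) ^ 2 / 2) • D.gravErr z₀ with hpt
  have hvt' : HasAEDerivOn vt (fun _ => D.gravErr z₀) s t :=
    ((HasAEDerivOn.const _).add ((HasAEDerivOn.id_sub s s t).smul
      (HasAEDerivOn.const _))).congr_deriv fun r _ => by simp
  have hpt' : HasAEDerivOn pt vt s t :=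
    (((HasAEDerivOn.const _).add ((HasAEDerivOn.id_sub s s t).smul (HasAEDerivOn.const _))).add
      ((HasAEDerivOn.id_sub_sq s s t).smul (HasAEDerivOn.const _))).congr_deriv
      fun r _ => by simp [hvt]
  have hEt : HasAEDerivOn (fun r => (E r)ᵀ) (fun r => skew η * (E r)ᵀ) s t :=
    hE.transpose.congr_deriv fun r _ => by
      have : skew (-η) = -skew η := by
        ext i j; fin_cases i <;> fin_cases j <;> simp [skew]
      rw [transpose_mul, transpose_skew, this, neg_neg]
  have hRh := hEt.matMul hR
  have hph := (hEt.mulVec ((hp.sub (HasAEDerivOn.const D.pc)).sub hpt')).add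
    (HasAEDerivOn.const D.pc)
  have hvh := hEt.mulVec (hv.sub hvt')
  have hgh := hEt.mulVec (HasAEDerivOn.const (a := s) (b := t) (D.g - D.gravErr z₀))
  refine ⟨fun r => (R r, p r, v r, (E r)ᵀ * R r, η, (E r)ᵀ *ᵥ (p r - D.pc - pt r) + D.pc,
    (E r)ᵀ *ᵥ (v r - vt r), (E r)ᵀ *ᵥ (D.g - D.gravErr z₀), P r,
    z₀.2.2.2.2.2.2.2.2.2 - (r - s)), ?_, hst, ?_, hRmem, fun r hr => ?_⟩
  · have e1 : pt s = D.posErr z₀ := by simp [hpt]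
    have e2 : vt s = velErr z₀ := by simp [hvt]
    simp only [hRs, hps, hvs, hEs, hPs, e1, e2, sub_self, sub_zero]
    rw [← rotEst_eq hR₀, ← posEst_eq hE₀, ← velEst_eq hE₀, ← gravEst_eq hE₀]
  · refine (hR.prodMk (hp.prodMk (hv.prodMk (hRh.prodMk ((HasAEDerivOn.const η).prodMk
      (hph.prodMk (hvh.prodMk (hgh.prodMk (hP.prodMk hτ))))))))).congr_deriv fun r hr => ?_
    rw [hu] at hr
    have hRh' : (E r)ᵀ * R r ∈ SO3 := by
      have := SO3.mul_transpose_mem (SO3.transpose_mem (hEmem r hr)) (SO3.transpose_mem (hRmem r hr))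
      rwa [transpose_transpose] at this
    refine Prod.ext rfl (Prod.ext rfl (Prod.ext rfl (Prod.ext ?_ (Prod.ext rfl (Prod.ext ?_
      (Prod.ext ?_ (Prod.ext ?_ (Prod.ext rfl rfl))))))))
    · change skew η * (E r)ᵀ * R r + (E r)ᵀ * (R r * skew (D.ω r)) =
        (E r)ᵀ * R r * skew (D.ω r + ((E r)ᵀ * R r)ᵀ *ᵥ η)
      rw [skew_add, Matrix.mul_add, SO3.mul_skew hRh', Matrix.mul_assoc, Matrix.mul_assoc, add_comm]
    · change _ = skew η *ᵥ ((E r)ᵀ *ᵥ (p r - D.pc - pt r) + D.pc - D.pc) + (E r)ᵀ *ᵥ (v r - vt r)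
      simp [Matrix.mulVec_mulVec]
    · change (skew η * (E r)ᵀ) *ᵥ (v r - vt r) + (E r)ᵀ *ᵥ (D.g + R r *ᵥ D.a r - D.gravErr z₀) =
        skew η *ᵥ ((E r)ᵀ *ᵥ (v r - vt r)) + (E r)ᵀ *ᵥ (D.g - D.gravErr z₀) +
        ((E r)ᵀ * R r) *ᵥ D.a r
      rw [← Matrix.mulVec_mulVec, ← Matrix.mulVec_mulVec, add_assoc, ← Matrix.mulVec_add]
      congr 2
      abel
    · change _ = skew η *ᵥ ((E r)ᵀ *ᵥ (D.g - D.gravErr z₀))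
      simp [Matrix.mulVec_mulVec]
  · have := SO3.mul_transpose_mem (SO3.transpose_mem (hEmem r hr)) (SO3.transpose_mem (hRmem r hr))
    rwa [transpose_transpose] at this

end Setup

/-! ### Hybrid time domains -/

theorem le_of_forall_le_succ {s : ℕ → ℝ} {J : ℕ} (hs : ∀ j < J, s j ≤ s (j + 1)) {i k : ℕ}
    (hik : i ≤ k) (hk : k ≤ J) : s i ≤ s k := by
  induction k, hik using Nat.le_induction with
  | base => exact le_rfl
  | succ k hik ih => exact (ih (by omega)).trans (hs k (by omega))

theorem isHybridTimeDomain_of_compact {J : ℕ} (hJ : 0 < J) {s : ℕ → ℝ} (h0 : s 0 = 0)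
    (hs : ∀ j < J, s j ≤ s (j + 1)) :
    IsHybridTimeDomain {q : ℝ × ℕ | q.2 < J ∧ q.1 ∈ Icc (s q.2) (s (q.2 + 1))} := by
  refine ⟨⟨hJ, h0.le, ?_⟩, fun q hq => ?_, fun q hq => ?_⟩
  · rw [← h0]; exact hs 0 hJ
  · have := le_of_forall_le_succ hs (Nat.zero_le q.2) hq.1.le
    rw [h0] at this
    exact this.trans hq.2.1
  · obtain ⟨t, j⟩ := q
    obtain ⟨hj, ht⟩ := hq
    simp only at hj ht
    refine ⟨j + 1, fun i => if i ≤ j then s i else t, by simp [h0], fun i hi => ?_, ?_⟩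
    · rcases (Nat.lt_succ_iff.1 hi).eq_or_lt with rfl | h
      · simpa using ht.1
      · simpa [h.le, Nat.succ_le_of_lt h] using hs i (by omega)
    · ext ⟨r, i⟩
      simp only [Set.mem_inter_iff, Set.mem_ofPred_eq, Set.mem_Icc]
      constructor
      · rintro ⟨⟨h1, h2, h3⟩, h4, h5⟩
        refine ⟨by omega, by simpa [h5] using h2, ?_⟩
        split_ifs
        · exact h3
        · exact h4
      · rintro ⟨h1, h2, h3⟩
        have hij : i ≤ j := by omega
        simp only [hij, if_true] at h2
        rcases hij.eq_or_lt with rfl | h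
        · simp only [add_le_iff_nonpos_right, nonpos_iff_eq_zero, one_ne_zero, if_false] at h3
          exact ⟨⟨hj, h2, h3.trans ht.2⟩, h3, le_rfl⟩
        · simp only [Nat.succ_le_of_lt h, if_true] at h3
          exact ⟨⟨by omega, h2, h3⟩,
            h3.trans ((le_of_forall_le_succ hs (Nat.succ_le_of_lt h) hj.le).trans ht.1), hij⟩

/-- The jump times before a point of a hybrid time domain. -/
structure IsJumpSeq (E : Set (ℝ × ℕ)) (t : ℝ) (j : ℕ) (s : ℕ → ℝ) : Prop where
  zero : s 0 = 0
  le_succ : ∀ i < j, s i ≤ s (i + 1)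
  le : s j ≤ t
  mem : ∀ i < j, ∀ r ∈ Icc (s i) (s (i + 1)), (r, i) ∈ E
  mem_last : ∀ r ∈ Icc (s j) t, (r, j) ∈ E
  last_le : ∀ r, (r, j) ∈ E → s j ≤ r
  start_le : ∀ r, ∀ i < j, (r, i) ∈ E → s i ≤ r

/-- The breakpoints are those of the truncation at `(t, j)`. For a point of a level beyond time `t`,
the lower bound by `s i` still holds because `s i ≤ s j ≤ t`. -/
theorem IsHybridTimeDomain.exists_jumpSeq {E : Set (ℝ × ℕ)} (hE : IsHybridTimeDomain E) {t : ℝ}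
    {j : ℕ} (h : (t, j) ∈ E) : ∃ s, IsJumpSeq E t j s := by
  obtain ⟨J, s, h0, hs, he⟩ := hE.2.2 (t, j) h
  have hmem : ∀ r i, ((r, i) ∈ E ∧ r ≤ t ∧ i ≤ j) ↔ (i < J ∧ r ∈ Icc (s i) (s (i + 1))) :=
    fun r i => by
      have := Set.ext_iff.1 he (r, i)
      simpa using this
  obtain ⟨hjJ, htj⟩ := (hmem t j).1 ⟨h, le_rfl, le_rfl⟩
  have start : ∀ r, ∀ i ≤ j, (r, i) ∈ E → s i ≤ r := fun r i hi hr => by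
    rcases le_total r t with hrt | hrt
    · exact ((hmem r i).1 ⟨hr, hrt, hi⟩).2.1
    · exact ((le_of_forall_le_succ hs hi hjJ.le).trans htj.1).trans hrt
  refine ⟨s, h0, fun i hi => hs i (by omega), htj.1, fun i hi r hr => ?_, fun r hr => ?_,
    fun r hr => start r j le_rfl hr, fun r i hi hr => start r i hi.le hr⟩
  · exact ((hmem r i).2 ⟨by omega, hr⟩).1
  · exact ((hmem r j).2 ⟨hjJ, hr.1, hr.2.trans htj.2⟩).1

theorem IsHybridTimeDomain.segment_mem {E : Set (ℝ × ℕ)} (hE : IsHybridTimeDomain E) {a b r : ℝ}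
    {j : ℕ} (ha : (a, j) ∈ E) (hb : (b, j) ∈ E) (hr : r ∈ Icc a b) : (r, j) ∈ E := by
  obtain ⟨s, hs⟩ := hE.exists_jumpSeq hb
  exact hs.mem_last r ⟨(hs.last_le a ha).trans hr.1, hr.2⟩

namespace Setup
variable {N : ℕ} {D : Setup N} {kR : ℝ} {φ : HybridArc State}

/-! ### Solutions of the closed loop -/

section Solution
variable (hφ : (D.closedLoop kR).IsSolution φ)
include hφ

theorem rot_mem {t : ℝ} {j : ℕ} (h : (t, j) ∈ φ.dom) : (φ.val t j).1 ∈ SO3 := by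
  rcases hφ.mem _ h with h1 | h1
  · exact h1.1
  · exact h1.1

theorem rotEst_mem {t : ℝ} {j : ℕ} (h : (t, j) ∈ φ.dom) : (φ.val t j).2.2.2.1 ∈ SO3 := by
  rcases hφ.mem _ h with h1 | h1
  · exact h1.2.1
  · exact h1.2.1

theorem timer_mem (hT : 0 ≤ D.TM) {t : ℝ} {j : ℕ} (h : (t, j) ∈ φ.dom) :
    (φ.val t j).2.2.2.2.2.2.2.2.2 ∈ Icc 0 D.TM := by
  rcases hφ.mem _ h with h1 | h1
  · exact h1.2.2
  · have h2 : (φ.val t j).2.2.2.2.2.2.2.2.2 = 0 := h1.2.2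
    rw [h2]; exact ⟨le_rfl, hT⟩

theorem flowsOn {a b : ℝ} {j : ℕ} (hab : a ≤ b) (ha : (a, j) ∈ φ.dom) (hb : (b, j) ∈ φ.dom) :
    D.FlowsOn (fun r => φ.val r j) a b := by
  have hseg : ∀ r ∈ Icc a b, (r, j) ∈ φ.dom := fun r hr => hφ.timeDomain.segment_mem ha hb hr
  refine ⟨hab, ⟨hφ.absCont j a b ha hb, ?_⟩, fun r hr => rot_mem hφ (hseg r hr),
    fun r hr => rotEst_mem hφ (hseg r hr)⟩
  filter_upwards [hφ.flow j] with t ht hm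
  rw [uIcc_of_le hab] at hm
  exact ht (hseg t hm)

theorem jump_mem {t : ℝ} {j : ℕ} (h : (t, j) ∈ φ.dom) (h' : (t, j + 1) ∈ φ.dom) :
    (φ.val t j).2.2.2.2.2.2.2.2.2 = 0 ∧ φ.val t (j + 1) ∈ D.jumpMap kR t (φ.val t j) := by
  have := hφ.jump t j h h'
  exact ⟨this.1.2.2, this.2⟩

/-- A level of the domain ends where the solution jumps. -/
theorem le_of_jump (hT : 0 ≤ D.TM) {r q : ℝ} {j : ℕ} (h : (r, j) ∈ φ.dom)
    (h' : (r, j + 1) ∈ φ.dom) (hq : (q, j) ∈ φ.dom) : q ≤ r := by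
  by_contra! hlt
  have h1 := (flowsOn hφ hlt.le h hq).timer_eq q ⟨hlt.le, le_rfl⟩
  have h2 := (timer_mem hφ hT hq).1
  simp only [(jump_mem hφ h h').1] at h1
  linarith

end Solution

/-- The extension of a solution by a flow on the last level and a final jump. -/
noncomputable def extendArc (φ : HybridArc State) (J : ℕ) (s : ℕ → ℝ) (t₁ : ℝ) (z : ℝ → State) (z' : State) :
    HybridArc State where
  dom := {q | q.2 < J + 2 ∧ q.1 ∈ Icc (if q.2 ≤ J then s q.2 else t₁)
    (if q.2 + 1 ≤ J then s (q.2 + 1) else t₁)}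
  val r i := if i < J then φ.val r i else if i = J then z r else z'

theorem isSolution_extendArc (hT : 0 < D.Tm ∧ D.Tm ≤ D.TM) (hφ : (D.closedLoop kR).IsSolution φ)
    {J : ℕ} {s : ℕ → ℝ} {t t₁ : ℝ} (hs : IsJumpSeq φ.dom t J s) {z : ℝ → State} {z' : State}
    (hz : D.FlowsOn z (s J) t₁) (hz0 : z (s J) = φ.val (s J) J)
    (hτ : (z (s J)).2.2.2.2.2.2.2.2.2 = t₁ - s J) (hτM : t₁ - s J ≤ D.TM)
    (hz' : z' ∈ D.jumpMap kR t₁ (z t₁)) :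
    (D.closedLoop kR).IsSolution (extendArc φ J s t₁ z z') := by
  have hle := hz.le
  have hzflow : ∀ r ∈ Icc (s J) t₁, z r ∈ D.flowSet := fun r hr => by
    refine ⟨hz.rot r hr, hz.rotEst r hr, ?_⟩
    change (z r).2.2.2.2.2.2.2.2.2 ∈ _
    rw [hz.timer_eq r hr, hτ]
    constructor <;> linarith [hr.1, hr.2]
  have ht₁ : t₁ ∈ Icc (s J) t₁ := ⟨hle, le_rfl⟩
  have hz'flow : z' ∈ D.flowSet := by
    refine ⟨?_, ?_, ?_⟩
    · rw [jump_rot hz']; exact hz.rot t₁ ht₁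
    · rw [jump_rotEst hz']; exact hz.rotEst t₁ ht₁
    · have := jump_timer hz'
      exact ⟨hT.1.le.trans this.1, this.2⟩
  have dlt : ∀ {r : ℝ} {i : ℕ}, i < J → ((r, i) ∈ (extendArc φ J s t₁ z z').dom ↔ r ∈ Icc (s i) (s (i + 1))) :=
    fun {r i} hi => by
      simp [extendArc, hi, hi.le, (by omega : i < J + 2)]
  have deq : ∀ {r : ℝ}, (r, J) ∈ (extendArc φ J s t₁ z z').dom ↔ r ∈ Icc (s J) t₁ := fun {r} => by
    simp [extendArc]
  have dsucc : ∀ {r : ℝ}, (r, J + 1) ∈ (extendArc φ J s t₁ z z').dom ↔ r = t₁ := fun {r} => by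
    have e : (r, J + 1) ∈ (extendArc φ J s t₁ z z').dom ↔ t₁ ≤ r ∧ r ≤ t₁ := by simp [extendArc]
    rw [e]
    exact ⟨fun h => le_antisymm h.2 h.1, fun h => ⟨h.ge, h.le⟩⟩
  have dle : ∀ {r : ℝ} {i : ℕ}, (r, i) ∈ (extendArc φ J s t₁ z z').dom → i < J ∨ i = J ∨ i = J + 1 :=
    fun {r i} h => by have := h.1; simp only at this; omega
  have vlt : ∀ {i : ℕ}, i < J → ∀ r, (extendArc φ J s t₁ z z').val r i = φ.val r i := fun hi r => by
    simp [extendArc, hi]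
  have veq : ∀ r, (extendArc φ J s t₁ z z').val r J = z r := fun r => by simp [extendArc]
  have vsucc : ∀ r, (extendArc φ J s t₁ z z').val r (J + 1) = z' := fun r => by simp [extendArc]
  have toφ : ∀ {r : ℝ} {i : ℕ}, i < J → (r, i) ∈ (extendArc φ J s t₁ z z').dom → (r, i) ∈ φ.dom :=
    fun hi h => hs.mem _ hi _ ((dlt hi).1 h)
  refine ⟨?_, ?_, ?_, ?_, ?_, ?_⟩
  · have := isHybridTimeDomain_of_compact (J := J + 2) (by omega)
      (s := fun i => if i ≤ J then s i else t₁) (by simp [hs.zero]) (fun j hj => ?_)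
    · exact this
    · rcases lt_trichotomy j J with h | rfl | h
      · simpa [h.le, Nat.succ_le_of_lt h] using hs.le_succ j h
      · simpa using hle
      · simp [not_le.2 h, not_le.2 (by omega : J < j + 1)]
  · rintro ⟨r, i⟩ h
    rcases dle h with hi | rfl | rfl
    · simp only [vlt hi]; exact hφ.mem _ (toφ hi h)
    · simp only [veq]; exact Or.inl (hzflow r (deq.1 h))
    · simp only [vsucc]; exact Or.inl hz'flow
  · intro i r hr
    have hr' : r ∈ {q : ℝ | (q, i) ∈ (extendArc φ J s t₁ z z').dom} := interior_subset hr
    rcases dle hr' with hi | rfl | rfl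
    · rw [vlt hi]
      exact hφ.mem_flow i r (interior_mono (show {q : ℝ | (q, i) ∈ (extendArc φ J s t₁ z z').dom} ⊆
        {q : ℝ | (q, i) ∈ φ.dom} from fun q hq => toφ hi hq) hr)
    · rw [veq]; exact hzflow r (deq.1 hr')
    · rw [vsucc]; exact hz'flow
  · intro i a b ha hb
    rcases dle ha with hi | rfl | rfl
    · simp only [vlt hi]
      exact hφ.absCont i a b (toφ hi ha) (toφ hi hb)
    · simp only [veq]
      refine hz.deriv.ac.mono ?_
      rw [uIcc_of_le hle]
      exact uIcc_subset_Icc (deq.1 ha) (deq.1 hb)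
    · simp only [vsucc]
      exact ac_const z'
  · intro i
    rcases lt_trichotomy i J with hi | rfl | hi
    · filter_upwards [hφ.flow i] with r hr hm
      simp only [vlt hi]
      exact hr (toφ hi hm)
    · filter_upwards [hz.deriv.deriv] with r hr hm
      simp only [veq]
      rw [uIcc_of_le hle] at hr
      exact hr (deq.1 hm)
    -- Level `J + 1` is the single time `t₁`, a null set, so the differential equation is void
    -- there.
    · have hne : ∀ᵐ r : ℝ, r ≠ t₁ := by
        have := (Set.Finite.measure_zero (s := ({t₁} : Set ℝ)) (by simp) volume)
        rw [measure_eq_zero_iff_ae_notMem] at this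
        simpa using this
      filter_upwards [hne] with r hr hm
      rcases dle hm with h | rfl | rfl
      · omega
      · omega
      · exact absurd (dsucc.1 hm) hr
  · intro r i h h'
    rcases dle h' with hi | hi | hi
    · rw [vlt (by omega), vlt hi]
      exact hφ.jump r i (toφ (by omega) h) (toφ hi h')
    · subst hi
      have h1 := (dlt (by omega : i < i + 1)).1 h
      have h2 := deq.1 h'
      have e : r = s (i + 1) := le_antisymm h1.2 h2.1
      subst e
      rw [vlt (by omega), veq, hz0]
      exact hφ.jump _ i (toφ (by omega) h) (hs.mem_last _ ⟨le_rfl, hs.le⟩)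
    · obtain rfl : i = J := by omega
      have e := dsucc.1 h'
      subst e
      rw [veq, vsucc]
      refine ⟨⟨hz.rot r ht₁, hz.rotEst r ht₁, ?_⟩, hz'⟩
      change (z r).2.2.2.2.2.2.2.2.2 = 0
      rw [hz.timer_eq r ht₁, hτ, sub_self]

/-- If `t + j` is bounded, there is a last level `J`. The flow from its start until the timer
vanishes, followed by a jump, agrees with `φ` on level `J` by uniqueness, hence extends `φ` to a
domain with a level `J + 1`. This also covers a last level that is half-open. -/
theorem isComplete_of_isMaximalSolution (hT : 0 < D.Tm ∧ D.Tm ≤ D.TM)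
    (ha : LocallyIntegrableOn D.a (Ici 0)) (hω : ContinuousOn D.ω (Ici 0))
    (hV : ContinuousOn D.V (Ici 0)) (hφ : (D.closedLoop kR).IsMaximalSolution φ) :
    φ.IsComplete := by
  obtain ⟨hsol, hmax⟩ := hφ
  have hTM : 0 ≤ D.TM := hT.1.le.trans hT.2
  by_contra hc
  unfold HybridArc.IsComplete at hc
  push Not at hc
  obtain ⟨b, hb⟩ := hc
  have hlev : ∃ J : ℕ, (∃ t, (t, J) ∈ φ.dom) ∧ ∀ q ∈ φ.dom, q.2 ≤ J := by
    have hbdd : ∀ j : ℕ, (∃ t, (t, j) ∈ φ.dom) → j ≤ ⌈b⌉₊ := fun j ⟨t, ht⟩ => by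
      have h1 := hb _ ht
      have h2 := hsol.timeDomain.2.1 _ ht
      simp only at h1 h2
      exact_mod_cast (by linarith [Nat.le_ceil b] : (j : ℝ) ≤ ⌈b⌉₊)
    classical
    refine ⟨Nat.findGreatest (fun j => ∃ t, (t, j) ∈ φ.dom) ⌈b⌉₊,
      Nat.findGreatest_spec (P := fun j => ∃ t, (t, j) ∈ φ.dom) (Nat.zero_le _)
        ⟨0, hsol.timeDomain.1⟩, fun q hq => ?_⟩
    exact Nat.le_findGreatest (hbdd q.2 ⟨q.1, hq⟩) ⟨q.1, hq⟩
  obtain ⟨J, ⟨t, ht⟩, hJ⟩ := hlev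
  obtain ⟨s, hs⟩ := hsol.timeDomain.exists_jumpSeq ht
  have hs0 : (s J, J) ∈ φ.dom := hs.mem_last _ ⟨le_rfl, hs.le⟩
  have hτ := timer_mem hsol hTM hs0
  set τ₀ := (φ.val (s J) J).2.2.2.2.2.2.2.2.2 with hτ₀
  have hle : s J ≤ s J + τ₀ := by linarith [hτ.1]
  obtain ⟨z, hz0, hz⟩ := exists_flow (D := D) ha hω hV (hsol.timeDomain.2.1 _ hs0) hle
    (rot_mem hsol hs0) (rotEst_mem hsol hs0)
  obtain ⟨z', hz'⟩ : ∃ z', z' ∈ D.jumpMap kR (s J + τ₀) (z (s J + τ₀)) :=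
    ⟨_, D.Tm, ⟨le_rfl, hT.2⟩, rfl⟩
  have hext := isSolution_extendArc hT hsol hs hz hz0 (by rw [hz0]; ring)
    (by rw [add_sub_cancel_left]; exact hτ.2) hz'
  have hlast : ∀ r, (r, J) ∈ φ.dom → r ∈ Icc (s J) (s J + τ₀) ∧ z r = φ.val r J := fun r hr => by
    have h1 := hs.last_le r hr
    have hf := flowsOn hsol h1 hs0 hr
    have h2 := hf.timer_eq r ⟨h1, le_rfl⟩
    have h3 := (timer_mem hsol hTM hr).1
    simp only [← hτ₀] at h2
    have hmem : r ∈ Icc (s J) (s J + τ₀) := ⟨h1, by linarith⟩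
    exact ⟨hmem, (hz.restrict hmem).unique hf hz0⟩
  have hdom := hmax _ hext (fun q hq => ?_) (fun q hq => ?_)
  · have hin : (s J + τ₀, J + 1) ∈ (extendArc φ J s (s J + τ₀) z z').dom := by simp [extendArc]
    rw [hdom] at hin
    have := hJ _ hin
    simp at this
  · obtain ⟨r, i⟩ := q
    rcases (hJ _ hq).eq_or_lt with e | hi
    · simp only at e
      subst e
      have := (hlast r hq).1
      simpa [extendArc] using this
    · simp only at hi
      have h1 : (s (i + 1), i) ∈ φ.dom := hs.mem i hi _ ⟨hs.le_succ i hi, le_rfl⟩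
      have h2 : (s (i + 1), i + 1) ∈ φ.dom := by
        rcases (Nat.succ_le_of_lt hi).eq_or_lt with e | e
        · have e' : i + 1 = J := e
          rw [e']; exact hs0
        · exact hs.mem (i + 1) e _ ⟨le_rfl, hs.le_succ _ e⟩
      have h3 := le_of_jump hsol hTM h1 h2 hq
      have h4 := hs.start_le r i hi hq
      simp [extendArc, hi, hi.le, h3, h4, (by omega : i < J + 2)]
  · obtain ⟨r, i⟩ := q
    rcases (hJ _ hq).eq_or_lt with e | hi
    · simp only at e
      subst e
      simpa [extendArc] using (hlast r hq).2
    · simp only at hi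
      simp [extendArc, hi]

end Setup

/-! ### Bounds of the error covariance and contraction of the translational errors -/

theorem add_dot_self_le {ι : Type*} [Fintype ι] (x y : ι → ℝ) :
    (x + y) ⬝ᵥ (x + y) ≤ 2 * (x ⬝ᵥ x) + 2 * (y ⬝ᵥ y) := by
  have h := dotProduct_self_nonneg' (x - y)
  simp only [dotProduct_add, add_dotProduct, dotProduct_sub, sub_dotProduct] at h ⊢
  linarith [dotProduct_comm x y]

theorem smul_dot_self {ι : Type*} [Fintype ι] (r : ℝ) (x : ι → ℝ) :
    (r • x) ⬝ᵥ (r • x) = r ^ 2 * (x ⬝ᵥ x) := by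
  simp only [dotProduct_smul, smul_dotProduct, smul_eq_mul]; ring

theorem neg_dot_self {ι : Type*} [Fintype ι] (x : ι → ℝ) : (-x) ⬝ᵥ (-x) = x ⬝ᵥ x := by simp

namespace Setup
variable {N : ℕ} {D : Setup N}

/-- Quadratic bounds of the matrix functions `V` and `Q`. -/
structure NoiseBounds (D : Setup N) (vl vu qu : ℝ) : Prop where
  vl_pos : 0 < vl
  vu_nonneg : 0 ≤ vu
  qu_nonneg : 0 ≤ qu
  V_symm : ∀ t ≥ 0, (D.V t)ᵀ = D.V t
  V_ge : ∀ t ≥ 0, ∀ x, vl * (x ⬝ᵥ x) ≤ x ⬝ᵥ D.V t *ᵥ x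
  V_le : ∀ t ≥ 0, ∀ x, x ⬝ᵥ D.V t *ᵥ x ≤ vu * (x ⬝ᵥ x)
  Q_posDef : ∀ t ≥ 0, (D.Q t).PosDef
  Q_le : ∀ t ≥ 0, ∀ x, x ⬝ᵥ D.Q t *ᵥ x ≤ qu * (x ⬝ᵥ x)

theorem exists_quadForm_le {n : Type*} [Fintype n] {S : ℝ → Matrix n n ℝ} (h : BoundedMat S) :
    ∃ β ≥ 0, ∀ t ≥ 0, ∀ x, x ⬝ᵥ S t *ᵥ x ≤ β * (x ⬝ᵥ x) := by
  obtain ⟨b, hb⟩ := h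
  refine ⟨|b| * Fintype.card n, by positivity, fun t ht x => ?_⟩
  exact abs_quadForm_le (fun i j => (hb t ht i j).trans (le_abs_self b)) x

theorem posDef_of_sub_smul {n : Type*} [Fintype n] [DecidableEq n] {H : Matrix n n ℝ} {c : ℝ}
    (hc : 0 < c) (h : (H - c • (1 : Matrix n n ℝ)).PosSemidef) : H.PosDef := by
  have h1 : (c • (1 : Matrix n n ℝ)).PosDef := PosDef.one.smul hc
  have := PosDef.posSemidef_add h h1
  rwa [sub_add_cancel] at this

theorem exists_noiseBounds (hVb : BoundedMat D.V) (hVpos : UniformlyPosDef D.V)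
    (hQb : BoundedMat D.Q) (hQpos : UniformlyPosDef D.Q) :
    ∃ vl vu qu, D.NoiseBounds vl vu qu := by
  obtain ⟨vl, hvl, hV⟩ := hVpos
  obtain ⟨ql, hql, hQ⟩ := hQpos
  obtain ⟨vu, hvu, hVu⟩ := exists_quadForm_le hVb
  obtain ⟨qu, hqu, hQu⟩ := exists_quadForm_le hQb
  refine ⟨vl, vu, qu, hvl, hvu, hqu, fun t ht => ?_, fun t ht x => ?_, hVu, fun t ht => ?_, hQu⟩
  · exact PosDef.transpose_eq (posDef_of_sub_smul hvl (hV t ht))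
  · have := quadForm_nonneg (hV t ht) x
    rw [quadForm_sub_smul] at this
    linarith
  · exact posDef_of_sub_smul hql (hQ t ht)

/-- The Riccati matrix of a state is symmetric and positive semidefinite. -/
def CovPSD (z : State) : Prop := (cov z)ᵀ = cov z ∧ ∀ x, 0 ≤ x ⬝ᵥ cov z *ᵥ x

/-- `w` is a bound of the squared translational error, measured by the inverse of the Riccati
matrix. -/
def ErrLe (D : Setup N) (z : State) (w : ℝ) : Prop :=
  ∀ a b c, D.pairing z a b c ^ 2 ≤ w * covForm z a b c

/-- The growth of the covariance by process noise over one interval. -/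
def noiseGrowth (D : Setup N) (vu : ℝ) : ℝ := vu * transBound D.TM * D.TM

theorem noiseGrowth_nonneg {vu : ℝ} (hvu : 0 ≤ vu) (hT : 0 ≤ D.TM) : 0 ≤ D.noiseGrowth vu :=
  mul_nonneg (mul_nonneg hvu (transBound_pos _).le) hT

section Flow
variable {vl vu qu s t : ℝ} {z : ℝ → State} (hN : D.NoiseBounds vl vu qu)
  (hz : D.FlowsOn z s t) (hs : 0 ≤ s) (hT : t - s ≤ D.TM)
include hN hz hs hT

theorem flow_covForm_le (a b c : Vec3) :
    covForm (z t) a b c ≤ covForm (z s) a (b + (t - s) • a)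
      (c + (t - s) • b + ((t - s) ^ 2 / 2) • a) + D.noiseGrowth vu * sqn a b c :=
  hz.covForm_flow_le hT hN.vu_nonneg (fun r hr => hN.V_le r (hs.trans hr.1)) a b c

theorem flow_covForm_ge (a b c : Vec3) :
    covForm (z s) a (b + (t - s) • a) (c + (t - s) • b + ((t - s) ^ 2 / 2) • a) +
      vl / transBound D.TM * (t - s) *
        sqn a (b + (t - s) • a) (c + (t - s) • b + ((t - s) ^ 2 / 2) • a) ≤ covForm (z t) a b c :=
  hz.covForm_flow_ge hT hN.vl_pos.le (fun r hr => hN.V_ge r (hs.trans hr.1)) a b c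

theorem flow_covForm_mono (a b c : Vec3) :
    covForm (z s) a (b + (t - s) • a) (c + (t - s) • b + ((t - s) ^ 2 / 2) • a) ≤
      covForm (z t) a b c := by
  refine le_trans (le_add_of_nonneg_right ?_) (flow_covForm_ge hN hz hs hT a b c)
  exact mul_nonneg (mul_nonneg (div_nonneg hN.vl_pos.le (transBound_pos _).le)
    (sub_nonneg.2 hz.le)) (sqn_nonneg _ _ _)

theorem flow_covForm_le_mul {B : ℝ} (hB0 : 0 ≤ B) (hB : ∀ a b c, covForm (z s) a b c ≤ B * sqn a b c)
    (a b c : Vec3) :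
    covForm (z t) a b c ≤ (transBound D.TM * B + D.noiseGrowth vu) * sqn a b c := by
  have h1 := flow_covForm_le hN hz hs hT a b c
  have h2 := hB a (b + (t - s) • a) (c + (t - s) • b + ((t - s) ^ 2 / 2) • a)
  have h3 := mul_le_mul_of_nonneg_left (sqn_shift_le (h := t - s) (T := D.TM)
    (by rw [abs_of_nonneg (sub_nonneg.2 hz.le)]; exact hT) a b c) hB0
  nlinarith

theorem CovPSD.flow (h : CovPSD (z s)) : CovPSD (z t) := by
  refine ⟨hz.cov_symm (fun r hr => hN.V_symm r (hs.trans hr.1)) h.1, ?_⟩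
  refine quadForm_nonneg_of_covForm (hz.rot t ⟨hz.le, le_rfl⟩) fun a b c => ?_
  exact (covForm_nonneg h.2 _ _ _).trans (flow_covForm_mono hN hz hs hT a b c)

theorem ErrLe.flow {w : ℝ} (hw : 0 ≤ w) (h : D.ErrLe (z s) w) : D.ErrLe (z t) w := fun a b c => by
  rw [hz.pairing_flow]
  exact (h _ _ _).trans (mul_le_mul_of_nonneg_left (flow_covForm_mono hN hz hs hT a b c) hw)

/-- Let `X` and `S` be the covariance form and the squared norm of the costate at the start. The
noise adds at least a multiple of `S ≥ X / B`, so the form grows by a factor while the pairing stays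
constant. -/
theorem ErrLe.flow_contract {w B : ℝ} (hw : 0 ≤ w) (hB0 : 0 < B) (hTm : D.Tm ≤ t - s)
    (hTm0 : 0 < D.Tm)
    (hB : ∀ a b c, covForm (z s) a b c ≤ B * sqn a b c) (h : D.ErrLe (z s) w) :
    D.ErrLe (z t) (w / (1 + vl * D.Tm / (transBound D.TM * B))) := fun a b c => by
  rw [hz.pairing_flow]
  refine (h _ _ _).trans ?_
  have hK := transBound_pos D.TM
  have hvl := hN.vl_pos
  have h1 := flow_covForm_ge hN hz hs hT a b c
  have h2 := hB a (b + (t - s) • a) (c + (t - s) • b + ((t - s) ^ 2 / 2) • a)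
  have h3 := sqn_nonneg a (b + (t - s) • a) (c + (t - s) • b + ((t - s) ^ 2 / 2) • a)
  set X := covForm (z s) a (b + (t - s) • a) (c + (t - s) • b + ((t - s) ^ 2 / 2) • a)
  set S := sqn a (b + (t - s) • a) (c + (t - s) • b + ((t - s) ^ 2 / 2) • a)
  have hδ : 0 ≤ vl * D.Tm / (transBound D.TM * B) := by positivity
  rw [div_mul_eq_mul_div, le_div_iff₀ (by linarith), mul_assoc]
  refine mul_le_mul_of_nonneg_left ?_ hw
  have h4 : X * (vl * D.Tm / (transBound D.TM * B)) ≤ vl / transBound D.TM * D.Tm * S := by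
    refine (mul_le_mul_of_nonneg_right h2 hδ).trans (le_of_eq ?_)
    field_simp
  have h5 : vl / transBound D.TM * D.Tm * S ≤ vl / transBound D.TM * (t - s) * S :=
    mul_le_mul_of_nonneg_right (mul_le_mul_of_nonneg_left hTm (div_nonneg hvl.le hK.le)) h3
  linarith

end Flow

section Jump
variable {vl vu qu t kR : ℝ} {z z' : State} (hN : D.NoiseBounds vl vu qu) (ht : 0 ≤ t)
  (hP : CovPSD z) (h : z' ∈ D.jumpMap kR t z)
include hN ht hP h

theorem CovPSD.jump : CovPSD z' := by
  have hQ := hN.Q_posDef t ht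
  refine ⟨?_, cov_nonneg_jump hP.1 hP.2 hQ h⟩
  rw [jump_cov h]
  exact transpose_riccati hP.1 (PosDef.transpose_eq hQ)

theorem ErrLe.jump (hk1 : ∑ i, D.k i = 1) (hz : z.1 ∈ SO3) (hz' : z.2.2.2.1 ∈ SO3) {w : ℝ}
    (hw : 0 ≤ w) (he : D.ErrLe z w) : D.ErrLe z' w := fun a b c => by
  obtain ⟨m, h1, h2⟩ := exists_pairing_jump hP.1 hP.2 (hN.Q_posDef t ht) hk1 hz hz' h a b c
  rw [h1]
  exact (he _ _ _).trans (mul_le_mul_of_nonneg_left h2 hw)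

end Jump

/-- A flow on `[s, t]` of length at most `TM`, followed by a jump to `z'`. -/
structure IsCycle (D : Setup N) (kR : ℝ) (z : ℝ → State) (s t : ℝ) (z' : State) : Prop where
  flow : D.FlowsOn z s t
  nonneg : 0 ≤ s
  length_le : t - s ≤ D.TM
  jump : z' ∈ D.jumpMap kR t (z t)

/-! ### One flow followed by one measurement -/

section Cycle
variable {vl vu qu kR : ℝ} (hN : D.NoiseBounds vl vu qu)
include hN

section
variable {z : ℝ → State} {s t : ℝ} {z' : State} (hz : D.IsCycle kR z s t z') (hP : CovPSD (z s))
include hz hP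

theorem CovPSD.cycle : CovPSD z' :=
  (hP.flow hN hz.flow hz.nonneg hz.length_le).jump hN (hz.nonneg.trans hz.flow.le) hz.jump

/-- Here `α` is the position part of the costate just before the jump; it is free, and `(α, B, G)`
is its transport to the start of the interval. Choosing `α` amounts to choosing a gain. -/
theorem cycle_covForm_le {a b c α : Vec3} {B G : Vec3} (hB : b + (t - s) • α = B)
    (hG : c + (t - s) • b + ((t - s) ^ 2 / 2) • α = G) :
    covForm z' a b c ≤ covForm (z s) α B G + D.noiseGrowth vu * sqn α b c +
      qu * ((a - α) ⬝ᵥ (a - α)) := by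
  have ht := hz.nonneg.trans hz.flow.le
  have hPt := hP.flow hN hz.flow hz.nonneg hz.length_le
  have h1 := covForm_jump_le hPt.1 hPt.2 (hN.Q_posDef t ht)
    (hz.flow.rot t ⟨hz.flow.le, le_rfl⟩) hz.jump (hN.Q_le t ht) a b c (a - α)
  have h2 := flow_covForm_le hN hz.flow hz.nonneg hz.length_le α b c
  rw [sub_sub_cancel] at h1
  rw [hB, hG] at h2
  linarith

theorem cycle_covForm_le_mul {B : ℝ} (hB0 : 0 ≤ B)
    (hB : ∀ a b c, covForm (z s) a b c ≤ B * sqn a b c) (a b c : Vec3) :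
    covForm z' a b c ≤ (transBound D.TM * B + D.noiseGrowth vu) * sqn a b c := by
  have ht := hz.nonneg.trans hz.flow.le
  have hPt := hP.flow hN hz.flow hz.nonneg hz.length_le
  have h1 := covForm_jump_le hPt.1 hPt.2 (hN.Q_posDef t ht)
    (hz.flow.rot t ⟨hz.flow.le, le_rfl⟩) hz.jump (hN.Q_le t ht) a b c 0
  have h2 := flow_covForm_le_mul hN hz.flow hz.nonneg hz.length_le hB0 hB a b c
  simp only [sub_zero, dotProduct_zero, mul_zero, add_zero] at h1
  exact h1.trans h2

theorem ErrLe.cycle (hk1 : ∑ i, D.k i = 1) {w : ℝ} (hw : 0 ≤ w) (he : D.ErrLe (z s) w) :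
    D.ErrLe z' w := by
  have ht := hz.nonneg.trans hz.flow.le
  have hts : t ∈ Icc s t := ⟨hz.flow.le, le_rfl⟩
  exact (he.flow hN hz.flow hz.nonneg hz.length_le hw).jump hN ht
    (hP.flow hN hz.flow hz.nonneg hz.length_le) hz.jump hk1 (hz.flow.rot t hts)
    (hz.flow.rotEst t hts) hw

theorem ErrLe.cycle_contract (hk1 : ∑ i, D.k i = 1) {w B : ℝ} (hw : 0 ≤ w) (hB0 : 0 < B)
    (hTm : D.Tm ≤ t - s) (hTm0 : 0 < D.Tm)
    (hB : ∀ a b c, covForm (z s) a b c ≤ B * sqn a b c) (he : D.ErrLe (z s) w) :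
    D.ErrLe z' (w / (1 + vl * D.Tm / (transBound D.TM * B))) := by
  have ht := hz.nonneg.trans hz.flow.le
  have hts : t ∈ Icc s t := ⟨hz.flow.le, le_rfl⟩
  have hvl := hN.vl_pos
  have hK := transBound_pos D.TM
  exact (he.flow_contract hN hz.flow hz.nonneg hz.length_le hw hB0 hTm hTm0 hB).jump hN ht
    (hP.flow hN hz.flow hz.nonneg hz.length_le) hz.jump hk1 (hz.flow.rot t hts)
    (hz.flow.rotEst t hts) (by positivity)

end

/-- Three consecutive measurements bound the covariance, whatever it was before. -/
theorem exists_cycle_covForm_bound (hT : 0 < D.Tm ∧ D.Tm ≤ D.TM) :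
    ∃ B ≥ 0, ∀ (kR : ℝ) (z₁ z₂ z₃ : ℝ → State) (s₁ s₂ s₃ s₄ : ℝ) (z₄ : State),
      D.IsCycle kR z₁ s₁ s₂ (z₂ s₂) → D.IsCycle kR z₂ s₂ s₃ (z₃ s₃) → D.IsCycle kR z₃ s₃ s₄ z₄ →
      D.Tm ≤ s₃ - s₂ → D.Tm ≤ s₄ - s₃ → CovPSD (z₁ s₁) →
      ∀ a b c, covForm z₄ a b c ≤ B * sqn a b c := by
  obtain ⟨hTm, hTM⟩ := hT
  have hTM0 : 0 < D.TM := hTm.trans_le hTM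
  have hqu := hN.qu_nonneg
  have hG := noiseGrowth_nonneg (D := D) hN.vu_nonneg hTM0.le
  set G := D.noiseGrowth vu
  -- `K` is the constant of the bound after the second measurement; `A` bounds `|α|²` by the squared
  -- norm of the costate for the `α` used at the third one.
  obtain ⟨K, hK⟩ : ∃ K, K = 3 * qu / D.Tm ^ 2 + G * (1 / D.Tm ^ 2 + 1 + D.TM ^ 2 / 4) + 2 * qu :=
    ⟨_, rfl⟩
  obtain ⟨A, hA⟩ : ∃ A, A = (8 + 18 * D.TM ^ 2) / (4 * D.Tm ^ 4) := ⟨_, rfl⟩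
  have hK0 : 0 ≤ K := by rw [hK]; positivity
  have hA0 : 0 ≤ A := by rw [hA]; positivity
  refine ⟨K * (A * (1 + 2 * D.TM ^ 2) + 2) + G * (A + 1) + 2 * qu * (1 + A), by positivity, ?_⟩
  intro kR z₁ z₂ z₃ s₁ s₂ s₃ s₄ z₄ h₁ h₂ h₃ hl₂ hl₃ hP₁ a b c
  have hP₂ := hP₁.cycle hN h₁
  have hP₃ := hP₂.cycle hN h₂
  -- With `α = 0` the prediction is discarded and position is read off the measurement. No lower
  -- bound on the length of this first interval is needed.
  have e₁ : ∀ a, covForm (z₂ s₂) a 0 0 ≤ qu * (a ⬝ᵥ a) := fun a => by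
    have := cycle_covForm_le hN h₁ hP₁ (a := a) (b := 0) (c := 0) (α := 0) (B := 0) (G := 0)
      (by simp) (by simp)
    have h0 : covForm (z₁ s₁) 0 0 0 = 0 := by
      have : stack (z₁ s₁).1 0 0 0 = 0 := by
        ext i; rcases i with i | i | i <;> simp [stack]
      rw [covForm, this, zero_dotProduct]
    simpa [h0, sqn] using this
  set h := s₃ - s₂ with hh
  set k := s₄ - s₃ with hk
  have hlu₂ : h ≤ D.TM := h₂.length_le
  have hlu₃ : k ≤ D.TM := h₃.length_le
  have hh0 : 0 < h := hTm.trans_le hl₂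
  have hk0 : 0 < k := hTm.trans_le hl₃
  -- For this two-parameter family of costates, `α = -b/h` makes the velocity and gravity parts
  -- vanish at the previous measurement, where `e₁` applies: velocity from a difference quotient.
  have e₂ : ∀ a b, covForm (z₃ s₃) a b (-(h / 2) • b) ≤ K * (a ⬝ᵥ a + b ⬝ᵥ b) := fun a b => by
    have := cycle_covForm_le hN h₂ hP₂ (a := a) (b := b) (c := -(h / 2) • b) (α := -(1 / h) • b)
      (B := 0) (G := 0)
      (by rw [← hh, smul_smul, mul_neg, mul_one_div_cancel hh0.ne']; module)
      (by
        rw [← hh, smul_smul, ← add_smul, ← add_smul]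
        have : -(h / 2) + h + h ^ 2 / 2 * -(1 / h) = 0 := by field_simp; ring
        rw [this, zero_smul])
    refine this.trans ?_
    have h1 := e₁ (-(1 / h) • b)
    have h2 := add_dot_self_le a ((1 / h) • b)
    have h3 : a - -(1 / h) • b = a + (1 / h) • b := by module
    have hi : (1 / h) ^ 2 ≤ 1 / D.Tm ^ 2 := by
      rw [div_pow, one_pow]
      exact one_div_le_one_div_of_le (by positivity) (pow_le_pow_left₀ hTm.le hl₂ 2)
    have hsq : h ^ 2 ≤ D.TM ^ 2 := pow_le_pow_left₀ hh0.le hlu₂ 2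
    have hb := dotProduct_self_nonneg' b
    have ha := dotProduct_self_nonneg' a
    rw [h3]
    simp only [sqn, smul_dot_self, neg_sq] at h1 h2 ⊢
    have i1 : (1 / h) ^ 2 * (b ⬝ᵥ b) ≤ 1 / D.Tm ^ 2 * (b ⬝ᵥ b) := mul_le_mul_of_nonneg_right hi hb
    have i2 : (h / 2) ^ 2 * (b ⬝ᵥ b) ≤ D.TM ^ 2 / 4 * (b ⬝ᵥ b) :=
      mul_le_mul_of_nonneg_right (by nlinarith) hb
    have i3 := mul_le_mul_of_nonneg_left i1 hqu
    have i4 : G * ((1 / h) ^ 2 * (b ⬝ᵥ b) + b ⬝ᵥ b + (h / 2) ^ 2 * (b ⬝ᵥ b)) ≤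
        G * (1 / D.Tm ^ 2 * (b ⬝ᵥ b) + b ⬝ᵥ b + D.TM ^ 2 / 4 * (b ⬝ᵥ b)) :=
      mul_le_mul_of_nonneg_left (by linarith) hG
    have i5 := mul_le_mul_of_nonneg_left h2 hqu
    have i6 : 0 ≤ (3 * qu / D.Tm ^ 2 + G * (1 / D.Tm ^ 2 + 1 + D.TM ^ 2 / 4)) * (a ⬝ᵥ a) := by
      positivity
    have i7 : 0 ≤ 2 * qu * (b ⬝ᵥ b) := by positivity
    have i8 : 3 * qu / D.Tm ^ 2 = 3 * (qu * (1 / D.Tm ^ 2)) := by ring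
    rw [i8] at i6
    rw [hK, i8]
    linarith
  -- This `α` solves `c + k b + (k²/2) α = -(h/2)(b + k α)`, which places the transported costate in
  -- the family of `e₂`: gravity from a second difference quotient.
  obtain ⟨α, hα⟩ : ∃ α : Vec3, α = -(1 / (k * (k + h))) • ((2 : ℝ) • c + (2 * k + h) • b) :=
    ⟨_, rfl⟩
  have hkk : k * (k + h) * (1 / (k * (k + h))) = 1 := mul_one_div_cancel (by positivity)
  have := cycle_covForm_le hN h₃ hP₃ (a := a) (b := b) (c := c) (α := α) (B := b + k • α)
    (G := -(h / 2) • (b + k • α)) rfl (by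
      rw [← hk]
      have e : c + k • b + (k ^ 2 / 2) • α - -(h / 2) • (b + k • α) =
          c + (k + h / 2) • b + (k * (k + h) / 2) • α := by module
      rw [← sub_eq_zero, e, hα, smul_smul]
      have : k * (k + h) / 2 * -(1 / (k * (k + h))) = -(1 / 2) := by linarith
      rw [this]
      module)
  refine this.trans ?_
  have ha := dotProduct_self_nonneg' a
  have hb := dotProduct_self_nonneg' b
  have hc := dotProduct_self_nonneg' c
  have hα0 := dotProduct_self_nonneg' α
  have hS := sqn_nonneg a b c
  have hαle : α ⬝ᵥ α ≤ A * sqn a b c := by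
    have h1 := add_dot_self_le ((2 : ℝ) • c) ((2 * k + h) • b)
    rw [smul_dot_self, smul_dot_self] at h1
    have h2 : (2 * k + h) ^ 2 * (b ⬝ᵥ b) ≤ 9 * D.TM ^ 2 * (b ⬝ᵥ b) :=
      mul_le_mul_of_nonneg_right (by nlinarith) hb
    have h3 : (1 / (k * (k + h))) ^ 2 ≤ 1 / (4 * D.Tm ^ 4) := by
      rw [div_pow, one_pow]
      refine one_div_le_one_div_of_le (by positivity) ?_
      have : 2 * D.Tm ^ 2 ≤ k * (k + h) := by nlinarith
      calc 4 * D.Tm ^ 4 = (2 * D.Tm ^ 2) ^ 2 := by ring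
        _ ≤ _ := pow_le_pow_left₀ (by positivity) this 2
    rw [hα, smul_dot_self, neg_sq, hA, div_eq_mul_one_div (8 + 18 * D.TM ^ 2)]
    have h4 : ((2 : ℝ) • c + (2 * k + h) • b) ⬝ᵥ ((2 : ℝ) • c + (2 * k + h) • b) ≤
        (8 + 18 * D.TM ^ 2) * sqn a b c := by
      have : 0 ≤ (8 + 18 * D.TM ^ 2) * (a ⬝ᵥ a) := by positivity
      have : 0 ≤ 18 * D.TM ^ 2 * (c ⬝ᵥ c) := by positivity
      simp only [sqn]
      linarith
    calc (1 / (k * (k + h))) ^ 2 * (((2 : ℝ) • c + (2 * k + h) • b) ⬝ᵥ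
          ((2 : ℝ) • c + (2 * k + h) • b)) ≤
        1 / (4 * D.Tm ^ 4) * ((8 + 18 * D.TM ^ 2) * sqn a b c) :=
          mul_le_mul h3 h4 (dotProduct_self_nonneg' _) (by positivity)
      _ = _ := by ring
  have hbα : (b + k • α) ⬝ᵥ (b + k • α) ≤ 2 * (b ⬝ᵥ b) + 2 * (D.TM ^ 2 * (α ⬝ᵥ α)) := by
    have h1 := add_dot_self_le b (k • α)
    rw [smul_dot_self] at h1
    have : k ^ 2 * (α ⬝ᵥ α) ≤ D.TM ^ 2 * (α ⬝ᵥ α) :=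
      mul_le_mul_of_nonneg_right (pow_le_pow_left₀ hk0.le hlu₃ 2) hα0
    linarith
  have haα : (a - α) ⬝ᵥ (a - α) ≤ 2 * (a ⬝ᵥ a) + 2 * (α ⬝ᵥ α) := by
    have h1 := add_dot_self_le a (-α)
    rwa [neg_dot_self, ← sub_eq_add_neg] at h1
  have haS : a ⬝ᵥ a ≤ sqn a b c := by simp only [sqn]; linarith
  have hbS : b ⬝ᵥ b ≤ sqn a b c := by simp only [sqn]; linarith
  have j1 : K * (α ⬝ᵥ α + (b + k • α) ⬝ᵥ (b + k • α)) ≤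
      K * ((A * (1 + 2 * D.TM ^ 2) + 2) * sqn a b c) := by
    refine mul_le_mul_of_nonneg_left ?_ hK0
    have : D.TM ^ 2 * (α ⬝ᵥ α) ≤ D.TM ^ 2 * (A * sqn a b c) :=
      mul_le_mul_of_nonneg_left hαle (by positivity)
    linarith
  have j2 : G * sqn α b c ≤ G * ((A + 1) * sqn a b c) := by
    refine mul_le_mul_of_nonneg_left ?_ hG
    simp only [sqn] at hαle ⊢
    linarith
  have j3 : qu * ((a - α) ⬝ᵥ (a - α)) ≤ qu * (2 * (1 + A) * sqn a b c) :=
    mul_le_mul_of_nonneg_left (by linarith) hqu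
  have j4 := e₂ α (b + k • α)
  linarith

end Cycle

/-- Cauchy–Schwarz; this initializes `ErrLe` from the positive definite `P(0)`, the only place where
a lower bound of the covariance enters. -/
theorem errLe_of_le_cov {z : State} (hz : z.1 ∈ SO3) {l : ℝ} (hl : 0 < l)
    (h : ∀ x, l * (x ⬝ᵥ x) ≤ x ⬝ᵥ cov z *ᵥ x) : D.ErrLe z (enorm2 (D.err z).2.2.1 ^ 2 / l) :=
    fun a b c => by
  rw [enorm2_sq, err_eq, pairing_eq D hz]
  have h1 := dotProduct_sq_le (stack z.1 a b c) (stack z.1 (D.posErr z) (velErr z) (D.gravErr z))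
  have h2 := h (stack z.1 a b c)
  refine h1.trans ?_
  rw [div_mul_eq_mul_div, le_div_iff₀ hl]
  have := mul_le_mul_of_nonneg_left h2 (dotProduct_self_nonneg'
    (stack z.1 (D.posErr z) (velErr z) (D.gravErr z)))
  simp only [covForm]
  linarith

/-- Test the inequality with the error itself: `|x|⁴ ≤ w B |x|²`. -/
theorem ErrLe.enorm2_sq_le {z : State} (hz : z.1 ∈ SO3) {w B : ℝ} (hw : 0 ≤ w) (hB0 : 0 ≤ B)
    (h : D.ErrLe z w) (hB : ∀ a b c, covForm z a b c ≤ B * sqn a b c) :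
    enorm2 (D.err z).2.2.1 ^ 2 ≤ w * B := by
  have h1 := h (D.posErr z) (velErr z) (D.gravErr z)
  have h2 := mul_le_mul_of_nonneg_left (hB (D.posErr z) (velErr z) (D.gravErr z)) hw
  have h3 : sqn (D.posErr z) (velErr z) (D.gravErr z) = enorm2 (D.err z).2.2.1 ^ 2 := by
    rw [enorm2_sq, err_eq, stack_dotProduct hz]; rfl
  have h4 : D.pairing z (D.posErr z) (velErr z) (D.gravErr z) = enorm2 (D.err z).2.2.1 ^ 2 := by
    rw [← h3]; rfl
  rw [h3] at h2
  rw [h4] at h1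
  rcases (sq_nonneg (enorm2 (D.err z).2.2.1)).eq_or_lt with h0 | h0
  · rw [← h0]; positivity
  · exact le_of_mul_le_mul_right (by nlinarith) h0

end Setup

/-! ### The attitude error along flows -/

theorem sig_sub (M A B : Mat3) : sig M (A - B) = sig M A - sig M B := by
  ext i
  fin_cases i <;> simp [sig, Matrix.mul_sub] <;> ring

theorem attDist_le_add {R S : Mat3} (hR : R ∈ SO3) (hS : S ∈ SO3) {d : ℝ} (hd : 0 ≤ d)
    (h : frobSq (R - S) ≤ 2 * d ^ 2) : attDist R ≤ attDist S + d / 2 := by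
  have h1 := sqrt_frobSq_add_le (R - S) (S - 1)
  rw [sub_add_sub_cancel, sqrt_frobSq_sub_one hR, sqrt_frobSq_sub_one hS] at h1
  have h2 : Real.sqrt (frobSq (R - S)) ≤ Real.sqrt 8 * (d / 2) := by
    refine Real.sqrt_le_iff.2 ⟨by positivity, h.trans (le_of_eq ?_)⟩
    rw [mul_pow, Real.sq_sqrt (by norm_num)]
    ring
  have h8 : 0 < Real.sqrt 8 := by positivity
  nlinarith

namespace Setup
namespace FlowsOn
variable {N : ℕ} {D : Setup N} {z : ℝ → State} {s t : ℝ}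

/-- The curve `R̃` has Frobenius speed `√2 |η|`. The mean value inequality comes from pairing the
curve with its own total increment, a fixed matrix. -/
theorem frobSq_attErr_sub_le (h : D.FlowsOn z s t) :
    frobSq (attErr (z t) - attErr (z s)) ≤ 2 * ((t - s) * enorm2 (z s).2.2.2.2.1) ^ 2 := by
  set E := attErr (z t) - attErr (z s) with hE
  set n := enorm2 (z s).2.2.2.2.1 with hn
  have hn0 : 0 ≤ n := enorm2_nonneg _
  have h1 := ((HasAEDerivOn.const (a := s) (b := t) Eᵀ).matMul h.attErr_deriv).trace.sub_le_sub h.le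
    ((HasAEDerivOn.id_sub s s t).smul
      (HasAEDerivOn.const (Real.sqrt (frobSq E) * (Real.sqrt 2 * n)))) (fun r hr => by
        have h2 := trace_transpose_mul_sq_le E (-(attErr (z r) * skew (z r).2.2.2.2.1))
        have h3 : frobSq (-(attErr (z r) * skew (z r).2.2.2.2.1)) = 2 * n ^ 2 := by
          rw [hn, enorm2_sq, ← h.eta_eq r hr, ← frobSq_mul_skew (h.attErr_mem hr)]
          simp [frobSq]
        rw [h3] at h2
        have h4 := Real.le_sqrt_of_sq_le h2
        rw [Real.sqrt_mul (frobSq_nonneg E), Real.sqrt_mul (by norm_num : (0 : ℝ) ≤ 2),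
          Real.sqrt_sq hn0] at h4
        simpa using h4)
  simp only [sub_self, smul_eq_mul] at h1
  rw [← Matrix.trace_sub, ← Matrix.mul_sub, ← hE, ← frobSq_eq_trace] at h1
  have h5 := Real.mul_self_sqrt (frobSq_nonneg E)
  set q := Real.sqrt (frobSq E)
  have hq : 0 ≤ q := Real.sqrt_nonneg _
  have h2' := Real.mul_self_sqrt (by norm_num : (0 : ℝ) ≤ 2)
  have hd : 0 ≤ (t - s) * n := mul_nonneg (sub_nonneg.2 h.le) hn0
  have h6 : q ≤ Real.sqrt 2 * ((t - s) * n) := by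
    rcases hq.eq_or_lt with h0 | h0
    · rw [← h0]; positivity
    · exact le_of_mul_le_mul_left (by linarith) h0
  calc frobSq E = q * q := h5.symm
    _ ≤ (Real.sqrt 2 * ((t - s) * n)) * (Real.sqrt 2 * ((t - s) * n)) :=
      mul_self_le_mul_self hq h6
    _ = (Real.sqrt 2 * Real.sqrt 2) * ((t - s) * n) ^ 2 := by ring
    _ = _ := by rw [h2']

theorem attDist_le (h : D.FlowsOn z s t) :
    attDist (attErr (z t)) ≤
      attDist (attErr (z s)) + (t - s) * enorm2 (z s).2.2.2.2.1 / 2 :=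
  attDist_le_add (h.attErr_mem ⟨h.le, le_rfl⟩) (h.attErr_mem ⟨le_rfl, h.le⟩)
    (mul_nonneg (sub_nonneg.2 h.le) (enorm2_nonneg _)) h.frobSq_attErr_sub_le

theorem pot_deriv (h : D.FlowsOn z s t) {M : Mat3} (hM : Mᵀ = M) :
    HasAEDerivOn (fun r => pot M (attErr (z r)))
      (fun r => -((z s).2.2.2.2.1 ⬝ᵥ sig M (attErr (z r)))) s t := by
  have h1 := (((HasAEDerivOn.const (a := s) (b := t) (1 : Mat3)).sub h.attErr_deriv).matMul
    (HasAEDerivOn.const M)).trace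
  have h2 := (HasAEDerivOn.const (a := s) (b := t) (1 / 2 : ℝ)).smul h1
  refine (h2.congr fun r _ => ?_).congr_deriv fun r hr => ?_
  · simp only [pot, smul_eq_mul]; ring
  · rw [uIcc_of_le h.le] at hr
    rw [← h.eta_eq r hr, ← trace_mul_skew hM]
    simp
    ring

/-- Along a flow with `η = k σ`, where `σ` is the innovation at the start, the potential
decreases. -/
theorem pot_le_sub (h : D.FlowsOn z s t) {M : Mat3} (hM : Mᵀ = M) {k T : ℝ} (hk : 0 ≤ k)
    (hT : t - s ≤ T) (hkT : 4 * Real.sqrt (frobSq M) * T * k ≤ 1)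
    (hη : (z s).2.2.2.2.1 = k • sig M (attErr (z s))) :
    pot M (attErr (z t)) ≤ pot M (attErr (z s)) -
      k / 2 * (t - s) * (sig M (attErr (z s)) ⬝ᵥ sig M (attErr (z s))) := by
  set σ := sig M (attErr (z s)) with hσ
  have hσ0 := dotProduct_self_nonneg' σ
  have h1 := (h.pot_deriv hM).sub_le_sub h.le ((HasAEDerivOn.id_sub s s t).smul
      (HasAEDerivOn.const (-(k / 2 * (σ ⬝ᵥ σ))))) (fun r hr => by
    set F := Real.sqrt (frobSq M) with hF
    have hF0 : 0 ≤ F := Real.sqrt_nonneg _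
    have hFF : F * F = frobSq M := Real.mul_self_sqrt (frobSq_nonneg M)
    have h2 := sig_sq_le M (attErr (z r) - attErr (z s))
    have h3 := (h.restrict hr).frobSq_attErr_sub_le
    rw [sig_sub, ← hσ] at h2
    set δ := sig M (attErr (z r)) - σ with hδ
    have hn : enorm2 (z s).2.2.2.2.1 ^ 2 = k ^ 2 * (σ ⬝ᵥ σ) := by
      rw [enorm2_sq, hη]; simp only [dotProduct_smul, smul_dotProduct, smul_eq_mul]; ring
    rw [mul_pow, hn] at h3
    have hrT : (r - s) ^ 2 ≤ T ^ 2 := pow_le_pow_left₀ (by linarith [hr.1]) (by linarith [hr.2]) 2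
    have hT0 : 0 ≤ T := (sub_nonneg.2 h.le).trans hT
    -- The change `δ` of the innovation is controlled by the motion of `R̃`, which is proportional
    -- to `k |σ|`. The smallness of `k` gives `|δ| ≤ |σ|/2`, so the potential keeps at least half of
    -- its initial rate of decrease.
    have h4 : δ ⬝ᵥ δ ≤ (2 * F * T * k) ^ 2 * (σ ⬝ᵥ σ) := by
      calc δ ⬝ᵥ δ ≤ 2 * (frobSq M * frobSq (attErr (z r) - attErr (z s))) := h2
        _ ≤ 2 * (frobSq M * (2 * (T ^ 2 * (k ^ 2 * (σ ⬝ᵥ σ))))) := by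
          have := mul_le_mul_of_nonneg_right hrT (by positivity : 0 ≤ k ^ 2 * (σ ⬝ᵥ σ))
          have h5 : frobSq (attErr (z r) - attErr (z s)) ≤ 2 * (T ^ 2 * (k ^ 2 * (σ ⬝ᵥ σ))) := by
            linarith
          have := mul_le_mul_of_nonneg_left h5 (frobSq_nonneg M)
          linarith
        _ = _ := by rw [← hFF]; ring
    have h5 : (2 * F * T * k) ^ 2 ≤ (1 / 2) ^ 2 :=
      pow_le_pow_left₀ (by positivity) (by linarith) 2
    have h6 : δ ⬝ᵥ δ ≤ (1 / 2) ^ 2 * (σ ⬝ᵥ σ) := h4.trans (mul_le_mul_of_nonneg_right h5 hσ0)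
    have h7 := dotProduct_sq_le σ δ
    have h8 : |σ ⬝ᵥ δ| ≤ 1 / 2 * (σ ⬝ᵥ σ) := by
      refine abs_le_of_sq_le_sq ?_ (by positivity)
      have := mul_le_mul_of_nonneg_left h6 hσ0
      nlinarith
    have h9 : sig M (attErr (z r)) = σ + δ := by rw [hδ]; abel
    have h10 := neg_abs_le (σ ⬝ᵥ δ)
    rw [hη, h9]
    simp only [smul_dotProduct, dotProduct_add, smul_eq_mul, mul_zero, zero_add, one_mul]
    nlinarith)
  simp only [sub_self, smul_eq_mul] at h1
  linarith

end FlowsOn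
end Setup

namespace Setup
variable {N : ℕ} {D : Setup N} {kR : ℝ} {φ : HybridArc State}

/-! ### Decay of the errors along solutions -/

theorem length_le {z : ℝ → State} {s t : ℝ} (h : D.FlowsOn z s t)
    (hs : (z s).2.2.2.2.2.2.2.2.2 ≤ D.TM) (ht : 0 ≤ (z t).2.2.2.2.2.2.2.2.2) : t - s ≤ D.TM := by
  have := h.timer_eq t ⟨h.le, le_rfl⟩
  linarith

section Chain
variable {t : ℝ} {j : ℕ} {s : ℕ → ℝ}

theorem isCycle (hT : 0 ≤ D.TM) (hφ : (D.closedLoop kR).IsSolution φ) (hs : IsJumpSeq φ.dom t j s)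
    {i : ℕ} (hi : i < j) :
    D.IsCycle kR (fun r => φ.val r i) (s i) (s (i + 1)) (φ.val (s (i + 1)) (i + 1)) := by
  have h0 := hs.mem i hi _ ⟨le_rfl, hs.le_succ i hi⟩
  have h1 := hs.mem i hi _ ⟨hs.le_succ i hi, le_rfl⟩
  have h2 : (s (i + 1), i + 1) ∈ φ.dom := by
    rcases (Nat.succ_le_of_lt hi).eq_or_lt with e | e
    · have e' : i + 1 = j := e
      rw [e']; exact hs.mem_last _ ⟨le_rfl, hs.le⟩
    · exact hs.mem (i + 1) e _ ⟨le_rfl, hs.le_succ _ e⟩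
  have hf := flowsOn hφ (hs.le_succ i hi) h0 h1
  exact ⟨hf, hφ.timeDomain.2.1 _ h0, length_le hf (timer_mem hφ hT h0).2 (timer_mem hφ hT h1).1,
    (jump_mem hφ h1 h2).2⟩

/-- Only an interval that begins with a jump is known to last at least `Tm`; the initial timer value
may be smaller. -/
theorem le_length (hT : 0 ≤ D.TM) (hφ : (D.closedLoop kR).IsSolution φ)
    (hs : IsJumpSeq φ.dom t j s) {i : ℕ} (hi : i + 1 < j) :
    D.Tm ≤ s (i + 2) - s (i + 1) := by
  have h1 := (isCycle hT hφ hs hi).flow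
  have h2 := jump_timer (isCycle hT hφ hs (by omega : i < j)).jump
  have h3 := hs.mem (i + 1) hi _ ⟨hs.le_succ _ hi, le_rfl⟩
  have h4 : (s (i + 1 + 1), i + 1 + 1) ∈ φ.dom := by
    rcases (Nat.succ_le_of_lt hi).eq_or_lt with e | e
    · have e' : i + 1 + 1 = j := e
      rw [e']; exact hs.mem_last _ ⟨le_rfl, hs.le⟩
    · exact hs.mem (i + 1 + 1) e _ ⟨le_rfl, hs.le_succ _ e⟩
  have h5 := (jump_mem hφ h3 h4).1
  have h6 := h1.timer_eq _ ⟨h1.le, le_rfl⟩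
  simp only [h5] at h6
  have := h2.1
  linarith

theorem flowsOn_last (hφ : (D.closedLoop kR).IsSolution φ) (hs : IsJumpSeq φ.dom t j s) :
    D.FlowsOn (fun r => φ.val r j) (s j) t :=
  flowsOn hφ hs.le (hs.mem_last _ ⟨le_rfl, hs.le⟩) (hs.mem_last _ ⟨hs.le, le_rfl⟩)

theorem length_last_le (hT : 0 ≤ D.TM) (hφ : (D.closedLoop kR).IsSolution φ)
    (hs : IsJumpSeq φ.dom t j s) : t - s j ≤ D.TM :=
  length_le (flowsOn_last hφ hs) (timer_mem hφ hT (hs.mem_last _ ⟨le_rfl, hs.le⟩)).2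
    (timer_mem hφ hT (hs.mem_last _ ⟨hs.le, le_rfl⟩)).1

theorem start_nonneg (hφ : (D.closedLoop kR).IsSolution φ)
    (hs : IsJumpSeq φ.dom t j s) : 0 ≤ s j :=
  hφ.timeDomain.2.1 _ (hs.mem_last _ ⟨le_rfl, hs.le⟩)

theorem time_le (hT : 0 ≤ D.TM) (hφ : (D.closedLoop kR).IsSolution φ)
    (hs : IsJumpSeq φ.dom t j s) : t ≤ (j + 1) * D.TM := by
  have h : ∀ i ≤ j, s i ≤ i * D.TM := fun i => by
    induction i with
    | zero => intro _; simp [hs.zero]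
    | succ i ih =>
      intro hi
      have h1 := ih (by omega)
      have h2 := (isCycle hT hφ hs (by omega : i < j)).length_le
      push_cast
      linarith
  have h1 := h j le_rfl
  have h2 := length_last_le hT hφ hs
  linarith

end Chain

/-! ### Uniform covariance bounds and decay of the translational errors -/

section Covariance
variable {vl vu qu : ℝ} (hN : D.NoiseBounds vl vu qu)
include hN

theorem covPSD_start (hT : 0 ≤ D.TM) (hφ : (D.closedLoop kR).IsSolution φ) {t : ℝ} {j : ℕ}
    {s : ℕ → ℝ} (hs : IsJumpSeq φ.dom t j s) (h0 : CovPSD (φ.val 0 0)) {i : ℕ} (hi : i ≤ j) :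
    CovPSD (φ.val (s i) i) := by
  induction i with
  | zero => rw [hs.zero]; exact h0
  | succ i ih => exact CovPSD.cycle hN (isCycle hT hφ hs hi) (ih (by omega))

/-- The covariance is bounded uniformly along all solutions. -/
theorem exists_covForm_bound (hT : 0 < D.Tm ∧ D.Tm ≤ D.TM) {B₀ : ℝ} (hB₀ : 0 ≤ B₀) :
    ∃ B > 0, ∀ (kR : ℝ) (φ : HybridArc State), (D.closedLoop kR).IsSolution φ →
      CovPSD (φ.val 0 0) → (∀ a b c, covForm (φ.val 0 0) a b c ≤ B₀ * sqn a b c) →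
      ∀ t j s, IsJumpSeq φ.dom t j s →
      (∀ i ≤ j, ∀ a b c, covForm (φ.val (s i) i) a b c ≤ B * sqn a b c) ∧
      ∀ a b c, covForm (φ.val t j) a b c ≤ B * sqn a b c := by
  obtain ⟨B₁, hB₁, hB⟩ := exists_cycle_covForm_bound hN hT
  have hTM : 0 ≤ D.TM := hT.1.le.trans hT.2
  have hK := one_le_transBound D.TM
  have hG := noiseGrowth_nonneg (D := D) hN.vu_nonneg hTM
  -- `f` bounds the growth over one cycle. Up to two jumps the bound comes from iterating `f` on the
  -- initial one, afterwards from three consecutive measurements; a final `f` pays for the flow on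
  -- the last level.
  obtain ⟨f, hf⟩ : ∃ f : ℝ → ℝ, f = fun B => transBound D.TM * B + D.noiseGrowth vu := ⟨_, rfl⟩
  have hfge : ∀ B, 0 ≤ B → B ≤ f B := fun B hB => by rw [hf]; nlinarith
  have hf0 := hfge B₀ hB₀
  have hf1 := hfge (f B₀) (by linarith)
  obtain ⟨B₂, hB₂⟩ : ∃ B₂, B₂ = max (f (f B₀)) B₁ := ⟨_, rfl⟩
  have hB₂0 : 0 ≤ B₂ := hB₁.trans (hB₂ ▸ le_max_right _ _)
  have hf2 := hfge B₂ hB₂0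
  refine ⟨f B₂ + 1, by linarith, fun kR φ hφ hP h0 t j s hs => ?_⟩
  have mono : ∀ {z : State} {B B' : ℝ}, B ≤ B' → (∀ a b c, covForm z a b c ≤ B * sqn a b c) →
      ∀ a b c, covForm z a b c ≤ B' * sqn a b c := fun hBB h a b c =>
    (h a b c).trans (mul_le_mul_of_nonneg_right hBB (sqn_nonneg a b c))
  have hPi : ∀ i ≤ j, CovPSD (φ.val (s i) i) := fun i hi => covPSD_start hN hTM hφ hs hP hi
  have hstart : ∀ i ≤ j, ∀ a b c, covForm (φ.val (s i) i) a b c ≤ B₂ * sqn a b c := by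
    have hff : f (f B₀) ≤ B₂ := hB₂ ▸ le_max_left _ _
    have step : ∀ i, i + 1 ≤ j → ∀ {B}, 0 ≤ B →
        (∀ a b c, covForm (φ.val (s i) i) a b c ≤ B * sqn a b c) →
        ∀ a b c, covForm (φ.val (s (i + 1)) (i + 1)) a b c ≤ f B * sqn a b c :=
      fun i hi B hB0 hB => by
        rw [hf]
        exact cycle_covForm_le_mul hN (isCycle hTM hφ hs hi) (hPi i (by omega)) hB0 hB
    have h0' : ∀ a b c, covForm (φ.val (s 0) 0) a b c ≤ B₀ * sqn a b c := by rwa [hs.zero]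
    intro i hi
    match i with
    | 0 => exact mono (by linarith) h0'
    | 1 => exact mono (by linarith) (step 0 hi hB₀ h0')
    | 2 => exact mono hff (step 1 hi (by linarith) (step 0 (by omega) hB₀ h0'))
    | i + 3 =>
      refine mono (hB₂ ▸ le_max_right _ _) ?_
      exact hB kR (fun r => φ.val r i) (fun r => φ.val r (i + 1)) (fun r => φ.val r (i + 2)) _ _ _ _ _
        (isCycle hTM hφ hs (by omega)) (isCycle hTM hφ hs (by omega))
        (isCycle hTM hφ hs (by omega)) (le_length hTM hφ hs (by omega))
        (le_length hTM hφ hs (by omega)) (hPi i (by omega))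
  refine ⟨fun i hi => mono (by linarith) (hstart i hi), mono (by linarith : f B₂ ≤ f B₂ + 1) ?_⟩
  rw [hf]
  exact flow_covForm_le_mul hN (flowsOn_last hφ hs) (start_nonneg hφ hs) (length_last_le hTM hφ hs)
    hB₂0 (hstart j le_rfl)

/-- Exponential decay of the translational errors, with a rate that depends neither on the
solution nor on the attitude gain. -/
theorem exists_translation_decay (hT : 0 < D.Tm ∧ D.Tm ≤ D.TM) (hk1 : ∑ i, D.k i = 1)
    (hP₀ : D.P₀.PosDef) :
    ∃ K ≥ 0, ∃ q > 0, q < 1 ∧ ∀ (kR : ℝ) (φ : HybridArc State), (D.closedLoop kR).IsSolution φ →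
      cov (φ.val 0 0) = D.P₀ → ∀ t j, (t, j) ∈ φ.dom →
      enorm2 (D.err (φ.val t j)).2.2.1 ^ 2 ≤
        K * q ^ (j - 1) * enorm2 (D.err (φ.val 0 0)).2.2.1 ^ 2 := by
  have hTM : 0 ≤ D.TM := hT.1.le.trans hT.2
  obtain ⟨hl, hlβ, hPl, hPu⟩ := spectrum_bounds hP₀
  set l := sInf (spectrum ℝ D.P₀)
  set β := sSup (spectrum ℝ D.P₀)
  have hlP : ∀ x, l * (x ⬝ᵥ x) ≤ x ⬝ᵥ D.P₀ *ᵥ x := fun x => by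
    have := quadForm_nonneg hPl x
    rw [quadForm_sub_smul] at this
    linarith
  have hβ : ∀ x, x ⬝ᵥ D.P₀ *ᵥ x ≤ β * (x ⬝ᵥ x) := fun x => by
    have := quadForm_nonneg hPu x
    rw [Matrix.sub_mulVec, Matrix.smul_mulVec, Matrix.one_mulVec, dotProduct_sub, dotProduct_smul,
      smul_eq_mul] at this
    linarith
  obtain ⟨B, hB0, hB⟩ := exists_covForm_bound hN hT (B₀ := β) (hl.le.trans hlβ)
  have hvl := hN.vl_pos
  have htb := transBound_pos D.TM
  have hTm := hT.1
  obtain ⟨δ, hδ⟩ : ∃ δ, δ = vl * D.Tm / (transBound D.TM * B) := ⟨_, rfl⟩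
  have hδ0 : 0 < δ := by rw [hδ]; positivity
  refine ⟨B / l, by positivity, 1 / (1 + δ), by positivity, ?_, ?_⟩
  · rw [div_lt_one (by linarith)]; linarith
  intro kR φ hφ hcov t j htj
  obtain ⟨s, hs⟩ := hφ.timeDomain.exists_jumpSeq htj
  have hR0 := rot_mem hφ hφ.timeDomain.1
  have hPSD : CovPSD (φ.val 0 0) := by
    rw [CovPSD, hcov]
    exact ⟨PosDef.transpose_eq hP₀, quadForm_nonneg hP₀.posSemidef⟩
  obtain ⟨hBs, hBt⟩ := hB kR φ hφ hPSD (fun a b c => by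
    have := hβ (stack (φ.val 0 0).1 a b c)
    rw [stack_dotProduct hR0] at this
    rw [covForm, hcov]
    exact this) t j s hs
  set w := enorm2 (D.err (φ.val 0 0)).2.2.1 ^ 2 / l with hw
  have hw0 : 0 ≤ w := by positivity
  have h0 : D.ErrLe (φ.val 0 0) w := errLe_of_le_cov hR0 hl (by rw [hcov]; exact hlP)
  have hq0 : 0 < 1 / (1 + δ) := by positivity
  -- The exponent `i - 1` is truncated: the first interval may be shorter than `Tm` and is not
  -- counted as contracting.
  have hstart : ∀ i ≤ j, D.ErrLe (φ.val (s i) i) (w * (1 / (1 + δ)) ^ (i - 1)) := by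
    intro i
    induction i with
    | zero => intro _; rw [hs.zero]; simpa using h0
    | succ i ih =>
      intro hi
      have h1 := ih (by omega)
      have hP := covPSD_start hN hTM hφ hs hPSD (by omega : i ≤ j)
      rcases i with _ | i
      · exact h1.cycle hN (isCycle hTM hφ hs hi) hP hk1 (by positivity)
      · have := h1.cycle_contract hN (isCycle hTM hφ hs hi) hP hk1 (by positivity) hB0
          (le_length hTM hφ hs hi) hTm (hBs (i + 1) (by omega))
        rw [← hδ] at this
        convert this using 1
        simp only [Nat.add_sub_cancel]
        rw [pow_succ]
        ring
  have hfin := (hstart j le_rfl).flow hN (flowsOn_last hφ hs) (start_nonneg hφ hs)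
    (length_last_le hTM hφ hs) (by positivity)
  have := hfin.enorm2_sq_le (rot_mem hφ htj) (by positivity) hB0.le hBt
  refine this.trans (le_of_eq ?_)
  rw [hw]
  ring

end Covariance

end Setup

/-! ### Decay of the attitude error -/

theorem attDist_sq_le_of_pot_le {M R : Mat3} (hR : R ∈ SO3) {l b : ℝ} (hl0 : 0 < l)
    (hl : (mbar M - l • (1 : Mat3)).PosSemidef) (h : pot M R ≤ b) :
    attDist R ^ 2 ≤ b / (2 * l) := by
  rw [le_div_iff₀ (by linarith)]
  have := le_pot hR hl
  linarith

/-- A gradient inequality for the attitude potential below its critical level. -/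
theorem mul_pot_le_sig_sq {M R : Mat3} (hM : Mᵀ = M) (hR : R ∈ SO3) {l L e : ℝ} (hl0 : 0 < l)
    (hL0 : 0 < L) (hl : (mbar M - l • (1 : Mat3)).PosSemidef)
    (hL : (L • (1 : Mat3) - mbar M).PosSemidef) (he0 : 0 ≤ e) (he : e < 1)
    (h : pot M R ≤ 2 * l * e ^ 2) :
    2 * l ^ 2 / L * (1 - e ^ 2) * pot M R ≤ sig M R ⬝ᵥ sig M R := by
  have h1 := attDist_sq_le_of_pot_le hR hl0 hl h
  rw [mul_div_cancel_left₀ _ (by positivity)] at h1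
  have h2 : attDist R ≤ e := abs_le_of_sq_le_sq' h1 he0 |>.2
  have h3 := le_sig_sq hM hR hl0.le hl (h2.trans_lt he)
  have h4 := pot_le hR hL
  have he2 : 0 ≤ 1 - e ^ 2 := by nlinarith
  calc 2 * l ^ 2 / L * (1 - e ^ 2) * pot M R
      ≤ 2 * l ^ 2 / L * (1 - e ^ 2) * (2 * L * attDist R ^ 2) :=
        mul_le_mul_of_nonneg_left h4 (by positivity)
    _ = 4 * l ^ 2 * attDist R ^ 2 * (1 - e ^ 2) := by field_simp; ring
    _ ≤ 4 * l ^ 2 * attDist R ^ 2 * (1 - attDist R ^ 2) :=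
        mul_le_mul_of_nonneg_left (by linarith) (by positivity)
    _ ≤ _ := h3

namespace Setup
variable {N : ℕ} {D : Setup N} {kR : ℝ} {φ : HybridArc State}

theorem ςM_pos (hk : ∀ i, 0 < D.k i)
    (hp : ∃ i₁ i₂ i₃ : Fin N, ¬ Collinear ℝ {D.p i₁, D.p i₂, D.p i₃}) : 0 < D.ςM := by
  obtain ⟨h1, h2, -, -⟩ := spectrum_bounds (D.posDef_Mbar hk hp)
  exact div_pos h1 (h1.trans_le h2)

set_option maxHeartbeats 800000 in
/-- Exponential decay of the attitude errors of the solutions that start in the basin. -/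
theorem exists_attitude_decay (hT : 0 < D.Tm ∧ D.Tm ≤ D.TM) (hk : ∀ i, 0 < D.k i)
    (hk1 : ∑ i, D.k i = 1) (hp : ∃ i₁ i₂ i₃ : Fin N, ¬ Collinear ℝ {D.p i₁, D.p i₂, D.p i₃})
    {ε : ℝ} (hε : 0 < ε) (hε1 : ε < 1) :
    ∃ ηs > 0, ∃ kRs > 0, ∀ kR > 0, kR < kRs → ∃ K ≥ 0, ∃ q > 0, q < 1 ∧
      ∀ φ : HybridArc State, (D.closedLoop kR).IsSolution φ → φ.val 0 0 ∈ D.basin ε ηs →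
      ∀ t j, (t, j) ∈ φ.dom →
      attDist (D.err (φ.val t j)).1 ^ 2 + enorm2 (D.err (φ.val t j)).2.1 ^ 2 ≤
        K * q ^ (j - 1) * (attDist (D.err (φ.val 0 0)).1 ^ 2 +
          enorm2 (D.err (φ.val 0 0)).2.1 ^ 2) := by
  have hς := ςM_pos hk hp
  have hM := D.transpose_M
  obtain ⟨hl, hlL, hPl, hPL⟩ := spectrum_bounds (D.posDef_Mbar hk hp)
  have hςe : D.ςM = sInf (spectrum ℝ D.Mbar) / sSup (spectrum ℝ D.Mbar) := rfl
  set l := sInf (spectrum ℝ D.Mbar)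
  set L := sSup (spectrum ℝ D.Mbar)
  rw [D.Mbar_eq] at hPl hPL
  have hL : 0 < L := hl.trans_le hlL
  obtain ⟨hTm, hTmM⟩ := hT
  have hTM : 0 < D.TM := hTm.trans_le hTmM
  have hF := frobSq_nonneg D.M
  have hF' := Real.sqrt_nonneg (frobSq D.M)
  have hsς : 0 < Real.sqrt D.ςM := Real.sqrt_pos.2 hς
  -- Starting at `ε √ς_M`, the first flow may move the attitude by at most `T_M η*/2 = (1 - ε) √ς_M
  -- / 2`, hence to `e √ς_M` with `e` the midpoint of `ε` and `1`.
  obtain ⟨e, he⟩ : ∃ e, e = (1 + ε) / 2 := ⟨_, rfl⟩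
  have he0 : 0 ≤ e := by linarith
  have he1 : e < 1 := by linarith
  have he2 : 0 < 1 - e ^ 2 := by nlinarith
  refine ⟨(1 - ε) * Real.sqrt D.ςM / D.TM, div_pos (mul_pos (by linarith) hsς) hTM,
    1 / (4 * Real.sqrt (frobSq D.M) * D.TM + 1), by positivity, fun kR hkR hkRs => ?_⟩
  have hkT : 4 * Real.sqrt (frobSq D.M) * D.TM * kR ≤ 1 := by
    rw [lt_div_iff₀ (by positivity)] at hkRs
    linarith
  obtain ⟨c, hc⟩ : ∃ c, c = 2 * l ^ 2 / L * (1 - e ^ 2) := ⟨_, rfl⟩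
  have hc0 : 0 < c := by rw [hc]; positivity
  -- The maximum with `1/2` ensures a positive rate.
  obtain ⟨γ, hγ⟩ : ∃ γ, γ = max (1 - kR / 2 * D.Tm * c) (1 / 2) := ⟨_, rfl⟩
  have hγ0 : 0 < γ := hγ ▸ lt_max_of_lt_right (by norm_num)
  have hγ1 : γ < 1 := by
    rw [hγ]
    refine max_lt ?_ (by norm_num)
    have : 0 < kR / 2 * D.Tm * c := by positivity
    linarith
  have hγρ : 1 - kR / 2 * D.Tm * c ≤ γ := hγ ▸ le_max_left _ _
  refine ⟨3 + D.TM ^ 2 + (1 + 16 * frobSq D.M * kR ^ 2) * (L / l * (2 + D.TM ^ 2)),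
    by positivity, γ, hγ0, hγ1, fun φ hφ hb t j htj => ?_⟩
  obtain ⟨s, hs⟩ := hφ.timeDomain.exists_jumpSeq htj
  obtain ⟨hb1, hb2⟩ := hb
  rw [err_eq] at hb1 hb2
  rw [err_eq, err_eq]
  simp only at hb1 hb2 ⊢
  set a₀ := attDist (attErr (φ.val 0 0)) with ha₀
  set n₀ := enorm2 (φ.val 0 0).2.2.2.2.1 with hn₀
  have ha₀0 : 0 ≤ a₀ := attDist_nonneg _
  have hn₀0 : 0 ≤ n₀ := enorm2_nonneg _
  set X := a₀ ^ 2 + n₀ ^ 2 with hX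
  have hX0 : 0 ≤ X := by positivity
  have hsum : a₀ + D.TM * n₀ / 2 ≤ Real.sqrt D.ςM * e := by
    have : D.TM * n₀ ≤ (1 - ε) * Real.sqrt D.ςM := by
      rw [le_div_iff₀ hTM] at hb2
      linarith
    rw [he]; linarith
  have hsumX : (a₀ + D.TM * n₀ / 2) ^ 2 ≤ (2 + D.TM ^ 2) * X := by
    have h1 : (a₀ + D.TM * n₀ / 2) ^ 2 ≤ 2 * a₀ ^ 2 + 2 * (D.TM * n₀ / 2) ^ 2 := by
      nlinarith [sq_nonneg (a₀ - D.TM * n₀ / 2)]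
    have h2 : 0 ≤ D.TM ^ 2 * a₀ ^ 2 := by positivity
    have h3 : 0 ≤ D.TM ^ 2 * n₀ ^ 2 := by positivity
    rw [hX]
    nlinarith [sq_nonneg n₀]
  have hfirst : ∀ {r}, D.FlowsOn (fun r => φ.val r 0) 0 r → r ≤ D.TM →
      attDist (attErr (φ.val r 0)) ≤ a₀ + D.TM * n₀ / 2 := fun {r} hr hrT => by
    have h1 := hr.attDist_le
    have h2 : (r - 0) * n₀ ≤ D.TM * n₀ := mul_le_mul_of_nonneg_right (by linarith) hn₀0
    linarith
  -- After the first jump `η` matches the innovation, the potential lies below the level of the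
  -- gradient inequality, and it decays geometrically. The induction carries all three.
  have hstart : ∀ i, i + 1 ≤ j → attErr (φ.val (s (i + 1)) (i + 1)) ∈ SO3 ∧
      (φ.val (s (i + 1)) (i + 1)).2.2.2.2.1 =
        kR • sig D.M (attErr (φ.val (s (i + 1)) (i + 1))) ∧
      pot D.M (attErr (φ.val (s (i + 1)) (i + 1))) ≤ 2 * l * e ^ 2 ∧
      pot D.M (attErr (φ.val (s (i + 1)) (i + 1))) ≤ γ ^ i * (2 * L * ((2 + D.TM ^ 2) * X)) := by
    intro i
    induction i with
    | zero =>
      intro hi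
      have hc := isCycle hTM.le hφ hs hi
      have hle := hc.length_le
      have hm := hc.flow.attErr_mem (r := s (0 + 1)) ⟨hc.flow.le, le_rfl⟩
      have hf := hc.flow
      simp only [hs.zero] at hf hle
      have h1 := hfirst hf (by linarith)
      rw [jump_eta hk1 hc.jump, jump_attErr hc.jump]
      have h2 := pot_le hm hPL
      have h3 := attDist_nonneg (attErr (φ.val (s (0 + 1)) 0))
      refine ⟨hm, rfl, h2.trans ?_, h2.trans ?_⟩
      -- `2 L ς_M e² = 2 l e²`: the factor `ς_M` exactly compensates the gap between the two bounds
      -- of the potential.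
      · have h4 := pow_le_pow_left₀ h3 (h1.trans hsum) 2
        rw [mul_pow, Real.sq_sqrt hς.le] at h4
        calc 2 * L * attDist (attErr (φ.val (s (0 + 1)) 0)) ^ 2 ≤ 2 * L * (D.ςM * e ^ 2) :=
              mul_le_mul_of_nonneg_left h4 (by positivity)
          _ = _ := by rw [hςe]; field_simp
      · rw [pow_zero, one_mul]
        exact mul_le_mul_of_nonneg_left ((pow_le_pow_left₀ h3 h1 2).trans hsumX) (by positivity)
    | succ i ih =>
      intro hi
      obtain ⟨hm, hη, hp1, hp2⟩ := ih (by omega)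
      have hc' := isCycle hTM.le hφ hs hi
      have hlen := le_length hTM.le hφ hs hi
      have hm' := hc'.flow.attErr_mem (r := s (i + 1 + 1)) ⟨hc'.flow.le, le_rfl⟩
      rw [jump_eta hk1 hc'.jump, jump_attErr hc'.jump]
      have h1 := hc'.flow.pot_le_sub hM hkR.le hc'.length_le hkT hη
      have h2 := mul_pot_le_sig_sq hM hm hl hL hPl hPL he0 he1 hp1
      rw [← hc] at h2
      have h3 : 0 ≤ pot D.M (attErr (φ.val (s (i + 1)) (i + 1))) :=
        le_trans (by positivity) (le_pot hm hPl)
      have h4 : kR / 2 * D.Tm * (c * pot D.M (attErr (φ.val (s (i + 1)) (i + 1)))) ≤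
          kR / 2 * (s (i + 1 + 1) - s (i + 1)) *
            (sig D.M (attErr (φ.val (s (i + 1)) (i + 1))) ⬝ᵥ
              sig D.M (attErr (φ.val (s (i + 1)) (i + 1)))) :=
        mul_le_mul (mul_le_mul_of_nonneg_left hlen (by positivity)) h2 (by positivity)
          (mul_nonneg (by positivity) (hTm.le.trans hlen))
      have h5 : pot D.M (attErr (φ.val (s (i + 1 + 1)) (i + 1))) ≤
          γ * pot D.M (attErr (φ.val (s (i + 1)) (i + 1))) := by
        have := mul_le_mul_of_nonneg_right hγρ h3
        linarith
      refine ⟨hm', rfl, ?_, ?_⟩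
      · exact h5.trans ((mul_le_of_le_one_left h3 hγ1.le).trans hp1)
      · rw [pow_succ']
        have := mul_le_mul_of_nonneg_left hp2 hγ0.le
        linarith
  have hlast := flowsOn_last hφ hs
  have hlen := length_last_le hTM.le hφ hs
  have htm := hlast.attErr_mem (r := t) ⟨hs.le, le_rfl⟩
  have hηt := hlast.eta_eq t ⟨hs.le, le_rfl⟩
  have hC : 0 ≤ (1 + 16 * frobSq D.M * kR ^ 2) * (L / l * (2 + D.TM ^ 2)) := by positivity
  -- Before the first jump `η` is still the initial value and the direct bound of the motion
  -- suffices. Afterwards the potential bounds the attitude error, and the norm of `η = k_R σ` is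
  -- controlled by that error at the last jump.
  rcases j with _ | i
  · rw [hs.zero] at hlast hlen hηt
    have h1 := pow_le_pow_left₀ (attDist_nonneg _) (hfirst hlast (by linarith)) 2
    have h3 := mul_nonneg hC hX0
    rw [hηt, ← hn₀]
    simp only [Nat.zero_sub, pow_zero, mul_one]
    have h4 : n₀ ^ 2 ≤ X := le_add_of_nonneg_left (sq_nonneg a₀)
    linarith
  · obtain ⟨hm, hη, hp1, hp2⟩ := hstart i le_rfl
    have h1 := hlast.pot_le_sub hM hkR.le hlen hkT hη
    have h2 : pot D.M (attErr (φ.val t (i + 1))) ≤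
        pot D.M (attErr (φ.val (s (i + 1)) (i + 1))) := by
      have : 0 ≤ kR / 2 * (t - s (i + 1)) * (sig D.M (attErr (φ.val (s (i + 1)) (i + 1))) ⬝ᵥ
          sig D.M (attErr (φ.val (s (i + 1)) (i + 1)))) :=
        mul_nonneg (mul_nonneg (by positivity) (sub_nonneg.2 hs.le)) (dotProduct_self_nonneg' _)
      linarith
    have h3 := attDist_sq_le_of_pot_le htm hl hPl (h2.trans hp2)
    have h4 := attDist_sq_le_of_pot_le hm hl hPl hp2
    have h5 := sig_sq_le_attDist hM hm
    have h6 : enorm2 (φ.val t (i + 1)).2.2.2.2.1 ^ 2 = kR ^ 2 *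
        (sig D.M (attErr (φ.val (s (i + 1)) (i + 1))) ⬝ᵥ
          sig D.M (attErr (φ.val (s (i + 1)) (i + 1)))) := by
      rw [enorm2_sq, hηt, hη, smul_dot_self]
    have h7 : γ ^ i * (2 * L * ((2 + D.TM ^ 2) * X)) / (2 * l) =
        γ ^ i * X * (L / l * (2 + D.TM ^ 2)) := by field_simp
    rw [h7] at h3 h4
    rw [h6, Nat.add_sub_cancel]
    have h8 : kR ^ 2 * (sig D.M (attErr (φ.val (s (i + 1)) (i + 1))) ⬝ᵥ
        sig D.M (attErr (φ.val (s (i + 1)) (i + 1)))) ≤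
        kR ^ 2 * (16 * frobSq D.M * (γ ^ i * X * (L / l * (2 + D.TM ^ 2)))) :=
      mul_le_mul_of_nonneg_left (h5.trans (mul_le_mul_of_nonneg_left h4 (by positivity)))
        (by positivity)
    have h9 : 0 ≤ (3 + D.TM ^ 2) * (γ ^ i * X) := by positivity
    linarith

/-! ### The distance to the target set -/

/-- The nearest point of the target has the same timer value, which is admissible. -/
theorem distToSet_target_err {z : State} (hτ : z.2.2.2.2.2.2.2.2.2 ∈ Icc 0 D.TM) :
    distToSet D.target (D.err z) = Real.sqrt (attDist (D.err z).1 ^ 2 +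
      enorm2 (D.err z).2.1 ^ 2 + enorm2 (D.err z).2.2.1 ^ 2) := by
  refine IsLeast.csInf_eq ⟨⟨(1, 0, 0, (D.err z).2.2.2), ⟨rfl, rfl, rfl, hτ⟩, ?_⟩, ?_⟩
  · simp [errDist]
  · rintro _ ⟨⟨R, η, x, τ⟩, ⟨h1, h2, h3, -⟩, rfl⟩
    subst h1 h2 h3
    refine Real.sqrt_le_sqrt ?_
    simp only [transpose_one, Matrix.mul_one, sub_zero]
    exact le_add_of_nonneg_right (sq_nonneg _)

theorem mem_basin_of_distToSet_lt {z : State} (hτ : z.2.2.2.2.2.2.2.2.2 ∈ Icc 0 D.TM)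
    {ε ηs μ : ℝ} (h : distToSet D.target (D.err z) < μ) (h1 : μ ≤ ε * Real.sqrt D.ςM)
    (h2 : μ ≤ ηs) : z ∈ D.basin ε ηs := by
  rw [distToSet_target_err hτ] at h
  refine ⟨?_, ?_⟩
  · refine le_trans (Real.le_sqrt_of_sq_le ?_) (h.le.trans h1)
    nlinarith [sq_nonneg (enorm2 (D.err z).2.1), sq_nonneg (enorm2 (D.err z).2.2.1)]
  · refine le_trans (Real.le_sqrt_of_sq_le ?_) (h.le.trans h2)
    nlinarith [sq_nonneg (attDist (D.err z).1), sq_nonneg (enorm2 (D.err z).2.2.1)]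

/-- A geometric bound in the number of jumps is an exponential bound in hybrid time. -/
theorem exists_exp_bound {K q T : ℝ} (hK : 0 ≤ K) (hq : 0 < q) (hq1 : q < 1) (hT : 0 ≤ T) :
    ∃ κ > 0, ∃ lam > 0, ∀ (t : ℝ) (j : ℕ), t ≤ (j + 1) * T →
      Real.sqrt (K * q ^ (j - 1)) ≤ κ * Real.exp (-lam * (t + j)) := by
  have hlog : Real.log q < 0 := Real.log_neg hq hq1
  -- The half accounts for the square root. From `t + j ≤ (T + 1)(j + 1)` the rate per unit of
  -- hybrid time is `m / (T + 1)`; the factor `exp (2m)` absorbs the shift between `j - 1` and `j +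
  -- 1`.
  obtain ⟨m, hm⟩ : ∃ m, m = -Real.log q / 2 := ⟨_, rfl⟩
  have hm0 : 0 < m := by linarith
  refine ⟨(Real.sqrt K + 1) * Real.exp (2 * m), by positivity, m / (T + 1), by positivity,
    fun t j ht => ?_⟩
  have hj : (j : ℝ) - 1 ≤ ((j - 1 : ℕ) : ℝ) := by
    rcases j with _ | j
    · simp
    · simp
  have h1 : Real.sqrt (q ^ (j - 1)) ≤ Real.exp (2 * m + -(m / (T + 1)) * (t + j)) := by
    have h2 : q ^ (j - 1) = Real.exp (-(m * ((j - 1 : ℕ) : ℝ))) ^ 2 := by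
      rw [← Real.exp_nat_mul, ← Real.exp_log hq, ← Real.exp_nat_mul, hm]
      congr 1
      push_cast
      ring
    rw [h2, Real.sqrt_sq (Real.exp_pos _).le, Real.exp_le_exp]
    have h3 : m / (T + 1) * (t + j) ≤ m * (j + 1) := by
      rw [div_mul_eq_mul_div, div_le_iff₀ (by linarith), mul_assoc]
      refine mul_le_mul_of_nonneg_left ?_ hm0.le
      nlinarith
    have h4 := mul_le_mul_of_nonneg_left hj hm0.le
    linarith
  rw [Real.sqrt_mul hK, mul_assoc, ← Real.exp_add]
  exact mul_le_mul (by linarith) h1 (Real.sqrt_nonneg _) (by positivity)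

end Setup

/-! ### Combination of both decays -/

namespace Setup
variable {N : ℕ} {D : Setup N}

theorem exists_errorExponentiallyStable
    (hT : 0 < D.Tm ∧ D.Tm ≤ D.TM)
    (hk : ∀ i, 0 < D.k i) (hk1 : ∑ i, D.k i = 1)
    (hp : ∃ i₁ i₂ i₃ : Fin N, ¬ Collinear ℝ {D.p i₁, D.p i₂, D.p i₃})
    (ha : LocallyIntegrableOn D.a (Ici 0)) (hω : ContinuousOn D.ω (Ici 0))
    (hV : ContinuousOn D.V (Ici 0)) (hVb : BoundedMat D.V) (hVpos : UniformlyPosDef D.V)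
    (hQb : BoundedMat D.Q) (hQpos : UniformlyPosDef D.Q) (hP₀ : D.P₀.PosDef)
    {ε : ℝ} (hε : 0 < ε) (hε1 : ε < 1) :
    ∃ ηs > (0 : ℝ), ∃ kRs > (0 : ℝ), ∀ kR : ℝ, 0 < kR → kR < kRs →
      D.ErrorExponentiallyStable kR ε ηs := by
  obtain ⟨vl, vu, qu, hN⟩ := exists_noiseBounds hVb hVpos hQb hQpos
  obtain ⟨K₁, hK₁, q₁, hq₁, hq₁1, hx⟩ := exists_translation_decay hN hT hk1 hP₀
  obtain ⟨ηs, hηs, kRs, hkRs, hatt⟩ := exists_attitude_decay hT hk hk1 hp hε hε1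
  refine ⟨ηs, hηs, kRs, hkRs, fun kR hkR hkR' => ?_⟩
  obtain ⟨K₂, hK₂, q₂, hq₂, hq₂1, hatt⟩ := hatt kR hkR hkR'
  have hTM : 0 ≤ D.TM := hT.1.le.trans hT.2
  have hq : 0 < max q₁ q₂ := lt_max_of_lt_left hq₁
  obtain ⟨κ, hκ, lam, hlam, hexp⟩ := exists_exp_bound (K := K₁ + K₂) (by positivity) hq
    (max_lt hq₁1 hq₂1) hTM
  have hς := Real.sqrt_pos.2 (ςM_pos hk hp)
  -- With this radius every start near the target already lies in the basin, so one estimate serves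
  -- both alternatives. The squared attitude and translational bounds add because neither depends on
  -- the other.
  refine ⟨κ, hκ, lam, hlam, min (ε * Real.sqrt D.ςM) ηs, lt_min (by positivity) hηs,
    fun φ hφ hP hstart => ⟨isComplete_of_isMaximalSolution hT ha hω hV hφ, ?_⟩⟩
  have hsol := hφ.1
  have hτ0 := timer_mem hsol hTM hsol.timeDomain.1
  have hbasin : φ.val 0 0 ∈ D.basin ε ηs := hstart.elim
    (fun h => mem_basin_of_distToSet_lt hτ0 h (min_le_left _ _) (min_le_right _ _)) id
  rintro ⟨t, j⟩ htj
  obtain ⟨s, hs⟩ := hsol.timeDomain.exists_jumpSeq htj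
  have h1 := hx kR φ hsol hP t j htj
  have h2 := hatt φ hsol hbasin t j htj
  have h3 := hexp t j (time_le hTM hsol hs)
  simp only
  rw [distToSet_target_err hτ0, distToSet_target_err (timer_mem hsol hTM htj)]
  refine le_trans ?_ (mul_le_mul_of_nonneg_right h3 (Real.sqrt_nonneg _))
  rw [← Real.sqrt_mul (by positivity)]
  refine Real.sqrt_le_sqrt ?_
  have hp₁ : K₁ * q₁ ^ (j - 1) ≤ (K₁ + K₂) * max q₁ q₂ ^ (j - 1) :=
    mul_le_mul (by linarith) (pow_le_pow_left₀ hq₁.le (le_max_left _ _) _) (by positivity)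
      (by positivity)
  have hp₂ : K₂ * q₂ ^ (j - 1) ≤ (K₁ + K₂) * max q₁ q₂ ^ (j - 1) :=
    mul_le_mul (by linarith) (pow_le_pow_left₀ hq₂.le (le_max_right _ _) _) (by positivity)
      (by positivity)
  have h4 := mul_le_mul_of_nonneg_right hp₁ (sq_nonneg (enorm2 (D.err (φ.val 0 0)).2.2.1))
  have h5 := mul_le_mul_of_nonneg_right hp₂ (add_nonneg (sq_nonneg (attDist (D.err (φ.val 0 0)).1))
    (sq_nonneg (enorm2 (D.err (φ.val 0 0)).2.1)))
  linarith

end Setup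
end HybridNav
theorem theorem4 {N : ℕ} (D : HybridNav.Setup N)
    (hT : 0 < D.Tm ∧ D.Tm ≤ D.TM)
    (hk : ∀ i, 0 < D.k i) (hk1 : ∑ i, D.k i = 1)
    (hp : ∃ i₁ i₂ i₃ : Fin N, ¬ Collinear ℝ {D.p i₁, D.p i₂, D.p i₃})
    (ha : MeasureTheory.LocallyIntegrableOn D.a (Set.Ici 0))
    (hω : ContinuousOn D.ω (Set.Ici 0)) (hωb : ∃ b : ℝ, ∀ t ≥ (0 : ℝ), HybridNav.enorm2 (D.ω t) ≤ b)
    (hV : ContinuousOn D.V (Set.Ici 0)) (hVb : HybridNav.BoundedMat D.V)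
    (hVpos : HybridNav.UniformlyPosDef D.V)
    (hQb : HybridNav.BoundedMat D.Q) (hQpos : HybridNav.UniformlyPosDef D.Q)
    (hP₀ : D.P₀.PosDef) :
    ∀ ε : ℝ, 0 < ε → ε < 1 →
      ∃ ηs > (0 : ℝ), ∃ kRs > (0 : ℝ), ∀ kR : ℝ, 0 < kR → kR < kRs →
        D.ErrorExponentiallyStable kR ε ηs := by
  intro ε hε hε1
  exact HybridNav.Setup.exists_errorExponentiallyStable hT hk hk1 hp ha hω hV hVb hVpos hQb hQpos hP₀
    hε hε1
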